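/- Let $\mathbb{R}^3_-=\{x\in\mathbb{R}^3: x_3<0\}$, $\varrho(x)=(1+|x|^2)^{1/2}$, and let $H^1_0(\mathbb{R}^3_-)$ be the weighted Sobolev space of functions $f$ with $\varrho^{-1}f\in L^2(\mathbb{R}^3_-)$ and weak gradient $\nabla f\in L^2(\mathbb{R}^3_-)$ (no boundary condition), with norm $\|f\|^2_{H^1_0}=\|\varrho^{-1}f\|_{L^2}^2+\|\nabla f\|_{L^2}^2$, taken componentwise for vector fields. Write $\widehat A=\frac12(A+A^T)$ and let $\widehat\nabla u$ be the symmetric part of $\nabla u$. Let $\mathbb{C}(x)A=\lambda(x)\,\mathrm{tr}(A)I+2\mu(x)\widehat A$, where $\lambda,\mu$ are functions on $\mathbb{R}^3_-$ with $$\|\mu\|_{C^{0,1}(\mathbb{R}^3_-)}+\|\lambda\|_{C^{0,1}(\mathbb{R}^3_-)}\le K,\qquad \mu\ge\alpha_0>0,\qquad 3\lambda+2\mu\ge\beta_0>0 \quad\text{on } \mathbb{R}^3_-,$$ where $\|f\|_{C^{0,1}}=\|f\|_{L^\infty}+\|\nabla f\|_{L^\infty}$. For $y\in\mathbb{R}^3_-$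 and $k\in\{1,2,3\}$, a $k$-th column of a Neumann function with pole $y$ for $\mathbb{C}$ is a weakly differentiable vector field $N$ on $\mathbb{R}^3_-$ (that is, $N$ and its weak gradient are locally integrable), with $\varrho^{-1}N,\nabla N\in L^2(\mathbb{R}^3_-\setminus B_r(y))$ for every $r>0$, that solves $\mathrm{div}(\mathbb{C}\widehat\nabla N)=e_k\delta_y$ in $\mathbb{R}^3_-$ and $(\mathbb{C}\widehat\nabla N)e_3=0$ on $\{x_3=0\}$ in the sense that $$\int_{\mathbb{R}^3_-}\mathbb{C}\widehat\nabla N:\widehat\nabla\varphi\,dx=-\varphi_k(y)\qquad\text{for all }\varphi\in C_c^\infty(\mathbb{R}^3;\mathbb{R}^3).$$ There is a constant $C>0$, depending only on $\alpha_0,\beta_0,K$, such that for all such $\lambda,\mu$, every $y\in\mathbb{R}^3_-$ and every $k\in\{1,2,3\}$ the following hold. (a) A $k$-th column $\widetilde N^{(k)}$ of a Neumann function with pole $y$ for the constant tensor $\mathbb{C}(y)$ exists. (b) For any such $\widetilde N^{(k)}$, the tensor field $F_{y,k}(x)=(\mathbb{C}(x)-\mathbb{C}(y))\widehat\nabla\widetilde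 N^{(k)}(x)$ belongs to $L^2(\mathbb{R}^3_-)$. (c) For any such $\widetilde N^{(k)}$, the boundary value problem $\mathrm{div}(\mathbb{C}\widehat\nabla M^{(k)})=-\mathrm{div}\,F_{y,k}$ in $\mathbb{R}^3_-$, $\ (\mathbb{C}\widehat\nabla M^{(k)})e_3=-F_{y,k}e_3=-(\mathbb{C}\widehat\nabla\widetilde N^{(k)})e_3$ on $\{x_3=0\}$, understood in the variational sense $$\int_{\mathbb{R}^3_-}\mathbb{C}\widehat\nabla M^{(k)}:\widehat\nabla v\,dx=-\int_{\mathbb{R}^3_-}F_{y,k}:\widehat\nabla v\,dx\qquad\text{for all } v\in H^1_0(\mathbb{R}^3_-),$$ has a unique solution $M^{(k)}\in H^1_0(\mathbb{R}^3_-)$, and $\|M^{(k)}\|_{H^1_0(\mathbb{R}^3_-)}\le C\,\|F_{y,k}\|_{L^2(\mathbb{R}^3_-)}$. In particular the matrix $M=[M^{(1)}\,M^{(2)}\,M^{(3)}]$ is in $H^1_0(\mathbb{R}^3_-)$. (d) $N^{(k)}=\widetilde N^{(k)}+M^{(k)}$ is a $k$-th column of a Neumann function with pole $y$ for $\mathbb{C}$,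 and (up to almost everywhere equality) it is the only one for which $N^{(k)}-\widetilde N^{(k)}\in H^1_0(\mathbb{R}^3_-)$. -/

import Mathlib

open MeasureTheory Set
open scoped ENNReal ContDiff Matrix

noncomputable section

namespace HalfSpaceLame

/-- Three-dimensional Euclidean space. -/
abbrev E3 : Type := EuclideanSpace ℝ (Fin 3)

/-- The open lower half-space, where the third coordinate is negative. -/
def lowerHalfSpace : Set E3 := {x | x 2 < 0}

/-- The restriction of Lebesgue measure to the lower half-space. -/
def halfVol : Measure E3 := volume.restrict lowerHalfSpace

/-- The weight `(1 + |x|²)^(1/2)`. -/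
def weight (x : E3) : ℝ := Real.sqrt (1 + ‖x‖ ^ 2)

/-! ### Tensors -/

/-- The symmetric part of a second-order tensor. -/
def symPart (A : Matrix (Fin 3) (Fin 3) ℝ) : Matrix (Fin 3) (Fin 3) ℝ :=
  (1 / 2 : ℝ) • (A + Aᵀ)

/-- The inner product `A : B` of second-order tensors. -/
def frobInner (A B : Matrix (Fin 3) (Fin 3) ℝ) : ℝ := ∑ i, ∑ j, A i j * B i j

/-- The isotropic elasticity tensor with Lamé parameters `l` and `m`, acting on
second-order tensors. -/
def lameTensor (l m : ℝ) (A : Matrix (Fin 3) (Fin 3) ℝ) : Matrix (Fin 3) (Fin 3) ℝ :=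
  (l * A.trace) • (1 : Matrix (Fin 3) (Fin 3) ℝ) + (2 * m) • symPart A

/-! ### Test functions and weak derivatives -/

/-- Smooth functions with compact support in the whole space. Their restrictions to the
half-space are the functions that are smooth up to the boundary and have bounded support. -/
def IsTestFunction (φ : E3 → ℝ) : Prop := ContDiff ℝ ∞ φ ∧ HasCompactSupport φ

/-- The classical partial derivative in the `j`-th coordinate direction. -/
def classicalPartial (j : Fin 3) (φ : E3 → ℝ) (x : E3) : ℝ :=
  fderiv ℝ φ x (EuclideanSpace.single j 1)

/-- `g` is the weak `j`-th partial derivative of `f` in the half-space: both are locally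
integrable there, and the integration by parts formula holds against every smooth function
with compact support inside the open half-space. -/
def HasWeakPartial (j : Fin 3) (f g : E3 → ℝ) : Prop :=
  LocallyIntegrableOn f lowerHalfSpace ∧ LocallyIntegrableOn g lowerHalfSpace ∧
    ∀ φ : E3 → ℝ, IsTestFunction φ → tsupport φ ⊆ lowerHalfSpace →
      ∫ x, f x * classicalPartial j φ x ∂halfVol = - ∫ x, g x * φ x ∂halfVol

/-- All first-order weak partial derivatives exist as locally integrable functions. -/
def WeaklyDifferentiable (f : E3 → ℝ) : Prop := ∀ j, ∃ g, HasWeakPartial j f g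

open Classical in
/-- The weak `j`-th partial derivative in the half-space (determined almost everywhere). -/
def weakPartial (j : Fin 3) (f : E3 → ℝ) : E3 → ℝ :=
  if h : ∃ g, HasWeakPartial j f g then h.choose else 0

/-- The weak gradient `(∇u)ᵢⱼ = ∂ⱼuᵢ` of a vector field in the half-space. -/
def weakGrad (u : Fin 3 → E3 → ℝ) (x : E3) : Matrix (Fin 3) (Fin 3) ℝ :=
  Matrix.of fun i j => weakPartial j (u i) x

/-- The classical gradient of a vector field. -/
def classicalGrad (φ : Fin 3 → E3 → ℝ) (x : E3) : Matrix (Fin 3) (Fin 3) ℝ :=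
  Matrix.of fun i j => classicalPartial j (φ i) x

/-- The deformation tensor: the symmetric part of the weak gradient. -/
def strain (u : Fin 3 → E3 → ℝ) (x : E3) : Matrix (Fin 3) (Fin 3) ℝ := symPart (weakGrad u x)

/-! ### Function spaces and norms -/

/-- Membership of a scalar function in the weighted Sobolev space `H¹₀` of the half-space
(order of differentiability one, weight exponent zero; no boundary condition). -/
structure MemH10 (f : E3 → ℝ) : Prop where
  weaklyDifferentiable : WeaklyDifferentiable f
  memLp_weight : MemLp (fun x => (weight x)⁻¹ * f x) 2 halfVol
  memLp_partial : ∀ j, MemLp (weakPartial j f) 2 halfVol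

/-- Membership of a vector field in `H¹₀`: every component is in `H¹₀`. -/
def VecMemH10 (u : Fin 3 → E3 → ℝ) : Prop := ∀ i, MemH10 (u i)

/-- The `H¹₀` norm of a vector field (meaningful for members of `H¹₀`). -/
def h10Norm (u : Fin 3 → E3 → ℝ) : ℝ :=
  Real.sqrt (∑ i, (∫ x, ((weight x)⁻¹ * u i x) ^ 2 ∂halfVol +
    ∑ j, ∫ x, (weakPartial j (u i) x) ^ 2 ∂halfVol))

/-- Square integrability of a tensor field over the half-space. -/
def TensorMemL2 (F : E3 → Matrix (Fin 3) (Fin 3) ℝ) : Prop :=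
  ∀ i j, MemLp (fun x => F x i j) 2 halfVol

/-- The `L²` norm of a tensor field (meaningful for square integrable fields). -/
def tensorL2Norm (F : E3 → Matrix (Fin 3) (Fin 3) ℝ) : ℝ :=
  Real.sqrt (∫ x, frobInner (F x) (F x) ∂halfVol)

/-- The `C^{0,1}` norm on the half-space: supremum norm plus best Lipschitz constant. As the
half-space is convex, the latter is the `L^∞` norm of the gradient. -/
def c01Norm (f : E3 → ℝ) : ℝ≥0∞ :=
  (⨆ x ∈ lowerHalfSpace, ‖f x‖ₑ) +
    ⨆ x ∈ lowerHalfSpace, ⨆ y ∈ lowerHalfSpace, edist (f x) (f y) / edist x y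

/-! ### The Lamé system -/

/-- The Lamé parameters have `C^{0,1}` norms that add up to at most `K`, and satisfy the strong
convexity condition with constants `α₀` and `β₀`. -/
structure AdmissibleLame (α₀ β₀ K : ℝ) (lam mu : E3 → ℝ) : Prop where
  lipschitz : c01Norm mu + c01Norm lam ≤ ENNReal.ofReal K
  mu_ge : ∀ x ∈ lowerHalfSpace, α₀ ≤ mu x
  bulk_ge : ∀ x ∈ lowerHalfSpace, β₀ ≤ 3 * lam x + 2 * mu x

/-- `N` is the `k`-th column of a Neumann function with pole `y` for the Lamé system with
parameters `lam`, `mu` in the half-space: `N` is weakly differentiable with locally integrable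
derivatives, it is in the weighted space `H¹₀` away from the pole, and it solves
`div (ℂ ∇̂N) = δ_y e_k` in the half-space and `(ℂ ∇̂N) e₃ = 0` on its boundary, in the sense of
distributions, with test fields that are smooth up to the boundary. -/
structure IsNeumannColumn (lam mu : E3 → ℝ) (y : E3) (k : Fin 3) (N : Fin 3 → E3 → ℝ) :
    Prop where
  weaklyDifferentiable : ∀ i, WeaklyDifferentiable (N i)
  memLp_weight : ∀ r : ℝ, 0 < r → ∀ i,
    MemLp (fun x => (weight x)⁻¹ * N i x) 2 (volume.restrict (lowerHalfSpace \ Metric.ball y r))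
  memLp_partial : ∀ r : ℝ, 0 < r → ∀ i j,
    MemLp (weakPartial j (N i)) 2 (volume.restrict (lowerHalfSpace \ Metric.ball y r))
  weak_eq : ∀ φ : Fin 3 → E3 → ℝ, (∀ i, IsTestFunction (φ i)) →
    ∫ x, frobInner (lameTensor (lam x) (mu x) (strain N x)) (symPart (classicalGrad φ x)) ∂halfVol
      = - φ k y

/-- The `k`-th column of a Neumann function for the Lamé system with the coefficients frozen
at the pole. -/
def IsFrozenNeumannColumn (lam mu : E3 → ℝ) (y : E3) (k : Fin 3) (N : Fin 3 → E3 → ℝ) : Prop :=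
  IsNeumannColumn (fun _ => lam y) (fun _ => mu y) y k N

/-- The tensor field `(ℂ(x) - ℂ(y)) ∇̂N(x)`. -/
def frozenDefect (lam mu : E3 → ℝ) (y : E3) (N : Fin 3 → E3 → ℝ) (x : E3) :
    Matrix (Fin 3) (Fin 3) ℝ :=
  lameTensor (lam x) (mu x) (strain N x) - lameTensor (lam y) (mu y) (strain N x)

/-- `w` is a variational solution in `H¹₀` of `div (ℂ ∇̂w + F) = 0` in the half-space with
`(ℂ ∇̂w + F) e₃ = 0` on its boundary. -/
def IsVariationalSolution (lam mu : E3 → ℝ) (F : E3 → Matrix (Fin 3) (Fin 3) ℝ)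
    (w : Fin 3 → E3 → ℝ) : Prop :=
  VecMemH10 w ∧ ∀ v : Fin 3 → E3 → ℝ, VecMemH10 v →
    ∫ x, frobInner (lameTensor (lam x) (mu x) (strain w x)) (strain v x) ∂halfVol
      = - ∫ x, frobInner (F x) (strain v x) ∂halfVol

end HalfSpaceLame

end

open HalfSpaceLame MeasureTheory

namespace HalfSpaceLame

/-! ### The half-space and the weight -/

/-! The whole argument rests on one coercivity estimate: on the weighted space, `‖u‖²` is at most
1260 times the integral of `|∇̂u|²` (`VecMemH10.korn_hardy_strain`). For test fields on all of
space, two integrations by parts give `∫|∇u|² + ∫(div u)² = 2 ∫|∇̂u|²` (Korn), and testing the field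
`x / (1 + |x|²)` against `φ²` gives Hardy's inequality with the weight `ϱ⁻²`. Both pass to the
weighted space by density. The half-space is reduced to the whole space by Nitsche's extension: two
scaled reflections across the boundary, with different coefficients for tangential and normal
components, chosen so that the strain of the extension is a combination of reflected strains of `u`,
with no other derivatives entering.

Together with the pointwise bound `ℂS : S ≥ min(2α₀, β₀) |S|²`, the Lax–Milgram theorem on the
closed space of jets `(ϱ⁻¹u, ∇u)` solves every variational problem with square integrable data
(`AdmissibleLame.exists_solution`). This gives existence, uniqueness and the estimate in (c), with a
constant that involves only `α₀` and `β₀`.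

For (a), the fundamental solution of the frozen system is found explicitly. Galerkin fields built on
`√(|x|² + e²)` are smooth and have a stress divergence proportional to `e⁴ (|x|² + e²)^(-7/2)`, an
approximate identity; letting `e` tend to zero yields a field of size `|x|⁻¹` with gradient of size
`|x|⁻²`. It is cut off inside the half-space, and a finite-energy field corrects the commutator
terms, which stay away from the pole (`exists_neumannColumn_const`).

For (b), the Lipschitz factor `ℂ(x) - ℂ(y)` lowers the singularity `|x - y|⁻²` of this particular
column to `|x - y|⁻¹`, which is locally square integrable in dimension three. An arbitrary frozen
column differs from it by a weak solution without source, known to have finite energy only away from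
the pole. Mollification gives smooth solutions nearby, and Caccioppoli's inequality bounds their
strain near the pole by values on an annulus, so the difference has square integrable strain
(`strain_memL2_of_weak_solution`).

For (d), the defect term produced by inserting the frozen column into the variable system is exactly
what the equation for `M` cancels. Conversely, if the difference of a Neumann column and the frozen
one lies in the weighted space, density of test fields turns its equation into the variational
problem, where uniqueness applies. -/

lemma isOpen_lowerHalfSpace : IsOpen lowerHalfSpace :=
  isOpen_lt (by fun_prop) continuous_const

lemma measurableSet_lowerHalfSpace : MeasurableSet lowerHalfSpace :=
  isOpen_lowerHalfSpace.measurableSet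

lemma weight_sq (x : E3) : weight x ^ 2 = 1 + ‖x‖ ^ 2 := Real.sq_sqrt (by positivity)

lemma weight_pos (x : E3) : 0 < weight x := Real.sqrt_pos.2 (by positivity)

lemma one_le_weight (x : E3) : 1 ≤ weight x := Real.one_le_sqrt.2 (by nlinarith [sq_nonneg ‖x‖])

lemma inv_weight_le_one (x : E3) : (weight x)⁻¹ ≤ 1 := inv_le_one_of_one_le₀ (one_le_weight x)

lemma continuous_weight : Continuous weight := by unfold weight; fun_prop

lemma continuous_inv_weight : Continuous fun x => (weight x)⁻¹ :=
  continuous_weight.inv₀ fun x => (weight_pos x).ne'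

/-! ### Classical partial derivatives and test functions -/

lemma classicalPartial_mul {f g : E3 → ℝ} {x : E3} (j : Fin 3) (hf : DifferentiableAt ℝ f x)
    (hg : DifferentiableAt ℝ g x) :
    classicalPartial j (fun y => f y * g y) x
      = f x * classicalPartial j g x + g x * classicalPartial j f x := by
  simp [classicalPartial, fderiv_fun_mul hf hg]

lemma classicalPartial_add {f g : E3 → ℝ} {x : E3} (j : Fin 3) (hf : DifferentiableAt ℝ f x)
    (hg : DifferentiableAt ℝ g x) :
    classicalPartial j (fun y => f y + g y) x
      = classicalPartial j f x + classicalPartial j g x := by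
  simp [classicalPartial, fderiv_fun_add hf hg]

lemma classicalPartial_sub {f g : E3 → ℝ} {x : E3} (j : Fin 3) (hf : DifferentiableAt ℝ f x)
    (hg : DifferentiableAt ℝ g x) :
    classicalPartial j (fun y => f y - g y) x
      = classicalPartial j f x - classicalPartial j g x := by
  simp [classicalPartial, fderiv_fun_sub hf hg]

lemma classicalPartial_const_mul {f : E3 → ℝ} {x : E3} (j : Fin 3) (c : ℝ)
    (hf : DifferentiableAt ℝ f x) :
    classicalPartial j (fun y => c * f y) x = c * classicalPartial j f x := by
  simp [classicalPartial, fderiv_const_mul hf]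

lemma classicalPartial_const (j : Fin 3) (c : ℝ) (x : E3) :
    classicalPartial j (fun _ => c) x = 0 := by
  simp [classicalPartial]

lemma contDiff_classicalPartial {f : E3 → ℝ} (hf : ContDiff ℝ ∞ f) (j : Fin 3) :
    ContDiff ℝ ∞ (classicalPartial j f) :=
  (hf.fderiv_right (m := ∞) (by simp)).clm_apply contDiff_const

lemma tsupport_classicalPartial_subset (f : E3 → ℝ) (j : Fin 3) :
    tsupport (classicalPartial j f) ⊆ tsupport f := by
  refine (closure_mono fun x hx => ?_).trans (tsupport_fderiv_subset ℝ (f := f))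
  contrapose! hx
  have : fderiv ℝ f x = 0 := by simpa using hx
  simp [classicalPartial, this]

lemma classicalPartial_eq_zero {f : E3 → ℝ} {x : E3} (j : Fin 3) (hx : x ∉ tsupport f) :
    classicalPartial j f x = 0 :=
  image_eq_zero_of_notMem_tsupport fun h => hx (tsupport_classicalPartial_subset f j h)

lemma classicalPartial_comm {f : E3 → ℝ} (hf : ContDiff ℝ ∞ f) (i j : Fin 3) (x : E3) :
    classicalPartial i (classicalPartial j f) x = classicalPartial j (classicalPartial i f) x := by
  have hd : DifferentiableAt ℝ (fderiv ℝ f) x :=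
    ((hf.fderiv_right (m := ∞) (by simp)).differentiable (by simp)).differentiableAt
  have key : ∀ i j : Fin 3, classicalPartial i (classicalPartial j f) x
      = fderiv ℝ (fderiv ℝ f) x (EuclideanSpace.single i 1) (EuclideanSpace.single j 1) := by
    intro i j
    have : classicalPartial j f = fun y => fderiv ℝ f y (EuclideanSpace.single j 1) := rfl
    rw [this, classicalPartial, fderiv_clm_apply hd (by fun_prop)]
    simp
  rw [key, key]
  exact (hf.contDiffAt.isSymmSndFDerivAt (by
    rw [minSmoothness_of_isRCLikeNormedField]; exact WithTop.coe_le_coe.2 (le_top : (2 : ℕ∞) ≤ ⊤))) _ _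

namespace IsTestFunction

variable {φ ψ : E3 → ℝ}

lemma differentiable (h : IsTestFunction φ) : Differentiable ℝ φ := h.1.differentiable (by simp)

lemma continuous (h : IsTestFunction φ) : Continuous φ := h.1.continuous

lemma zero : IsTestFunction fun _ => 0 := ⟨contDiff_const, HasCompactSupport.zero⟩

lemma add (h : IsTestFunction φ) (h' : IsTestFunction ψ) : IsTestFunction fun x => φ x + ψ x :=
  ⟨h.1.add h'.1, h.2.add h'.2⟩

lemma mul_left (h : IsTestFunction φ) (hψ : ContDiff ℝ ∞ ψ) :
    IsTestFunction fun x => ψ x * φ x :=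
  ⟨hψ.mul h.1, h.2.mul_left⟩

lemma mul_right (h : IsTestFunction φ) (hψ : ContDiff ℝ ∞ ψ) :
    IsTestFunction fun x => φ x * ψ x :=
  ⟨h.1.mul hψ, h.2.mul_right⟩

lemma const_mul (h : IsTestFunction φ) (c : ℝ) : IsTestFunction fun x => c * φ x :=
  h.mul_left contDiff_const

lemma classicalPartial (h : IsTestFunction φ) (j : Fin 3) :
    IsTestFunction (classicalPartial j φ) :=
  ⟨contDiff_classicalPartial h.1 j,
    h.2.of_isClosed_subset (isClosed_tsupport _) (tsupport_classicalPartial_subset φ j)⟩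

lemma memLp (h : IsTestFunction φ) (p : ℝ≥0∞) : MemLp φ p volume :=
  h.continuous.memLp_of_hasCompactSupport h.2

lemma memLp_half (h : IsTestFunction φ) (p : ℝ≥0∞) : MemLp φ p halfVol := (h.memLp p).restrict _

lemma integrable (h : IsTestFunction φ) : Integrable φ := h.continuous.integrable_of_hasCompactSupport h.2

lemma exists_bound (h : IsTestFunction φ) : ∃ C, 0 ≤ C ∧ ∀ x, |φ x| ≤ C := by
  obtain ⟨C, hC⟩ := h.2.exists_bound_of_continuous h.continuous
  exact ⟨C, (norm_nonneg _).trans (hC 0), hC⟩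

end IsTestFunction

lemma integral_mul_classicalPartial {f φ : E3 → ℝ} (hf : ContDiff ℝ ∞ f) (hφ : IsTestFunction φ)
    (j : Fin 3) :
    ∫ x, f x * classicalPartial j φ x = - ∫ x, classicalPartial j f x * φ x := by
  refine integral_mul_fderiv_eq_neg_fderiv_mul_of_integrable
    (hφ.mul_left (contDiff_classicalPartial hf j)).integrable
    ((hφ.classicalPartial j).mul_left hf).integrable
    (hφ.mul_left hf).integrable (fun x _ => ?_) (fun x _ => hφ.differentiable x)
  exact hf.differentiable (by simp) x

/-! ### Integrability of products -/

lemma integrable_mul_of_support {μ : Measure E3} {f φ : E3 → ℝ} {k : Set E3}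
    (hf : IntegrableOn f k μ) (hk : IsCompact k) (hφ : Continuous φ) (h0 : ∀ x ∉ k, φ x = 0) :
    Integrable (fun x => f x * φ x) μ :=
  (hf.mul_continuousOn hφ.continuousOn hk).integrable_of_forall_notMem_eq_zero
    fun x hx => by simp [h0 x hx]

lemma LocallyIntegrableOn.integrable_mul_test {f φ : E3 → ℝ} (hf : LocallyIntegrableOn f lowerHalfSpace)
    (hφ : Continuous φ) (hc : HasCompactSupport φ) (hs : tsupport φ ⊆ lowerHalfSpace) :
    Integrable (fun x => f x * φ x) halfVol :=
  (integrable_mul_of_support (hf.integrableOn_compact_subset hs hc) hc hφ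
    fun _ hx => image_eq_zero_of_notMem_tsupport hx).mono_measure Measure.restrict_le_self

/-- Integrals over the half-space of functions that vanish outside of it. -/
lemma integral_half_eq {f : E3 → ℝ} (hf : ∀ x ∉ lowerHalfSpace, f x = 0) :
    ∫ x, f x ∂halfVol = ∫ x, f x := setIntegral_eq_integral_of_forall_compl_eq_zero hf

lemma eq_zero_of_tsupport_subset {φ : E3 → ℝ} {s : Set E3} (h : tsupport φ ⊆ s) {x : E3} (hx : x ∉ s) :
    φ x = 0 := image_eq_zero_of_notMem_tsupport fun h' => hx (h h')

/-! ### Weak partial derivatives -/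

namespace HasWeakPartial

variable {j : Fin 3} {f f' g g' : E3 → ℝ}

/-- This is the fundamental lemma of the calculus of variations on the open half-space. -/
lemma ae_eq (h : HasWeakPartial j f g) (h' : HasWeakPartial j f g') : g =ᵐ[halfVol] g' := by
  have key := isOpen_lowerHalfSpace.ae_eq_zero_of_integral_contDiff_smul_eq_zero
    (f := fun x => g x - g' x) (μ := volume) (h.2.1.sub h'.2.1) ?_
  · refine (ae_restrict_iff' measurableSet_lowerHalfSpace).2 ?_
    filter_upwards [key] with x hx hxs using sub_eq_zero.1 (hx hxs)
  · intro φ hφ hc hs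
    have e := (h.2.2 φ ⟨hφ, hc⟩ hs).symm.trans (h'.2.2 φ ⟨hφ, hc⟩ hs)
    have i1 := LocallyIntegrableOn.integrable_mul_test h.2.1 hφ.continuous hc hs
    have i2 := LocallyIntegrableOn.integrable_mul_test h'.2.1 hφ.continuous hc hs
    rw [← integral_half_eq]
    · have : ∀ x, φ x • (g x - g' x) = g x * φ x - g' x * φ x := fun x => by
        simp only [smul_eq_mul]; ring
      simp only [this]
      rw [integral_sub i1 i2]
      linarith
    · intro x hx
      simp [eq_zero_of_tsupport_subset hs hx]

/-- Since `weakPartial` is an arbitrary choice, all later identities between gradients hold only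
almost everywhere and pass through this lemma. -/
lemma weakPartial_ae_eq (h : HasWeakPartial j f g) : weakPartial j f =ᵐ[halfVol] g := by
  have hex : ∃ g, HasWeakPartial j f g := ⟨g, h⟩
  rw [weakPartial, dif_pos hex]
  exact hex.choose_spec.ae_eq h

lemma add (h : HasWeakPartial j f g) (h' : HasWeakPartial j f' g') :
    HasWeakPartial j (fun x => f x + f' x) (fun x => g x + g' x) := by
  refine ⟨h.1.add h'.1, h.2.1.add h'.2.1, fun φ hφ hs => ?_⟩
  have hs' := (tsupport_classicalPartial_subset φ j).trans hs
  have hφ' := hφ.classicalPartial j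
  simp only [add_mul]
  rw [integral_add (LocallyIntegrableOn.integrable_mul_test h.1 hφ'.continuous hφ'.2 hs')
      (LocallyIntegrableOn.integrable_mul_test h'.1 hφ'.continuous hφ'.2 hs'),
    integral_add (LocallyIntegrableOn.integrable_mul_test h.2.1 hφ.continuous hφ.2 hs)
      (LocallyIntegrableOn.integrable_mul_test h'.2.1 hφ.continuous hφ.2 hs),
    h.2.2 φ hφ hs, h'.2.2 φ hφ hs]
  ring

lemma const_mul (h : HasWeakPartial j f g) (c : ℝ) :
    HasWeakPartial j (fun x => c * f x) (fun x => c * g x) := by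
  refine ⟨h.1.smul c, h.2.1.smul c, fun φ hφ hs => ?_⟩
  simp only [mul_assoc, integral_const_mul, h.2.2 φ hφ hs]
  ring

lemma sub (h : HasWeakPartial j f g) (h' : HasWeakPartial j f' g') :
    HasWeakPartial j (fun x => f x - f' x) (fun x => g x - g' x) := by
  simpa [sub_eq_add_neg] using h.add (h'.const_mul (-1))

end HasWeakPartial

lemma WeaklyDifferentiable.hasWeakPartial {f : E3 → ℝ} (h : WeaklyDifferentiable f) (j : Fin 3) :
    HasWeakPartial j f (weakPartial j f) := by
  rw [weakPartial, dif_pos (h j)]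
  exact (h j).choose_spec

lemma WeaklyDifferentiable.locallyIntegrableOn {f : E3 → ℝ} (h : WeaklyDifferentiable f) :
    LocallyIntegrableOn f lowerHalfSpace := (h.hasWeakPartial 0).1

lemma WeaklyDifferentiable.locallyIntegrableOn_weakPartial {f : E3 → ℝ} (h : WeaklyDifferentiable f)
    (j : Fin 3) : LocallyIntegrableOn (weakPartial j f) lowerHalfSpace := (h.hasWeakPartial j).2.1

lemma WeaklyDifferentiable.add {f g : E3 → ℝ} (hf : WeaklyDifferentiable f)
    (hg : WeaklyDifferentiable g) : WeaklyDifferentiable fun x => f x + g x :=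
  fun j => ⟨_, (hf.hasWeakPartial j).add (hg.hasWeakPartial j)⟩

lemma WeaklyDifferentiable.sub {f g : E3 → ℝ} (hf : WeaklyDifferentiable f)
    (hg : WeaklyDifferentiable g) : WeaklyDifferentiable fun x => f x - g x :=
  fun j => ⟨_, (hf.hasWeakPartial j).sub (hg.hasWeakPartial j)⟩

lemma weakPartial_add {f g : E3 → ℝ} (hf : WeaklyDifferentiable f) (hg : WeaklyDifferentiable g)
    (j : Fin 3) : weakPartial j (fun x => f x + g x) =ᵐ[halfVol]
      fun x => weakPartial j f x + weakPartial j g x :=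
  ((hf.hasWeakPartial j).add (hg.hasWeakPartial j)).weakPartial_ae_eq

lemma weakPartial_sub {f g : E3 → ℝ} (hf : WeaklyDifferentiable f) (hg : WeaklyDifferentiable g)
    (j : Fin 3) : weakPartial j (fun x => f x - g x) =ᵐ[halfVol]
      fun x => weakPartial j f x - weakPartial j g x :=
  ((hf.hasWeakPartial j).sub (hg.hasWeakPartial j)).weakPartial_ae_eq

lemma _root_.ContDiff.hasWeakPartial {f : E3 → ℝ} (hf : ContDiff ℝ ∞ f) (j : Fin 3) :
    HasWeakPartial j f (classicalPartial j f) := by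
  refine ⟨hf.continuous.locallyIntegrable.locallyIntegrableOn _,
    (contDiff_classicalPartial hf j).continuous.locallyIntegrable.locallyIntegrableOn _,
    fun φ hφ hs => ?_⟩
  rw [integral_half_eq, integral_half_eq, integral_mul_classicalPartial hf hφ]
  · intro x hx
    simp [eq_zero_of_tsupport_subset hs hx]
  · intro x hx
    simp [eq_zero_of_tsupport_subset ((tsupport_classicalPartial_subset φ j).trans hs) hx]

/-! ### The weighted Sobolev space -/

lemma IsTestFunction.weakPartial_ae_eq {φ : E3 → ℝ} (h : IsTestFunction φ) (j : Fin 3) :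
    weakPartial j φ =ᵐ[halfVol] HalfSpaceLame.classicalPartial j φ :=
  (h.1.hasWeakPartial j).weakPartial_ae_eq

lemma memLp_inv_weight_mul {μ : Measure E3} {f : E3 → ℝ} (hf : MemLp f 2 μ) :
    MemLp (fun x => (weight x)⁻¹ * f x) 2 μ := by
  refine hf.mono (continuous_inv_weight.aestronglyMeasurable.mul hf.1) (.of_forall fun x => ?_)
  rw [norm_mul, Real.norm_of_nonneg (inv_nonneg.2 (weight_pos x).le)]
  exact mul_le_of_le_one_left (norm_nonneg _) (inv_weight_le_one x)

lemma IsTestFunction.memH10 {φ : E3 → ℝ} (h : IsTestFunction φ) : MemH10 φ where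
  weaklyDifferentiable j := ⟨_, h.1.hasWeakPartial j⟩
  memLp_weight := memLp_inv_weight_mul (h.memLp_half 2)
  memLp_partial j := ((h.classicalPartial j).memLp_half 2).ae_eq (h.weakPartial_ae_eq j).symm

lemma MemH10.sub {f g : E3 → ℝ} (hf : MemH10 f) (hg : MemH10 g) : MemH10 fun x => f x - g x where
  weaklyDifferentiable := hf.1.sub hg.1
  memLp_weight := by simp only [mul_sub]; exact hf.2.sub hg.2
  memLp_partial j := ((hf.3 j).sub (hg.3 j)).ae_eq (weakPartial_sub hf.1 hg.1 j).symm

/-- Weighted square integrability gives integrability against bounded fields of bounded support. -/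
lemma integrable_mul_of_memLp_weight {μ : Measure E3} [IsFiniteMeasureOnCompacts μ]
    {f φ : E3 → ℝ} (hf : MemLp (fun x => (weight x)⁻¹ * f x) 2 μ)
    (hφ : Continuous φ) (hc : HasCompactSupport φ) : Integrable (fun x => f x * φ x) μ := by
  have h2 : MemLp (fun x => weight x * φ x) 2 μ :=
    (continuous_weight.mul hφ).memLp_of_hasCompactSupport hc.mul_left
  refine (hf.integrable_mul h2).congr (.of_forall fun x => ?_)
  have := (weight_pos x).ne'
  simp only [Pi.mul_apply]
  field_simp


/-! ### Mollification -/

open Filter Topology in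
/-- Translations act continuously on square integrable functions. -/
lemma tendsto_eLpNorm_translate_sub {f : E3 → ℝ} (hf : MemLp f 2 volume) :
    Tendsto (fun h : E3 => eLpNorm (fun x => f (x - h) - f x) 2 volume) (𝓝 0) (𝓝 0) := by
  -- Currying the subtraction turns the translations into a continuous family of measure-preserving
  -- maps, and composition with such a family is continuous in `Lp`.
  let F : C(E3 × E3, E3) := ⟨fun p => p.2 - p.1, by fun_prop⟩
  have hF : ∀ h : E3, MeasurePreserving (F.curry h) volume volume := fun h =>
    measurePreserving_sub_right volume h
  have key := Tendsto.compMeasurePreservingLp (μ := volume) (ν := (volume : Measure E3)) (p := 2)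
    (tendsto_const_nhds (x := hf.toLp f) (f := 𝓝 (0 : E3))) (F.curry.continuous.tendsto 0)
    hF (hF 0) (by simp)
  rw [tendsto_iff_edist_tendsto_0] at key
  refine key.congr fun h => ?_
  rw [Lp.edist_def]
  refine eLpNorm_congr_ae ?_
  have e : ∀ h : E3, (Lp.compMeasurePreserving (F.curry h) (hF h) (hf.toLp f) : E3 → ℝ)
      =ᵐ[volume] fun x => f (x - h) := fun h => by
    rw [Lp.toLp_compMeasurePreserving]
    exact MemLp.coeFn_toLp _
  filter_upwards [e h, e 0] with x hx hx0
  rw [Pi.sub_apply, hx, hx0, sub_zero]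

/-- The convolution with a normalized bump function. -/
noncomputable def mollify (φ : ContDiffBump (0 : E3)) (f : E3 → ℝ) : E3 → ℝ :=
  convolution (φ.normed volume) f (ContinuousLinearMap.lsmul ℝ ℝ) volume

lemma mollify_apply (φ : ContDiffBump (0 : E3)) (f : E3 → ℝ) (x : E3) :
    mollify φ f x = ∫ t, φ.normed volume t * f (x - t) := by
  simp [mollify, convolution]

lemma mollify_apply' (φ : ContDiffBump (0 : E3)) (f : E3 → ℝ) (x : E3) :
    mollify φ f x = ∫ t, φ.normed volume (x - t) * f t := by
  simp [mollify, convolution_eq_swap]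

lemma mollify_congr_ae (φ : ContDiffBump (0 : E3)) {f g : E3 → ℝ} (h : f =ᵐ[volume] g) :
    mollify φ f = mollify φ g := by
  ext x
  rw [mollify_apply', mollify_apply']
  exact integral_congr_ae (h.mono fun t ht => by simp [ht])

/-- A mollification only depends on the values in a ball. -/
lemma mollify_congr_on (φ : ContDiffBump (0 : E3)) {f g : E3 → ℝ} {x : E3}
    (h : ∀ t ∈ Metric.ball x φ.rOut, f t = g t) : mollify φ f x = mollify φ g x := by
  rw [mollify_apply', mollify_apply']
  congr 1 with t
  by_cases ht : t ∈ Metric.ball x φ.rOut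
  · rw [h t ht]
  · have : x - t ∉ Function.support (φ.normed volume) := by
      rw [φ.support_normed_eq]
      rw [Metric.mem_ball, dist_comm] at ht
      simpa [dist_eq_norm] using ht
    rw [Function.notMem_support.1 this]
    simp

lemma integrable_mollify_integrand (φ : ContDiffBump (0 : E3)) {f : E3 → ℝ}
    (hf : LocallyIntegrable f volume) (x : E3) :
    Integrable fun t => φ.normed volume t * f (x - t) := by
  have := (φ.hasCompactSupport_normed (μ := volume)).convolutionExists_left
    (ContinuousLinearMap.lsmul ℝ ℝ) (φ.continuous_normed) hf x
  simpa [ConvolutionExistsAt] using this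

lemma isTestFunction_normed (φ : ContDiffBump (0 : E3)) : IsTestFunction (φ.normed volume) :=
  ⟨φ.contDiff_normed, φ.hasCompactSupport_normed⟩

lemma contDiff_mollify (φ : ContDiffBump (0 : E3)) {f : E3 → ℝ} (hf : LocallyIntegrable f volume) :
    ContDiff ℝ ∞ (mollify φ f) :=
  (φ.hasCompactSupport_normed).contDiff_convolution_left _ φ.contDiff_normed hf

lemma classicalPartial_mollify (φ : ContDiffBump (0 : E3)) {f : E3 → ℝ}
    (hf : LocallyIntegrable f volume) (j : Fin 3) (x : E3) :
    classicalPartial j (mollify φ f) x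
      = ∫ t, classicalPartial j (φ.normed volume) (x - t) * f t := by
  have hd := (φ.hasCompactSupport_normed (μ := volume)).hasFDerivAt_convolution_left
    (ContinuousLinearMap.lsmul ℝ ℝ) φ.contDiff_normed hf x
  have hx := (φ.hasCompactSupport_normed (μ := volume)).fderiv (𝕜 := ℝ) |>.convolutionExists_left
    ((ContinuousLinearMap.lsmul ℝ ℝ).precompL E3)
    (φ.contDiff_normed (n := 1) |>.continuous_fderiv (by simp)) hf x
  rw [classicalPartial, mollify, hd.fderiv, convolution,
    ContinuousLinearMap.integral_apply hx, ← integral_sub_left_eq_self _ _ x]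
  simp [classicalPartial, ContinuousLinearMap.precompL_apply]

/-- The reflected and translated bump function, as a test function. -/
lemma isTestFunction_bump (φ : ContDiffBump (0 : E3)) (x : E3) :
    IsTestFunction fun t => φ.normed volume (x - t) := by
  refine ⟨φ.contDiff_normed.comp (contDiff_const.sub contDiff_id), ?_⟩
  exact (φ.hasCompactSupport_normed).comp_homeomorph (Homeomorph.subLeft x)

lemma tsupport_bump_subset (φ : ContDiffBump (0 : E3)) (x : E3) :
    tsupport (fun t => φ.normed volume (x - t)) ⊆ Metric.closedBall x φ.rOut := by
  refine closure_minimal (fun t ht => ?_) Metric.isClosed_closedBall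
  have : x - t ∈ Function.support (φ.normed volume) := ht
  rw [φ.support_normed_eq, Metric.mem_ball, dist_zero_right, ← dist_eq_norm, dist_comm] at this
  exact this.le

lemma classicalPartial_bump (φ : ContDiffBump (0 : E3)) (x t : E3) (j : Fin 3) :
    classicalPartial j (fun t => φ.normed volume (x - t)) t
      = - classicalPartial j (φ.normed volume) (x - t) := by
  have h1 : HasFDerivAt (φ.normed volume) (fderiv ℝ (φ.normed volume) (x - t)) (x - t) :=
    ((isTestFunction_normed φ).differentiable _).hasFDerivAt
  have h2 := h1.comp t ((hasFDerivAt_id t).const_sub x)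
  rw [classicalPartial, classicalPartial, show (fun t => φ.normed volume (x - t))
    = φ.normed volume ∘ fun t => x - t from rfl, HasFDerivAt.fderiv h2]
  simp

/-- Differentiating the kernel in `x` is, up to sign, differentiating it in `t`. The weak identity
is needed only for the one bump centred at `x`, so the lemma also serves functions with a weak
derivative merely near `x`. -/
lemma classicalPartial_mollify_eq (φ : ContDiffBump (0 : E3)) {f g : E3 → ℝ}
    (hf : LocallyIntegrable f volume) {j : Fin 3} {x : E3}
    (h : ∫ t, f t * classicalPartial j (fun t => φ.normed volume (x - t)) t
      = - ∫ t, g t * φ.normed volume (x - t)) :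
    classicalPartial j (mollify φ f) x = mollify φ g x := by
  rw [classicalPartial_mollify φ hf, mollify_apply']
  simp only [classicalPartial_bump, mul_neg, integral_neg, neg_inj] at h
  simpa only [mul_comm] using h

/-! ### Convergence of mollifications, in the square mean and almost everywhere. -/

lemma mollify_sub_self (φ : ContDiffBump (0 : E3)) {f : E3 → ℝ} (hf : LocallyIntegrable f volume)
    (x : E3) : mollify φ f x - f x = ∫ t, φ.normed volume t * (f (x - t) - f x) := by
  simp only [mul_sub]
  rw [integral_sub (integrable_mollify_integrand φ hf x) (φ.integrable_normed.mul_const _),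
    mollify_apply, integral_mul_const, φ.integral_normed, one_mul]

/-- The mollification error is an average of translation errors, and the norm of an average is at
most the largest norm. -/
lemma eLpNorm_mollify_sub_le (φ : ContDiffBump (0 : E3)) {f : E3 → ℝ} (hf : MemLp f 2 volume)
    {δ : ℝ≥0∞} (hδ : ∀ h : E3, ‖h‖ < φ.rOut → eLpNorm (fun x => f (x - h) - f x) 2 volume ≤ δ) :
    eLpNorm (fun x => mollify φ f x - f x) 2 volume ≤ δ := by
  -- Tonelli's theorem below needs joint measurability in the point and the translation, hence a
  -- genuinely measurable representative.
  wlog hm : StronglyMeasurable f generalizing f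
  · obtain ⟨g, hg, hae⟩ := hf.aestronglyMeasurable
    have h1 := this (hf.ae_eq hae) (fun h hh => ?_) hg
    · rw [mollify_congr_ae φ hae]
      refine le_of_eq_of_le (eLpNorm_congr_ae ?_) h1
      filter_upwards [hae] with x hx
      rw [hx]
    · refine le_of_eq_of_le (eLpNorm_congr_ae ?_) (hδ h hh)
      filter_upwards [hae, (measurePreserving_sub_right volume h).quasiMeasurePreserving.ae hae]
        with x hx hx'
      rw [hx, hx']
  have hloc := hf.locallyIntegrable (by norm_num)
  set d : E3 → ℝ≥0∞ := fun t => ENNReal.ofReal (φ.normed volume t) with hd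
  have hdm : Measurable d := φ.continuous_normed.measurable.ennreal_ofReal
  -- With the bump as density of a probability measure, monotonicity of `Lp` norms in the exponent
  -- gives the square of the average at most the average of the squares; Tonelli then replaces
  -- Minkowski's integral inequality.
  set ν : Measure E3 := volume.withDensity d with hν
  have hprob : IsProbabilityMeasure ν := by
    refine ⟨?_⟩
    rw [hν, withDensity_apply _ MeasurableSet.univ, Measure.restrict_univ,
      ← ofReal_integral_eq_lintegral_ofReal φ.integrable_normed (.of_forall φ.nonneg_normed),
      φ.integral_normed, ENNReal.ofReal_one]
  have hrep : ∀ x, mollify φ f x - f x = ∫ t, (f (x - t) - f x) ∂ν := fun x => by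
    rw [mollify_sub_self φ hloc, hν, integral_withDensity_eq_integral_toReal_smul hdm
      (.of_forall fun _ => ENNReal.ofReal_lt_top)]
    simp [hd, ENNReal.toReal_ofReal (φ.nonneg_normed _)]
  have hkm : Measurable fun p : E3 × E3 => f (p.1 - p.2) - f p.1 :=
    (hm.measurable.comp (measurable_fst.sub measurable_snd)).sub (hm.measurable.comp measurable_fst)
  have hsq : ∀ k : E3 → ℝ, ∀ μ : Measure E3, eLpNorm k 2 μ ^ 2 = ∫⁻ x, ‖k x‖ₑ ^ 2 ∂μ := by
    intro k μ
    simpa using eLpNorm_nnreal_pow_eq_lintegral (f := k) (μ := μ) (p := 2) (by simp)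
  have h1 : ∀ x, ‖mollify φ f x - f x‖ₑ ^ 2 ≤ ∫⁻ t, ‖f (x - t) - f x‖ₑ ^ 2 ∂ν := fun x => by
    rw [hrep, ← hsq (fun t => f (x - t) - f x)]
    gcongr
    refine (enorm_integral_le_lintegral_enorm _).trans ?_
    rw [← eLpNorm_one_eq_lintegral_enorm]
    exact eLpNorm_le_eLpNorm_of_exponent_le (by norm_num)
      (hkm.comp (measurable_const.prodMk measurable_id)).aestronglyMeasurable
  have h2 : eLpNorm (fun x => mollify φ f x - f x) 2 volume ^ 2 ≤ δ ^ 2 := by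
    rw [hsq]
    calc ∫⁻ x, ‖mollify φ f x - f x‖ₑ ^ 2
        ≤ ∫⁻ x, (∫⁻ t, ‖f (x - t) - f x‖ₑ ^ 2 ∂ν) := lintegral_mono h1
      _ = ∫⁻ t, (∫⁻ x, ‖f (x - t) - f x‖ₑ ^ 2) ∂ν :=
          lintegral_lintegral_swap (hkm.enorm.pow_const 2).aemeasurable
      _ ≤ ∫⁻ t, δ ^ 2 ∂ν := by
          refine lintegral_mono_ae ?_
          rw [hν, ae_withDensity_iff hdm]
          refine .of_forall fun t ht => ?_
          rw [← hsq (fun x => f (x - t) - f x)]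
          gcongr
          refine hδ t ?_
          have : t ∈ Function.support (φ.normed volume) := fun h0 => ht (by simp [hd, h0])
          rw [φ.support_normed_eq] at this
          simpa using this
      _ = δ ^ 2 := by simp
  exact (ENNReal.pow_le_pow_left_iff (by norm_num)).1 h2

/-- A sequence of bump functions concentrating at the origin. -/
noncomputable def bumpSeq (n : ℕ) : ContDiffBump (0 : E3) :=
  ⟨1 / (2 * (n + 1)), 1 / (n + 1), by positivity, by
    apply one_div_lt_one_div_of_lt <;> linarith [n.cast_nonneg (α := ℝ)]⟩

open Filter Topology

lemma tendsto_rOut_bumpSeq : Tendsto (fun n => (bumpSeq n).rOut) atTop (𝓝 0) :=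
  tendsto_one_div_add_atTop_nhds_zero_nat

/-- The bounded ratio of radii is what Lebesgue differentiation along the bumps requires. -/
lemma rOut_bumpSeq_le (n : ℕ) : (bumpSeq n).rOut ≤ 2 * (bumpSeq n).rIn := by
  simp only [bumpSeq]
  apply le_of_eq
  field_simp

lemma tendsto_eLpNorm_mollify_sub {f : E3 → ℝ} (hf : MemLp f 2 volume) :
    Tendsto (fun n => eLpNorm (fun x => mollify (bumpSeq n) f x - f x) 2 volume) atTop (𝓝 0) := by
  rw [ENNReal.tendsto_nhds_zero]
  intro δ hδ
  obtain ⟨r, hr, h⟩ := Metric.eventually_nhds_iff.1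
    ((ENNReal.tendsto_nhds_zero.1 (tendsto_eLpNorm_translate_sub hf)) δ hδ)
  filter_upwards [tendsto_rOut_bumpSeq.eventually (gt_mem_nhds hr)] with n hn
  exact eLpNorm_mollify_sub_le _ hf fun y hy => h (by simpa using hy.trans hn)

lemma ae_tendsto_mollify {f : E3 → ℝ} (hf : LocallyIntegrable f volume) :
    ∀ᵐ x, Tendsto (fun n => mollify (bumpSeq n) f x) atTop (𝓝 (f x)) :=
  ContDiffBump.ae_convolution_tendsto_right_of_locallyIntegrable tendsto_rOut_bumpSeq
    (.of_forall rOut_bumpSeq_le) hf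

lemma isTestFunction_mollify (φ : ContDiffBump (0 : E3)) {f : E3 → ℝ}
    (hf : LocallyIntegrable f volume) (hc : HasCompactSupport f) :
    IsTestFunction (mollify φ f) :=
  ⟨contDiff_mollify φ hf, (φ.hasCompactSupport_normed).convolution _ hc⟩


/-! ### Convergence in `L²` -/

lemma eLpNorm_two_sq (k : E3 → ℝ) (μ : Measure E3) :
    eLpNorm k 2 μ ^ 2 = ∫⁻ x, ‖k x‖ₑ ^ 2 ∂μ := by
  simpa using eLpNorm_nnreal_pow_eq_lintegral (f := k) (μ := μ) (p := 2) (by simp)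

lemma tendsto_eLpNorm_of_dominated {μ : Measure E3} {F : ℕ → E3 → ℝ} {b : E3 → ℝ}
    (hF : ∀ n, AEStronglyMeasurable (F n) μ) (hb : MemLp b 2 μ)
    (hle : ∀ n, ∀ᵐ x ∂μ, |F n x| ≤ b x)
    (hlim : ∀ᵐ x ∂μ, Tendsto (fun n => F n x) atTop (𝓝 0)) :
    Tendsto (fun n => eLpNorm (F n) 2 μ) atTop (𝓝 0) := by
  have key : Tendsto (fun n => eLpNorm (F n) 2 μ ^ 2) atTop (𝓝 0) := by
    simp only [eLpNorm_two_sq]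
    have h0 : ∫⁻ _, (0 : ℝ≥0∞) ∂μ = 0 := by simp
    rw [← h0]
    refine tendsto_lintegral_of_dominated_convergence' (fun x => ‖b x‖ₑ ^ 2)
      (fun n => (hF n).enorm.pow_const 2) (fun n => ?_) ?_ ?_
    · filter_upwards [hle n] with x hx
      gcongr
      rw [enorm_le_iff_norm_le]
      exact hx.trans (le_abs_self _)
    · rw [← eLpNorm_two_sq]
      exact (ENNReal.pow_lt_top hb.2).ne
    · filter_upwards [hlim] with x hx
      have := ENNReal.Tendsto.pow (n := 2) hx.enorm
      simpa using this
  have := (ENNReal.continuous_rpow_const (y := (1 / 2 : ℝ))).tendsto _ |>.comp key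
  refine (this.congr fun n => ?_).trans (by simp)
  simp only [Function.comp_apply]
  rw [← ENNReal.rpow_natCast, ← ENNReal.rpow_mul]
  simp

/-- Joint continuity of the inner product of the space of square integrable functions. -/
lemma tendsto_integral_mul_of_eLpNorm {μ : Measure E3} {F G : ℕ → E3 → ℝ} {f g : E3 → ℝ}
    (hF : ∀ n, MemLp (F n) 2 μ) (hf : MemLp f 2 μ)
    (hFf : Tendsto (fun n => eLpNorm (fun x => F n x - f x) 2 μ) atTop (𝓝 0))
    (hG : ∀ n, MemLp (G n) 2 μ) (hg : MemLp g 2 μ)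
    (hGg : Tendsto (fun n => eLpNorm (fun x => G n x - g x) 2 μ) atTop (𝓝 0)) :
    Tendsto (fun n => ∫ x, F n x * G n x ∂μ) atTop (𝓝 (∫ x, f x * g x ∂μ)) := by
  have inner_eq : ∀ {a b : E3 → ℝ} (ha : MemLp a 2 μ) (hb : MemLp b 2 μ),
      inner ℝ (ha.toLp a) (hb.toLp b) = ∫ x, a x * b x ∂μ := by
    intro a b ha hb
    rw [L2.inner_def]
    refine integral_congr_ae ?_
    filter_upwards [ha.coeFn_toLp, hb.coeFn_toLp] with x h1 h2
    rw [h1, h2]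
    simp [mul_comm]
  have conv : ∀ {A : ℕ → E3 → ℝ} {a : E3 → ℝ} (hA : ∀ n, MemLp (A n) 2 μ) (ha : MemLp a 2 μ),
      Tendsto (fun n => eLpNorm (fun x => A n x - a x) 2 μ) atTop (𝓝 0) →
      Tendsto (fun n => (hA n).toLp (A n)) atTop (𝓝 (ha.toLp a)) := by
    intro A a hA ha h
    rw [tendsto_iff_edist_tendsto_0]
    exact h.congr fun n => (Lp.edist_toLp_toLp _ _ (hA n) ha).symm
  have := (conv hF hf hFf).inner (𝕜 := ℝ) (conv hG hg hGg)
  simpa only [inner_eq] using this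

/-! ### Approximation by test functions in the whole space -/

/-- Smooth cutoff functions exhausting the space. -/
noncomputable def cutoff (n : ℕ) (x : E3) : ℝ :=
  (⟨1, 2, one_pos, one_lt_two⟩ : ContDiffBump (0 : E3)) ((n + 1 : ℝ)⁻¹ • x)

lemma contDiff_cutoff (n : ℕ) : ContDiff ℝ ∞ (cutoff n) :=
  (ContDiffBump.contDiff _).comp (contDiff_const_smul _)

lemma cutoff_nonneg (n : ℕ) (x : E3) : 0 ≤ cutoff n x := ContDiffBump.nonneg _

lemma cutoff_le_one (n : ℕ) (x : E3) : cutoff n x ≤ 1 := ContDiffBump.le_one _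

lemma cutoff_eq_zero {n : ℕ} {x : E3} (hx : 2 * (n + 1 : ℝ) ≤ ‖x‖) : cutoff n x = 0 := by
  refine ContDiffBump.zero_of_le_dist _ ?_
  rw [dist_zero_right, norm_smul, Real.norm_of_nonneg (by positivity), inv_mul_eq_div,
    le_div_iff₀ (by positivity)]
  exact hx

lemma isTestFunction_cutoff (n : ℕ) : IsTestFunction (cutoff n) := by
  refine ⟨contDiff_cutoff n, HasCompactSupport.intro (isCompact_closedBall 0 (2 * (n + 1 : ℝ))) ?_⟩
  intro x hx
  refine cutoff_eq_zero ?_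
  simpa using (not_le.1 (by simpa using hx) : 2 * (n + 1 : ℝ) < ‖x‖).le

lemma tendsto_cutoff (x : E3) : Tendsto (fun n => cutoff n x) atTop (𝓝 1) := by
  refine tendsto_const_nhds.congr' ?_
  filter_upwards [eventually_ge_atTop ⌈‖x‖⌉₊] with n hn
  refine (ContDiffBump.one_of_mem_closedBall _ ?_).symm
  rw [mem_closedBall_zero_iff, norm_smul, Real.norm_of_nonneg (by positivity), inv_mul_eq_div,
    div_le_iff₀ (by positivity)]
  have := Nat.ceil_le.1 hn
  simp only [one_mul]
  linarith

lemma exists_abs_classicalPartial_cutoff_le (j : Fin 3) :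
    ∃ C, 0 ≤ C ∧ ∀ n x, |classicalPartial j (cutoff n) x| ≤ C / (n + 1) := by
  obtain ⟨C, hC, hb⟩ := ((isTestFunction_cutoff 0).classicalPartial j).exists_bound
  refine ⟨C, hC, fun n x => ?_⟩
  have h0 : cutoff n = fun x => cutoff 0 ((n + 1 : ℝ)⁻¹ • x) := by
    ext x
    simp [cutoff]
  have : classicalPartial j (cutoff n) x
      = (n + 1 : ℝ)⁻¹ * classicalPartial j (cutoff 0) ((n + 1 : ℝ)⁻¹ • x) := by
    rw [h0, classicalPartial, fderiv_comp_smul]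
    simp [classicalPartial]
  rw [this, abs_mul, abs_of_nonneg (by positivity), inv_mul_eq_div]
  gcongr
  exact hb _

/-- The derivative is of order `1 / (n + 1)` and lives where `‖x‖ ≤ 2 (n + 1)`, so the weight is at
most `3 (n + 1)` there. This scale invariance makes the space `ϱ⁻¹f ∈ L²` compatible with cutting
off at infinity. -/
lemma exists_abs_classicalPartial_cutoff_mul_weight_le (j : Fin 3) :
    ∃ C, 0 ≤ C ∧ ∀ n x, |classicalPartial j (cutoff n) x| * weight x ≤ C := by
  obtain ⟨C, hC, hb⟩ := exists_abs_classicalPartial_cutoff_le j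
  refine ⟨3 * C, by positivity, fun n x => ?_⟩
  by_cases hx : x ∈ tsupport (cutoff n)
  · have hx' : ‖x‖ ≤ 2 * (n + 1) := by
      have : tsupport (cutoff n) ⊆ Metric.closedBall 0 (2 * (n + 1 : ℝ)) := by
        refine closure_minimal (fun z hz => ?_) Metric.isClosed_closedBall
        rw [mem_closedBall_zero_iff]
        by_contra! h
        exact hz (cutoff_eq_zero h.le)
      simpa using this hx
    have hw : weight x ≤ 3 * (n + 1) := by
      refine Real.sqrt_le_iff.2 ⟨by positivity, ?_⟩
      nlinarith [norm_nonneg x, n.cast_nonneg (α := ℝ)]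
    calc _ ≤ C / (n + 1) * (3 * (n + 1))  :=
          mul_le_mul (hb n x) hw (weight_pos x).le (by positivity)
      _ = 3 * C := by field_simp
  · rw [classicalPartial_eq_zero j hx]
    simp only [abs_zero, zero_mul]
    positivity

/-- Weakly differentiable functions on the whole space with finite weighted energy. -/
structure WholeWeak (f : E3 → ℝ) (g : Fin 3 → E3 → ℝ) : Prop where
  memLp_weight : MemLp (fun x => (weight x)⁻¹ * f x) 2 volume
  memLp_grad : ∀ j, MemLp (g j) 2 volume
  weak : ∀ j φ, IsTestFunction φ →
    ∫ x, f x * classicalPartial j φ x = - ∫ x, g j x * φ x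

lemma MemLp.mul_bounded {μ : Measure E3} {f φ : E3 → ℝ} (hf : MemLp f 2 μ) (hφ : Continuous φ)
    {C : ℝ} (hC : ∀ x, |φ x| ≤ C) : MemLp (fun x => φ x * f x) 2 μ := by
  refine (hf.const_mul C).mono (hφ.aestronglyMeasurable.mul hf.aestronglyMeasurable)
    (.of_forall fun x => ?_)
  rw [norm_mul, norm_mul]
  gcongr
  exact (hC x).trans (le_abs_self C)

lemma WholeWeak.memLp_mul_test {f : E3 → ℝ} {g : Fin 3 → E3 → ℝ} (h : WholeWeak f g)
    {φ : E3 → ℝ} (hφ : IsTestFunction φ) : MemLp (fun x => φ x * f x) 2 volume := by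
  have hc : Continuous fun x => φ x * weight x := hφ.continuous.mul continuous_weight
  obtain ⟨C, hC⟩ := (hφ.2.mul_right : HasCompactSupport fun x => φ x * weight x)
    |>.exists_bound_of_continuous hc
  refine (MemLp.mul_bounded h.1 hc hC).ae_eq (.of_forall fun x => ?_)
  have := (weight_pos x).ne'
  field_simp

lemma WholeWeak.integrable_mul_test {f : E3 → ℝ} {g : Fin 3 → E3 → ℝ} (h : WholeWeak f g)
    {φ : E3 → ℝ} (hφ : IsTestFunction φ) : Integrable fun x => f x * φ x :=
  integrable_mul_of_memLp_weight h.1 hφ.continuous hφ.2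

lemma WholeWeak.cutoff_mul {f : E3 → ℝ} {g : Fin 3 → E3 → ℝ} (h : WholeWeak f g) (n : ℕ) :
    WholeWeak (fun x => cutoff n x * f x)
      (fun j x => cutoff n x * g j x + classicalPartial j (cutoff n) x * f x) where
  memLp_weight := memLp_inv_weight_mul (h.memLp_mul_test (isTestFunction_cutoff n))
  memLp_grad j := (MemLp.mul_bounded (h.2 j) (isTestFunction_cutoff n).continuous
      (C := 1) fun x => by rw [abs_of_nonneg (cutoff_nonneg n x)]; exact cutoff_le_one n x).add
    (h.memLp_mul_test ((isTestFunction_cutoff n).classicalPartial j))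
  weak j φ hφ := by
    have hη := isTestFunction_cutoff n
    have e := h.3 j _ (hη.mul_right hφ.1)
    have e' : ∀ x, f x * classicalPartial j (fun x => cutoff n x * φ x) x
        = cutoff n x * f x * classicalPartial j φ x
          + f x * (φ x * classicalPartial j (cutoff n) x) := fun x => by
      rw [classicalPartial_mul j (hη.differentiable x) (hφ.differentiable x)]
      ring
    simp only [e'] at e
    have i1 : Integrable fun x => cutoff n x * f x * classicalPartial j φ x := by
      refine (h.integrable_mul_test (hη.mul_right (hφ.classicalPartial j).1)).congr
        (.of_forall fun x => by ring)
    have i2 : Integrable fun x => f x * (φ x * classicalPartial j (cutoff n) x) :=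
      h.integrable_mul_test (hφ.mul_right (hη.classicalPartial j).1)
    have i3 : Integrable fun x => g j x * (cutoff n x * φ x) :=
      (h.2 j).integrable_mul ((hη.mul_right hφ.1).memLp 2)
    rw [integral_add i1 i2] at e
    have e2 : ∫ x, (cutoff n x * g j x + classicalPartial j (cutoff n) x * f x) * φ x
        = (∫ x, g j x * (cutoff n x * φ x)) + ∫ x, f x * (φ x * classicalPartial j (cutoff n) x) := by
      rw [← integral_add i3 i2]
      congr 1 with x
      ring
    rw [e2]
    linarith

lemma WholeWeak.tendsto_cutoff_mul {f : E3 → ℝ} {g : Fin 3 → E3 → ℝ} (h : WholeWeak f g) :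
    Tendsto (fun n => eLpNorm (fun x => (weight x)⁻¹ * (cutoff n x * f x) - (weight x)⁻¹ * f x)
      2 volume) atTop (𝓝 0) := by
  refine tendsto_eLpNorm_of_dominated (fun n => ?_) h.1.norm (fun n => .of_forall fun x => ?_)
    (.of_forall fun x => ?_)
  · exact ((h.cutoff_mul n).1.sub h.1).1
  · rw [show (weight x)⁻¹ * (cutoff n x * f x) - (weight x)⁻¹ * f x
      = (cutoff n x - 1) * ((weight x)⁻¹ * f x) by ring, abs_mul]
    refine mul_le_of_le_one_left (abs_nonneg _) ?_
    rw [abs_le]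
    constructor <;> linarith [cutoff_nonneg n x, cutoff_le_one n x]
  · have := (((tendsto_cutoff x).mul_const (f x)).const_mul (weight x)⁻¹).sub_const
      ((weight x)⁻¹ * f x)
    simpa using this

/-- The commutator `∂η · f` is dominated by a multiple of `ϱ⁻¹|f|`, which is square integrable, and
tends to zero pointwise. -/
lemma WholeWeak.tendsto_cutoff_mul_grad {f : E3 → ℝ} {g : Fin 3 → E3 → ℝ} (h : WholeWeak f g)
    (j : Fin 3) :
    Tendsto (fun n => eLpNorm (fun x => (cutoff n x * g j x
      + classicalPartial j (cutoff n) x * f x) - g j x) 2 volume) atTop (𝓝 0) := by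
  obtain ⟨C, hC0, hC⟩ := exists_abs_classicalPartial_cutoff_mul_weight_le j
  obtain ⟨D, hD0, hD⟩ := exists_abs_classicalPartial_cutoff_le j
  refine tendsto_eLpNorm_of_dominated (fun n => ?_) ((h.2 j).norm.add (h.1.norm.const_mul C))
    (fun n => .of_forall fun x => ?_) (.of_forall fun x => ?_)
  · exact (((h.cutoff_mul n).2 j).sub (h.2 j)).1
  · rw [show cutoff n x * g j x + classicalPartial j (cutoff n) x * f x - g j x
      = (cutoff n x - 1) * g j x
        + (classicalPartial j (cutoff n) x * weight x) * ((weight x)⁻¹ * f x) by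
          have := (weight_pos x).ne'
          field_simp
          ring]
    refine (abs_add_le _ _).trans ?_
    simp only [Pi.add_apply, Real.norm_eq_abs]
    rw [abs_mul, abs_mul]
    gcongr
    · refine mul_le_of_le_one_left (abs_nonneg _) ?_
      rw [abs_le]
      constructor <;> linarith [cutoff_nonneg n x, cutoff_le_one n x]
    · rw [abs_mul, abs_of_pos (weight_pos x)]
      exact hC n x
  · have h1 : Tendsto (fun n => classicalPartial j (cutoff n) x) atTop (𝓝 0) := by
      refine squeeze_zero_norm (hD · x) ?_
      exact tendsto_const_nhds.div_atTop
        (tendsto_atTop_add_const_right _ _ tendsto_natCast_atTop_atTop)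
    have := (((tendsto_cutoff x).mul_const (g j x)).add (h1.mul_const (f x))).sub_const (g j x)
    simpa using this

/-- Functions of compact support are approximated by their mollifications. -/
lemma WholeWeak.exists_approx_of_hasCompactSupport {f : E3 → ℝ} {g : Fin 3 → E3 → ℝ}
    (h : WholeWeak f g) (hf : MemLp f 2 volume) (hc : HasCompactSupport f) {δ : ℝ≥0∞} (hδ : 0 < δ) :
    ∃ φ, IsTestFunction φ ∧
      eLpNorm (fun x => (weight x)⁻¹ * φ x - (weight x)⁻¹ * f x) 2 volume ≤ δ ∧
      ∀ j, eLpNorm (fun x => classicalPartial j φ x - g j x) 2 volume ≤ δ := by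
  have hloc := hf.locallyIntegrable (by norm_num)
  have e1 := ENNReal.tendsto_nhds_zero.1 (tendsto_eLpNorm_mollify_sub hf) δ hδ
  have e2 : ∀ j, ∀ᶠ n in atTop,
      eLpNorm (fun x => mollify (bumpSeq n) (g j) x - g j x) 2 volume ≤ δ := fun j =>
    ENNReal.tendsto_nhds_zero.1 (tendsto_eLpNorm_mollify_sub (h.2 j)) δ hδ
  obtain ⟨n, h1, h2⟩ := (e1.and (eventually_all.2 e2)).exists
  refine ⟨mollify (bumpSeq n) f, isTestFunction_mollify _ hloc hc, ?_, fun j => ?_⟩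
  · refine (eLpNorm_mono fun x => ?_).trans h1
    rw [← mul_sub, norm_mul, Real.norm_of_nonneg (inv_nonneg.2 (weight_pos x).le)]
    exact mul_le_of_le_one_left (norm_nonneg _) (inv_weight_le_one x)
  · refine le_of_eq_of_le ?_ (h2 j)
    congr 1 with x
    rw [classicalPartial_mollify_eq _ hloc (h.3 j _ (isTestFunction_bump _ x))]

/-- Test functions are dense in the weighted Sobolev space of the whole space. -/
lemma WholeWeak.exists_approx {f : E3 → ℝ} {g : Fin 3 → E3 → ℝ} (h : WholeWeak f g) :
    ∃ φ : ℕ → E3 → ℝ, (∀ n, IsTestFunction (φ n)) ∧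
      Tendsto (fun n => eLpNorm (fun x => (weight x)⁻¹ * φ n x - (weight x)⁻¹ * f x) 2 volume)
        atTop (𝓝 0) ∧
      ∀ j, Tendsto (fun n => eLpNorm (fun x => classicalPartial j (φ n) x - g j x) 2 volume)
        atTop (𝓝 0) := by
  have hpos : ∀ n : ℕ, 0 < ((n : ℝ≥0∞) + 1)⁻¹ := fun n => by simp
  have hlim : Tendsto (fun n : ℕ => ((n : ℝ≥0∞) + 1)⁻¹) atTop (𝓝 0) := by
    have := (tendsto_add_atTop_iff_nat 1).2 ENNReal.tendsto_inv_nat_nhds_zero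
    simpa using this
  -- The `n`-th cutoff is approximated within `1 / (n + 1)`, so the mollification error and the
  -- cutoff error vanish together.
  choose φ hφ h1 h2 using fun n => (h.cutoff_mul n).exists_approx_of_hasCompactSupport
    (h.memLp_mul_test (isTestFunction_cutoff n)) ((isTestFunction_cutoff n).2.mul_right) (hpos n)
  have squeeze : ∀ {a b : ℕ → ℝ≥0∞}, Tendsto b atTop (𝓝 0) →
      (∀ n, a n ≤ ((n : ℝ≥0∞) + 1)⁻¹ + b n) → Tendsto a atTop (𝓝 0) := by
    intro a b hb hab
    have := hlim.add hb
    rw [add_zero] at this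
    exact tendsto_of_tendsto_of_tendsto_of_le_of_le tendsto_const_nhds this (fun _ => zero_le) hab
  refine ⟨φ, hφ, squeeze h.tendsto_cutoff_mul fun n => ?_, fun j =>
    squeeze (h.tendsto_cutoff_mul_grad j) fun n => ?_⟩
  · refine le_trans (le_of_eq_of_le ?_ (eLpNorm_add_le
      ((memLp_inv_weight_mul ((hφ n).memLp 2)).sub (h.cutoff_mul n).1).1
      ((h.cutoff_mul n).1.sub h.1).1 (by norm_num))) (add_le_add_left (h1 n) _)
    congr 1 with x
    simp
  · refine le_trans (le_of_eq_of_le ?_ (eLpNorm_add_le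
      ((((hφ n).classicalPartial j).memLp 2).sub ((h.cutoff_mul n).2 j)).1
      (((h.cutoff_mul n).2 j).sub (h.2 j)).1 (by norm_num))) (add_le_add_left (h2 n j) _)
    congr 1 with x
    simp


/-! ### The inequalities of Hardy and Korn in the whole space -/

lemma norm_sq_eq_sum (x : E3) : ‖x‖ ^ 2 = ∑ i, x i ^ 2 := by
  simp [EuclideanSpace.norm_sq_eq]

lemma contDiff_coord (j : Fin 3) : ContDiff ℝ ∞ fun x : E3 => x j := by fun_prop

lemma classicalPartial_coord (i j : Fin 3) (x : E3) :
    classicalPartial j (fun x : E3 => x i) x = if i = j then 1 else 0 := by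
  have : (fun x : E3 => x i) = (EuclideanSpace.proj i : E3 →L[ℝ] ℝ) := rfl
  rw [classicalPartial, this, ContinuousLinearMap.fderiv]
  simp

/-- The field `x / (1 + |x|²)`. -/
noncomputable def hardyField (j : Fin 3) (x : E3) : ℝ := x j * (1 + ‖x‖ ^ 2)⁻¹

lemma contDiff_hardyField (j : Fin 3) : ContDiff ℝ ∞ (hardyField j) := by
  refine (contDiff_coord j).mul (ContDiff.inv ?_ fun x => by positivity)
  exact contDiff_const.add (contDiff_norm_sq ℝ)

lemma classicalPartial_norm_sq (j : Fin 3) (x : E3) :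
    classicalPartial j (fun x : E3 => ‖x‖ ^ 2) x = 2 * x j := by
  have h := (hasStrictFDerivAt_norm_sq x).hasFDerivAt
  rw [classicalPartial, h.fderiv]
  simp [EuclideanSpace.inner_single_right]

lemma classicalPartial_hardyField (j : Fin 3) (x : E3) :
    classicalPartial j (hardyField j) x
      = (1 + ‖x‖ ^ 2)⁻¹ - 2 * x j ^ 2 * ((1 + ‖x‖ ^ 2)⁻¹) ^ 2 := by
  have hd : DifferentiableAt ℝ (fun x : E3 => 1 + ‖x‖ ^ 2) x :=
    (contDiff_const.add (contDiff_norm_sq ℝ) : ContDiff ℝ ∞ fun x : E3 => (1 : ℝ) + ‖x‖ ^ 2)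
      |>.differentiable (by simp) x
  have hpos : (1 : ℝ) + ‖x‖ ^ 2 ≠ 0 := by positivity
  have hinv : classicalPartial j (fun x : E3 => (1 + ‖x‖ ^ 2)⁻¹) x
      = -(2 * x j) * ((1 + ‖x‖ ^ 2)⁻¹) ^ 2 := by
    have h1 : classicalPartial j (fun x : E3 => 1 + ‖x‖ ^ 2) x = 2 * x j := by
      rw [classicalPartial, fderiv_const_add, ← classicalPartial_norm_sq, classicalPartial]
    have h2 := (hasFDerivAt_inv hpos).comp x hd.hasFDerivAt
    rw [classicalPartial, show (fun x : E3 => (1 + ‖x‖ ^ 2)⁻¹) = (fun t : ℝ => t⁻¹) ∘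
      (fun x : E3 => 1 + ‖x‖ ^ 2) from rfl, h2.fderiv]
    rw [classicalPartial] at h1
    simp only [ContinuousLinearMap.comp_apply, h1]
    simp
  have := classicalPartial_mul (g := fun x => (1 + ‖x‖ ^ 2)⁻¹) j
    ((contDiff_coord j).differentiable (by simp) x) (hd.inv hpos)
  rw [show hardyField j = fun x => x j * (1 + ‖x‖ ^ 2)⁻¹ from rfl, this,
    hinv, classicalPartial_coord]
  simp only [↓reduceIte]
  ring

/-- Hardy's inequality. -/
lemma IsTestFunction.hardy {φ : E3 → ℝ} (hφ : IsTestFunction φ) :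
    ∫ x, ((weight x)⁻¹ * φ x) * ((weight x)⁻¹ * φ x)
      ≤ 4 * ∑ j, ∫ x, HalfSpaceLame.classicalPartial j φ x * HalfSpaceLame.classicalPartial j φ x := by
  have hφ2 : IsTestFunction fun x => φ x * φ x := hφ.mul_left hφ.1
  have iA : ∀ j, Integrable fun x => hardyField j x
      * HalfSpaceLame.classicalPartial j (fun x => φ x * φ x) x := fun j =>
    ((hφ2.classicalPartial j).mul_left (contDiff_hardyField j)).integrable
  have iB : ∀ j, Integrable fun x => HalfSpaceLame.classicalPartial j (hardyField j) x
      * (φ x * φ x) := fun j =>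
    (hφ2.mul_left (contDiff_classicalPartial (contDiff_hardyField j) j)).integrable
  have iG : ∀ j, Integrable fun x =>
      HalfSpaceLame.classicalPartial j φ x * HalfSpaceLame.classicalPartial j φ x := fun j =>
    ((hφ.classicalPartial j).mul_left (hφ.classicalPartial j).1).integrable
  have iW : Integrable fun x => ((weight x)⁻¹ * φ x) * ((weight x)⁻¹ * φ x) :=
    (memLp_inv_weight_mul (hφ.memLp 2)).integrable_mul (memLp_inv_weight_mul (hφ.memLp 2))
  -- The integrand is the divergence of `φ²` times the Hardy field, so it integrates to zero. Below
  -- it is bounded from below pointwise by `½ ϱ⁻²φ² - 2|∇φ|²`, whence the constant 4.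
  have hz : ∫ x, ∑ j, (hardyField j x * HalfSpaceLame.classicalPartial j (fun x => φ x * φ x) x
      + HalfSpaceLame.classicalPartial j (hardyField j) x * (φ x * φ x)) = 0 := by
    rw [integral_finsetSum]
    swap
    · exact fun j _ => (iA j).add (iB j)
    refine Finset.sum_eq_zero fun j _ => ?_
    rw [integral_add (iA j) (iB j), integral_mul_classicalPartial (contDiff_hardyField j) hφ2]
    ring
  have hle : ∫ x, (1 / 2 * (((weight x)⁻¹ * φ x) * ((weight x)⁻¹ * φ x))
      - 2 * ∑ j, HalfSpaceLame.classicalPartial j φ x * HalfSpaceLame.classicalPartial j φ x)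
      ≤ ∫ x, ∑ j, (hardyField j x * HalfSpaceLame.classicalPartial j (fun x => φ x * φ x) x
      + HalfSpaceLame.classicalPartial j (hardyField j) x * (φ x * φ x)) := by
    refine integral_mono ((iW.const_mul _).sub ((integrable_finsetSum _ fun j _ => iG j).const_mul _))
      (integrable_finsetSum _ fun j _ => (iA j).add (iB j)) fun x => ?_
    have hw : (weight x)⁻¹ * φ x * ((weight x)⁻¹ * φ x) = (1 + ‖x‖ ^ 2)⁻¹ * φ x ^ 2 := by
      rw [← weight_sq]
      ring
    simp only [hw, classicalPartial_hardyField,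
      classicalPartial_mul _ (hφ.differentiable x) (hφ.differentiable x), hardyField]
    set q := (1 + ‖x‖ ^ 2)⁻¹ with hq
    have hq0 : 0 < q := by positivity
    have hq1 : q * ‖x‖ ^ 2 ≤ 1 := by
      rw [hq, inv_mul_le_iff₀ (by positivity)]
      linarith
    rw [norm_sq_eq_sum] at hq1
    simp only [Fin.sum_univ_three] at hq1 ⊢
    set a := HalfSpaceLame.classicalPartial 0 φ x
    set b := HalfSpaceLame.classicalPartial 1 φ x
    set c := HalfSpaceLame.classicalPartial 2 φ x
    -- With `q = (1 + |x|²)⁻¹`, the difference of the two integrands is `½ |q φ x + 2∇φ|²` plus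
    -- `5/2` times this quantity.
    have h0 : 0 ≤ q * (1 - q * (x 0 ^ 2 + x 1 ^ 2 + x 2 ^ 2)) * φ x ^ 2 :=
      mul_nonneg (mul_nonneg hq0.le (by linarith)) (sq_nonneg _)
    nlinarith [sq_nonneg (q * x 0 * φ x + 2 * a), sq_nonneg (q * x 1 * φ x + 2 * b),
      sq_nonneg (q * x 2 * φ x + 2 * c)]
  rw [hz, integral_sub (iW.const_mul _) ((integrable_finsetSum _ fun j _ => iG j).const_mul _),
    integral_const_mul, integral_const_mul, integral_finsetSum _ fun j _ => iG j] at hle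
  linarith

/-- Two integrations by parts exchange the derivatives; with no boundary, nothing is left over. On
the half-space this fails, which is why an extension is needed for Korn's inequality. -/
lemma integral_partial_mul_partial_comm {u v : E3 → ℝ} (hu : IsTestFunction u)
    (hv : IsTestFunction v) (i j : Fin 3) :
    ∫ x, classicalPartial j u x * classicalPartial i v x
      = ∫ x, classicalPartial i u x * classicalPartial j v x := by
  rw [integral_mul_classicalPartial (hu.classicalPartial j).1 hv,
    integral_mul_classicalPartial (hu.classicalPartial i).1 hv]
  simp only [classicalPartial_comm hu.1 i j]

/-- Korn's inequality. -/
lemma test_korn {u : Fin 3 → E3 → ℝ} (hu : ∀ i, IsTestFunction (u i)) :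
    ∑ i, ∑ j, ∫ x, classicalPartial j (u i) x * classicalPartial j (u i) x
      ≤ 1 / 2 * ∑ i, ∑ j, ∫ x, (classicalPartial j (u i) x + classicalPartial i (u j) x)
        * (classicalPartial j (u i) x + classicalPartial i (u j) x) := by
  have int : ∀ i j k l, Integrable fun x => classicalPartial j (u i) x * classicalPartial l (u k) x :=
    fun i j k l => (((hu k).classicalPartial l).mul_left ((hu i).classicalPartial j).1).integrable
  set a : Fin 3 → Fin 3 → Fin 3 → Fin 3 → ℝ := fun i j k l =>
    ∫ x, classicalPartial j (u i) x * classicalPartial l (u k) x with ha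
  have e : ∀ i j, ∫ x, (classicalPartial j (u i) x + classicalPartial i (u j) x)
        * (classicalPartial j (u i) x + classicalPartial i (u j) x)
        = a i j i j + 2 * a i i j j + a j i j i := by
    intro i j
    -- The mixed term of the expanded square becomes a product of diagonal derivatives, whose sum is
    -- the integral of the squared divergence.
    have h1 : a i i j j = a i j j i := integral_partial_mul_partial_comm (hu i) (hu j) j i
    rw [h1]
    simp only [ha]
    rw [← integral_const_mul, ← integral_add (int i j i j) ((int i j j i).const_mul 2),
      ← integral_add _ (int j i j i)]
    · congr 1 with x
      ring
    · exact (int i j i j).add ((int i j j i).const_mul 2)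
  have hdiv : 0 ≤ ∑ i, ∑ j, a i i j j := by
    have : ∑ i, ∑ j, a i i j j = ∫ x, (∑ i, classicalPartial i (u i) x) ^ 2 := by
      simp only [ha]
      rw [← Finset.sum_congr rfl fun i _ => integral_finsetSum _ fun j _ => int i i j j,
        ← integral_finsetSum _ fun i _ => integrable_finsetSum _ fun j _ => int i i j j]
      congr 1 with x
      rw [sq, Finset.sum_mul_sum]
    rw [this]
    exact integral_nonneg fun x => sq_nonneg _
  simp only [e, Finset.sum_add_distrib, ← Finset.mul_sum]
  rw [Finset.sum_comm (f := fun i j => a j i j i)]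
  change ∑ i, ∑ j, a i j i j ≤ _
  linarith

/-- The inequalities of Korn and Hardy in the weighted space. -/
lemma WholeWeak.korn_hardy {u : Fin 3 → E3 → ℝ} {g : Fin 3 → Fin 3 → E3 → ℝ}
    (h : ∀ i, WholeWeak (u i) (g i)) :
    ∑ i, ((∫ x, ((weight x)⁻¹ * u i x) * ((weight x)⁻¹ * u i x))
        + ∑ j, ∫ x, g i j x * g i j x)
      ≤ 5 / 2 * ∑ i, ∑ j, ∫ x, (g i j x + g j i x) * (g i j x + g j i x) := by
  choose φ hφ h1 h2 using fun i => (h i).exists_approx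
  have t1 : ∀ i, Tendsto (fun n => ∫ x, ((weight x)⁻¹ * φ i n x) * ((weight x)⁻¹ * φ i n x)) atTop
      (𝓝 (∫ x, ((weight x)⁻¹ * u i x) * ((weight x)⁻¹ * u i x))) := fun i =>
    tendsto_integral_mul_of_eLpNorm (fun n => memLp_inv_weight_mul ((hφ i n).memLp 2)) (h i).1 (h1 i)
      (fun n => memLp_inv_weight_mul ((hφ i n).memLp 2)) (h i).1 (h1 i)
  have t2 : ∀ i j, Tendsto (fun n => ∫ x, classicalPartial j (φ i n) x * classicalPartial j (φ i n) x)
      atTop (𝓝 (∫ x, g i j x * g i j x)) := fun i j =>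
    tendsto_integral_mul_of_eLpNorm (fun n => ((hφ i n).classicalPartial j).memLp 2) ((h i).2 j)
      (h2 i j) (fun n => ((hφ i n).classicalPartial j).memLp 2) ((h i).2 j) (h2 i j)
  have h3 : ∀ i j, Tendsto (fun n => eLpNorm (fun x => (classicalPartial j (φ i n) x
      + classicalPartial i (φ j n) x) - (g i j x + g j i x)) 2 volume) atTop (𝓝 0) := by
    intro i j
    have := (h2 i j).add (h2 j i)
    rw [add_zero] at this
    refine tendsto_of_tendsto_of_tendsto_of_le_of_le tendsto_const_nhds this (fun _ => zero_le)
      fun n => ?_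
    refine le_of_eq_of_le ?_ (eLpNorm_add_le
      ((((hφ i n).classicalPartial j).memLp 2).sub ((h i).2 j)).1
      ((((hφ j n).classicalPartial i).memLp 2).sub ((h j).2 i)).1 (by norm_num))
    congr 1 with x
    simp only [Pi.add_apply]
    ring
  have t3 : ∀ i j, Tendsto (fun n => ∫ x, (classicalPartial j (φ i n) x + classicalPartial i (φ j n) x)
      * (classicalPartial j (φ i n) x + classicalPartial i (φ j n) x))
      atTop (𝓝 (∫ x, (g i j x + g j i x) * (g i j x + g j i x))) := fun i j =>
    tendsto_integral_mul_of_eLpNorm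
      (fun n => (((hφ i n).classicalPartial j).memLp 2).add (((hφ j n).classicalPartial i).memLp 2))
      (((h i).2 j).add ((h j).2 i)) (h3 i j)
      (fun n => (((hφ i n).classicalPartial j).memLp 2).add (((hφ j n).classicalPartial i).memLp 2))
      (((h i).2 j).add ((h j).2 i)) (h3 i j)
  refine le_of_tendsto_of_tendsto' (tendsto_finsetSum _ fun i _ =>
    (t1 i).add (tendsto_finsetSum _ fun j _ => t2 i j)) ((tendsto_finsetSum _ fun i _ =>
      tendsto_finsetSum _ fun j _ => t3 i j).const_mul _) fun n => ?_
  -- The constant `5/2` is `(1 + 4) · 1/2`: Hardy's factor 4 for the weighted part, 1 for the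
  -- gradient, and Korn's `1/2`.
  have hk := test_korn fun i => hφ i n
  have hh : ∑ i, ∫ x, ((weight x)⁻¹ * φ i n x) * ((weight x)⁻¹ * φ i n x)
      ≤ ∑ i, 4 * ∑ j, ∫ x, classicalPartial j (φ i n) x * classicalPartial j (φ i n) x :=
    Finset.sum_le_sum fun i _ => (hφ i n).hardy
  rw [← Finset.mul_sum] at hh
  rw [Finset.sum_add_distrib]
  linarith


/-! ### Integration by parts up to the boundary -/

lemma integrableOn_of_memLp_weight {μ : Measure E3} [IsFiniteMeasureOnCompacts μ] {f : E3 → ℝ}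
    (hf : MemLp (fun x => (weight x)⁻¹ * f x) 2 μ) {k : Set E3} (hk : IsCompact k) :
    IntegrableOn f k μ := by
  have hfin : IsFiniteMeasure (μ.restrict k) := ⟨by
    rw [Measure.restrict_apply_univ]; exact hk.measure_lt_top⟩
  have h1 : IntegrableOn (fun x => (weight x)⁻¹ * f x) k μ :=
    (hf.restrict k).integrable (by norm_num)
  refine (h1.mul_continuousOn continuous_weight.continuousOn hk).congr (.of_forall fun x => ?_)
  have := (weight_pos x).ne'
  simp only
  field_simp

lemma deriv_smoothTransition_of_neg {t : ℝ} (ht : t < 0) : deriv Real.smoothTransition t = 0 := by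
  have : Real.smoothTransition =ᶠ[𝓝 t] fun _ => 0 := by
    filter_upwards [gt_mem_nhds ht] with s hs using Real.smoothTransition.zero_of_nonpos hs.le
  rw [this.deriv_eq, deriv_const]

lemma deriv_smoothTransition_of_one_lt {t : ℝ} (ht : 1 < t) : deriv Real.smoothTransition t = 0 := by
  have : Real.smoothTransition =ᶠ[𝓝 t] fun _ => 1 := by
    filter_upwards [lt_mem_nhds ht] with s hs using Real.smoothTransition.one_of_one_le hs.le
  rw [this.deriv_eq, deriv_const]

lemma exists_abs_deriv_smoothTransition_le : ∃ D, 0 ≤ D ∧ ∀ t, |deriv Real.smoothTransition t| ≤ D := by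
  have hc : Continuous (deriv Real.smoothTransition) :=
    (Real.smoothTransition.contDiff (n := 1)).continuous_deriv (by simp)
  have hs : HasCompactSupport (deriv Real.smoothTransition) := by
    refine HasCompactSupport.intro (isCompact_Icc (a := 0) (b := 1)) fun t ht => ?_
    rw [mem_Icc, not_and_or, not_le, not_le] at ht
    exact ht.elim deriv_smoothTransition_of_neg deriv_smoothTransition_of_one_lt
  obtain ⟨D, hD⟩ := hs.exists_bound_of_continuous hc
  exact ⟨D, (norm_nonneg _).trans (hD 0), hD⟩

/-- A smooth function that vanishes near the boundary of the half-space. -/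
noncomputable def boundaryCutoff (n : ℕ) (x : E3) : ℝ :=
  Real.smoothTransition (-(n + 1) * x 2 - 1)

lemma contDiff_boundaryCutoff (n : ℕ) : ContDiff ℝ ∞ (boundaryCutoff n) :=
  Real.smoothTransition.contDiff.comp ((contDiff_const.mul (contDiff_coord 2)).sub contDiff_const)

lemma classicalPartial_boundaryCutoff (n : ℕ) (j : Fin 3) (x : E3) :
    classicalPartial j (boundaryCutoff n) x
      = deriv Real.smoothTransition (-(n + 1) * x 2 - 1) * (-(n + 1) * if (2 : Fin 3) = j then 1 else 0) := by
  have h1 : HasDerivAt Real.smoothTransition (deriv Real.smoothTransition (-(n + 1) * x 2 - 1))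
      (-(n + 1) * x 2 - 1) :=
    ((Real.smoothTransition.contDiff (n := 1)).differentiable (by simp) _).hasDerivAt
  have h2 : HasFDerivAt (fun x : E3 => -(n + 1 : ℝ) * x 2 - 1)
      (-(n + 1 : ℝ) • (EuclideanSpace.proj 2 : E3 →L[ℝ] ℝ)) x :=
    ((EuclideanSpace.proj 2 : E3 →L[ℝ] ℝ).hasFDerivAt.const_mul _).sub_const _
  have h3 := h1.comp_hasFDerivAt x h2
  rw [classicalPartial, show boundaryCutoff n = Real.smoothTransition ∘
    fun x : E3 => -(n + 1 : ℝ) * x 2 - 1 from rfl, h3.fderiv]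
  simp

lemma boundaryCutoff_eq_zero {n : ℕ} {x : E3} (hx : -1 / (n + 1 : ℝ) < x 2) :
    boundaryCutoff n x = 0 := by
  refine Real.smoothTransition.zero_of_nonpos ?_
  rw [div_lt_iff₀ (by positivity)] at hx
  linarith

lemma tsupport_boundaryCutoff_mul_subset (n : ℕ) (ψ : E3 → ℝ) :
    tsupport (fun x => boundaryCutoff n x * ψ x) ⊆ lowerHalfSpace := by
  have hc : IsClosed {x : E3 | x 2 ≤ -1 / (n + 1 : ℝ)} := isClosed_le (by fun_prop) continuous_const
  refine (closure_minimal (fun x hx => ?_) hc).trans fun x hx => ?_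
  · by_contra! h
    exact hx (by simp only [boundaryCutoff_eq_zero (not_le.1 h), zero_mul])
  · have hx' : x 2 ≤ -1 / (n + 1 : ℝ) := hx
    exact hx'.trans_lt (div_neg_of_neg_of_pos (by norm_num) (by positivity))

lemma eventually_one_lt_boundary {x : E3} (hx : x ∈ lowerHalfSpace) :
    ∀ᶠ n : ℕ in atTop, 1 < -((n : ℝ) + 1) * x 2 - 1 := by
  have hx' : 0 < -x 2 := neg_pos.2 hx
  have : Tendsto (fun n : ℕ => ((n : ℝ) + 1) * -x 2) atTop atTop :=
    (tendsto_atTop_add_const_right _ _ tendsto_natCast_atTop_atTop).atTop_mul_const hx'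
  filter_upwards [this.eventually_gt_atTop 2] with n hn
  linarith

/-- A smooth function that vanishes on the boundary is small near the boundary. -/
lemma IsTestFunction.exists_abs_le_mul_coord {ψ : E3 → ℝ} (hψ : IsTestFunction ψ)
    (h0 : ∀ x : E3, x 2 = 0 → ψ x = 0) : ∃ L, 0 ≤ L ∧ ∀ x, |ψ x| ≤ L * |x 2| := by
  obtain ⟨L, hL⟩ := (hψ.1.of_le (by simp) : ContDiff ℝ 1 ψ).lipschitzWith_of_hasCompactSupport
    hψ.2 (by simp)
  refine ⟨L, L.2, fun x => ?_⟩
  have h := hL.dist_le_mul x (x - EuclideanSpace.single 2 (x 2))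
  rw [h0 (x - EuclideanSpace.single 2 (x 2)) (by simp), Real.dist_0_eq_abs, dist_eq_norm] at h
  simpa using h

/-- Integration by parts in the half-space, for test functions that vanish on the boundary if the
derivative is in the normal direction. -/
lemma MemH10.integral_mul_classicalPartial {f : E3 → ℝ} (hf : MemH10 f) {j : Fin 3} {ψ : E3 → ℝ}
    (hψ : IsTestFunction ψ) (h0 : j = 2 → ∀ x : E3, x 2 = 0 → ψ x = 0) :
    ∫ x, f x * classicalPartial j ψ x ∂halfVol = - ∫ x, weakPartial j f x * ψ x ∂halfVol := by
  have : IsFiniteMeasureOnCompacts halfVol := by unfold halfVol; infer_instance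
  have hw := hf.1.hasWeakPartial j
  obtain ⟨D, hD0, hD⟩ := exists_abs_deriv_smoothTransition_le
  have hH : ∀ᵐ x ∂halfVol, x ∈ lowerHalfSpace := ae_restrict_mem measurableSet_lowerHalfSpace
  have hχ1 : ∀ n x, |boundaryCutoff n x| ≤ 1 := fun n x => by
    rw [boundaryCutoff, abs_of_nonneg (Real.smoothTransition.nonneg _)]
    exact Real.smoothTransition.le_one _
  have hχlim : ∀ x ∈ lowerHalfSpace, ∀ᶠ n in atTop, boundaryCutoff n x = 1 := fun x hx => by
    filter_upwards [eventually_one_lt_boundary hx] with n hn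
    exact Real.smoothTransition.one_of_one_le hn.le
  have i1 : Integrable (fun x => f x * classicalPartial j ψ x) halfVol :=
    integrable_mul_of_memLp_weight hf.2 (hψ.classicalPartial j).continuous (hψ.classicalPartial j).2
  have i2 : Integrable (fun x => weakPartial j f x * ψ x) halfVol :=
    (hf.3 j).integrable_mul (hψ.memLp_half 2)
  have hfk : IntegrableOn f (tsupport ψ) halfVol := integrableOn_of_memLp_weight hf.2 hψ.2
  -- The factor `ψ ∂χₙ` will only be bounded. Restricting `f` to the compact support of `ψ` provides
  -- an integrable dominating function.
  have i3 : Integrable ((tsupport ψ).indicator f) halfVol :=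
    hfk.integrable_indicator (isClosed_tsupport ψ).measurableSet
  -- In the normal direction `∂χₙ` is of order `n + 1` on a strip of width of order `1 / (n + 1)`,
  -- where `ψ` is at most `L |x₃| ≤ 2L / (n + 1)`. In tangential directions `∂χₙ` vanishes, so `ψ`
  -- needs no boundary condition.
  obtain ⟨B, hB⟩ : ∃ B, ∀ n x, |ψ x * classicalPartial j (boundaryCutoff n) x| ≤ B := by
    by_cases hj : j = 2
    · obtain ⟨L, hL0, hL⟩ := hψ.exists_abs_le_mul_coord (h0 hj)
      refine ⟨2 * L * D, fun n x => ?_⟩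
      rw [classicalPartial_boundaryCutoff, if_pos hj.symm, mul_one]
      by_cases ht : 0 ≤ -(n + 1 : ℝ) * x 2 - 1 ∧ -(n + 1 : ℝ) * x 2 - 1 ≤ 1
      · have hx2 : |x 2| * (n + 1) ≤ 2 := by
          have : x 2 < 0 := by
            by_contra! h
            nlinarith [n.cast_nonneg (α := ℝ)]
          rw [abs_of_neg this]
          linarith
        have hn : |-(n + 1 : ℝ)| = n + 1 := by rw [abs_neg, abs_of_nonneg (by positivity)]
        rw [abs_mul, abs_mul, hn]
        calc |ψ x| * (|deriv Real.smoothTransition (-(n + 1) * x 2 - 1)| * (n + 1))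
            ≤ (L * |x 2|) * (D * (n + 1)) := by
              gcongr
              · exact hL x
              · exact hD _
          _ = L * D * (|x 2| * (n + 1)) := by ring
          _ ≤ L * D * 2 := by gcongr
          _ = 2 * L * D := by ring
      · have : deriv Real.smoothTransition (-(n + 1) * x 2 - 1) = 0 := by
          rw [not_and_or, not_le, not_le] at ht
          exact ht.elim deriv_smoothTransition_of_neg deriv_smoothTransition_of_one_lt
        rw [this]
        simp only [zero_mul, mul_zero, abs_zero]
        positivity
    · refine ⟨0, fun n x => ?_⟩
      rw [classicalPartial_boundaryCutoff, if_neg fun h => hj h.symm]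
      simp
  have m1 : ∀ n, AEStronglyMeasurable (fun x => boundaryCutoff n x * (f x * classicalPartial j ψ x))
      halfVol := fun n =>
    (contDiff_boundaryCutoff n).continuous.aestronglyMeasurable.mul i1.aestronglyMeasurable
  have m2 : ∀ n, AEStronglyMeasurable (fun x => boundaryCutoff n x * (weakPartial j f x * ψ x))
      halfVol := fun n =>
    (contDiff_boundaryCutoff n).continuous.aestronglyMeasurable.mul i2.aestronglyMeasurable
  have m3 : ∀ n, AEStronglyMeasurable (fun x => (tsupport ψ).indicator f x
      * (ψ x * classicalPartial j (boundaryCutoff n) x)) halfVol := fun n =>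
    i3.aestronglyMeasurable.mul (hψ.continuous.mul
      (contDiff_classicalPartial (contDiff_boundaryCutoff n) j).continuous).aestronglyMeasurable
  have b1 : ∀ n x, ‖boundaryCutoff n x * (f x * classicalPartial j ψ x)‖
      ≤ ‖f x * classicalPartial j ψ x‖ := fun n x => by
    rw [norm_mul]
    exact mul_le_of_le_one_left (norm_nonneg _) (hχ1 n x)
  have b2 : ∀ n x, ‖boundaryCutoff n x * (weakPartial j f x * ψ x)‖
      ≤ ‖weakPartial j f x * ψ x‖ := fun n x => by
    rw [norm_mul]
    exact mul_le_of_le_one_left (norm_nonneg _) (hχ1 n x)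
  have b3 : ∀ n x, ‖(tsupport ψ).indicator f x * (ψ x * classicalPartial j (boundaryCutoff n) x)‖
      ≤ ‖(tsupport ψ).indicator f x‖ * B := fun n x => by
    rw [norm_mul]
    gcongr
    exact hB n x
  have t1 : Tendsto (fun n => ∫ x, boundaryCutoff n x * (f x * classicalPartial j ψ x) ∂halfVol)
      atTop (𝓝 (∫ x, f x * classicalPartial j ψ x ∂halfVol)) := by
    refine tendsto_integral_of_dominated_convergence _ m1 i1.norm
      (fun n => .of_forall (b1 n)) ?_
    filter_upwards [hH] with x hx
    refine tendsto_const_nhds.congr' ?_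
    filter_upwards [hχlim x hx] with n hn
    rw [hn, one_mul]
  have t2 : Tendsto (fun n => ∫ x, boundaryCutoff n x * (weakPartial j f x * ψ x) ∂halfVol)
      atTop (𝓝 (∫ x, weakPartial j f x * ψ x ∂halfVol)) := by
    refine tendsto_integral_of_dominated_convergence _ m2 i2.norm
      (fun n => .of_forall (b2 n)) ?_
    filter_upwards [hH] with x hx
    refine tendsto_const_nhds.congr' ?_
    filter_upwards [hχlim x hx] with n hn
    rw [hn, one_mul]
  -- At each fixed point of the half-space the transition is eventually over, so the term with `∂χₙ`
  -- tends to zero pointwise as well.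
  have t3 : Tendsto (fun n => ∫ x, (tsupport ψ).indicator f x
      * (ψ x * classicalPartial j (boundaryCutoff n) x) ∂halfVol) atTop (𝓝 0) := by
    rw [← integral_zero E3 ℝ (μ := halfVol)]
    refine tendsto_integral_of_dominated_convergence _ m3 (i3.norm.mul_const B)
      (fun n => .of_forall (b3 n)) ?_
    filter_upwards [hH] with x hx
    refine tendsto_const_nhds.congr' ?_
    filter_upwards [eventually_one_lt_boundary hx] with n hn
    rw [classicalPartial_boundaryCutoff, deriv_smoothTransition_of_one_lt hn]
    simp
  have key : ∀ n, (∫ x, boundaryCutoff n x * (f x * classicalPartial j ψ x) ∂halfVol)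
      + ∫ x, (tsupport ψ).indicator f x * (ψ x * classicalPartial j (boundaryCutoff n) x) ∂halfVol
      = - ∫ x, boundaryCutoff n x * (weakPartial j f x * ψ x) ∂halfVol := by
    intro n
    have hχ := contDiff_boundaryCutoff n
    have e := hw.2.2 _ (hψ.mul_left hχ) (tsupport_boundaryCutoff_mul_subset n ψ)
    rw [← integral_add]
    · convert! e using 2
      · ext x
        rw [classicalPartial_mul j (hχ.differentiable (by simp) x) (hψ.differentiable x)]
        by_cases hx : x ∈ tsupport ψ
        · rw [indicator_of_mem hx]
          ring
        · rw [indicator_of_notMem hx, image_eq_zero_of_notMem_tsupport hx]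
          ring
      · congr 1 with x
        ring
    · exact i1.mono (m1 n) (.of_forall (b1 n))
    · refine (i3.norm.mul_const B).mono (m3 n) (.of_forall fun x => (b3 n x).trans (le_abs_self _))
  have := tendsto_nhds_unique (t1.add t3) (t2.neg.congr fun n => (key n).symm)
  rwa [add_zero] at this


lemma integral_linear_combination {μ : Measure E3} {a b c : E3 → ℝ} (ha : Integrable a μ)
    (hb : Integrable b μ) (hc : Integrable c μ) (p q : ℝ) :
    ∫ x, (a x + (p * b x + q * c x)) ∂μ = ∫ x, a x ∂μ + (p * ∫ x, b x ∂μ + q * ∫ x, c x ∂μ) := by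
  have h : Integrable (fun x => p * b x + q * c x) μ := (hb.const_mul p).add (hc.const_mul q)
  rw [integral_add ha h, integral_add (hb.const_mul p) (hc.const_mul q), integral_const_mul,
    integral_const_mul]

/-! ### Scaled reflections -/

/-- The linear map that multiplies the third coordinate by `-a`. -/
noncomputable def refl (a : ℝ) : E3 →L[ℝ] E3 :=
  LinearMap.toContinuousLinearMap (Matrix.toEuclideanLin (Matrix.diagonal ![1, 1, -a]))

lemma refl_apply (a : ℝ) (x : E3) (i : Fin 3) :
    refl a x i = (if i = 2 then -a else 1) * x i := by
  fin_cases i <;> simp [refl, Matrix.toLpLin_apply, Matrix.mulVec_diagonal]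

lemma refl_refl_inv {a : ℝ} (ha : a ≠ 0) (x : E3) : refl a (refl a⁻¹ x) = x := by
  ext i
  simp only [refl_apply]
  split_ifs
  · field_simp
  · simp

/-- The reflection as a homeomorphism. -/
noncomputable def reflHomeomorph {a : ℝ} (ha : a ≠ 0) : E3 ≃ₜ E3 where
  toFun := refl a
  invFun := refl a⁻¹
  left_inv x := by simpa using refl_refl_inv (inv_ne_zero ha) x
  right_inv x := refl_refl_inv ha x
  continuous_toFun := (refl a).continuous
  continuous_invFun := (refl a⁻¹).continuous

lemma measurableEmbedding_refl {a : ℝ} (ha : a ≠ 0) : MeasurableEmbedding (refl a) :=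
  (reflHomeomorph ha).measurableEmbedding

lemma map_refl_volume {a : ℝ} (ha : 0 < a) :
    Measure.map (refl a) (volume : Measure E3) = ENNReal.ofReal a⁻¹ • volume := by
  have hdet : LinearMap.det (Matrix.toEuclideanLin (Matrix.diagonal ![1, 1, -a])) = -a := by
    change LinearMap.det (Matrix.toLpLin 2 2 (Matrix.diagonal ![1, 1, -a])) = -a
    rw [Matrix.toLpLin_eq_toLin, LinearMap.det_toLin, Matrix.det_diagonal]
    simp [Fin.prod_univ_three]
  have := Measure.map_linearMap_addHaar_eq_smul_addHaar (volume : Measure E3)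
    (f := Matrix.toEuclideanLin (Matrix.diagonal ![1, 1, -a])) (by rw [hdet]; linarith)
  rw [hdet, inv_neg, abs_neg, abs_of_pos (inv_pos.2 ha)] at this
  exact this

lemma integral_comp_refl {a : ℝ} (ha : 0 < a) (f : E3 → ℝ) :
    ∫ x, f (refl a x) = a⁻¹ * ∫ x, f x := by
  rw [← (measurableEmbedding_refl ha.ne').integral_map, map_refl_volume ha, integral_smul_measure,
    ENNReal.toReal_ofReal (by positivity), smul_eq_mul]

lemma integral_comp_refl_mul {a : ℝ} (ha : 0 < a) (f φ : E3 → ℝ) :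
    ∫ x, f (refl a x) * φ x = a⁻¹ * ∫ x, f x * φ (refl a⁻¹ x) := by
  rw [← integral_comp_refl ha]
  congr 1 with x
  have := refl_refl_inv (inv_ne_zero ha.ne') x
  rw [inv_inv] at this
  rw [this]

lemma memLp_comp_refl {a : ℝ} (ha : 0 < a) {f : E3 → ℝ} (hf : MemLp f 2 volume) :
    MemLp (fun x => f (refl a x)) 2 volume := by
  refine (measurableEmbedding_refl ha.ne').memLp_map_measure_iff.1 ?_
  rw [map_refl_volume ha]
  exact hf.smul_measure ENNReal.ofReal_ne_top

lemma integrable_comp_refl {a : ℝ} (ha : 0 < a) {f : E3 → ℝ} (hf : Integrable f) :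
    Integrable fun x => f (refl a x) := by
  refine (measurableEmbedding_refl ha.ne').integrable_map_iff.1 ?_
  rw [map_refl_volume ha]
  exact hf.smul_measure ENNReal.ofReal_ne_top

lemma classicalPartial_comp_refl {φ : E3 → ℝ} (hφ : Differentiable ℝ φ) (a : ℝ) (j : Fin 3) (x : E3) :
    classicalPartial j (fun x => φ (refl a x)) x
      = (if j = 2 then -a else 1) * classicalPartial j φ (refl a x) := by
  have h := (hφ (refl a x)).hasFDerivAt.comp x (refl a).hasFDerivAt
  have e : refl a (EuclideanSpace.single j 1)
      = (if j = 2 then -a else 1 : ℝ) • EuclideanSpace.single j (1 : ℝ) := by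
    ext i
    rw [refl_apply]
    by_cases hij : i = j
    · subst hij
      split_ifs <;> simp
    · split_ifs <;> simp [hij]
  rw [classicalPartial, show (fun x => φ (refl a x)) = φ ∘ refl a from rfl, h.fderiv,
    ContinuousLinearMap.comp_apply, e, map_smul, smul_eq_mul, classicalPartial]

lemma IsTestFunction.comp_refl {φ : E3 → ℝ} (hφ : IsTestFunction φ) {a : ℝ} (ha : a ≠ 0) :
    IsTestFunction fun x => φ (refl a x) :=
  ⟨hφ.1.comp (refl a).contDiff, hφ.2.comp_homeomorph (reflHomeomorph ha)⟩

lemma inv_weight_le_refl {a : ℝ} (ha : 0 < a) (ha2 : a ≤ 2) (x : E3) :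
    (weight x)⁻¹ ≤ 2 * (weight (refl a x))⁻¹ := by
  have : weight (refl a x) ≤ 2 * weight x := by
    refine Real.sqrt_le_iff.2 ⟨by positivity [weight_pos x], ?_⟩
    rw [mul_pow, weight_sq, norm_sq_eq_sum, norm_sq_eq_sum]
    simp only [refl_apply, Fin.sum_univ_three]
    simp
    have : (a * x 2) ^ 2 ≤ 4 * x 2 ^ 2 := by
      rw [mul_pow]
      gcongr
      nlinarith
    nlinarith [sq_nonneg (x 0), sq_nonneg (x 1)]
  rw [← div_eq_mul_inv, le_div_iff₀ (weight_pos _), inv_mul_le_iff₀ (weight_pos x)]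
  linarith

lemma refl_mem_iff {a : ℝ} (ha : 0 < a) (x : E3) : refl a x ∈ lowerHalfSpace ↔ 0 < x 2 := by
  simp only [lowerHalfSpace, mem_ofPred_eq, refl_apply, ↓reduceIte]
  constructor <;> intro h <;> nlinarith

/-! ### The extension operator -/

/-- The extension by zero of a function on the half-space. -/
noncomputable def zeroExt (f : E3 → ℝ) : E3 → ℝ := lowerHalfSpace.indicator f

/-- Extension by a linear combination of two reflections. -/
noncomputable def nitscheExt (p q : ℝ) (f : E3 → ℝ) (x : E3) : ℝ :=
  zeroExt f x + p * zeroExt f (refl 1 x) + q * zeroExt f (refl 2 x)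

lemma nitscheExt_of_mem (p q : ℝ) (f : E3 → ℝ) {x : E3} (hx : x ∈ lowerHalfSpace) :
    nitscheExt p q f x = f x := by
  have hx' : ¬ 0 < x 2 := not_lt.2 (le_of_lt hx)
  rw [nitscheExt, zeroExt, indicator_of_mem hx,
    indicator_of_notMem (by rw [refl_mem_iff one_pos]; exact hx'),
    indicator_of_notMem (by rw [refl_mem_iff two_pos]; exact hx')]
  ring

lemma integral_zeroExt_mul (f φ : E3 → ℝ) :
    ∫ x, zeroExt f x * φ x = ∫ x, f x * φ x ∂halfVol := by
  rw [halfVol, ← integral_indicator measurableSet_lowerHalfSpace]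
  congr 1 with x
  simp only [zeroExt, indicator]
  split_ifs <;> simp

lemma memLp_zeroExt {f : E3 → ℝ} (hf : MemLp f 2 halfVol) : MemLp (zeroExt f) 2 volume :=
  (memLp_indicator_iff_restrict measurableSet_lowerHalfSpace).2 hf

lemma memLp_weight_zeroExt {f : E3 → ℝ} (hf : MemLp (fun x => (weight x)⁻¹ * f x) 2 halfVol) :
    MemLp (fun x => (weight x)⁻¹ * zeroExt f x) 2 volume := by
  refine (memLp_zeroExt hf).ae_eq (.of_forall fun x => ?_)
  simp only [zeroExt, indicator]
  split_ifs <;> simp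

lemma memLp_weight_zeroExt_refl {f : E3 → ℝ} (hf : MemLp (fun x => (weight x)⁻¹ * f x) 2 halfVol)
    {a : ℝ} (ha : 0 < a) (ha2 : a ≤ 2) :
    MemLp (fun x => (weight x)⁻¹ * zeroExt f (refl a x)) 2 volume := by
  have h := memLp_comp_refl ha (memLp_weight_zeroExt hf)
  refine (h.const_mul 2).mono ?_ (.of_forall fun x => ?_)
  · have : AEStronglyMeasurable (fun x => weight (refl a x) *
        ((weight (refl a x))⁻¹ * zeroExt f (refl a x))) volume :=
      (continuous_weight.comp (refl a).continuous).aestronglyMeasurable.mul h.1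
    refine continuous_inv_weight.aestronglyMeasurable.mul (this.congr (.of_forall fun x => ?_))
    have := (weight_pos (refl a x)).ne'
    field_simp
  · rw [← mul_assoc, norm_mul, norm_mul, Real.norm_of_nonneg (inv_nonneg.2 (weight_pos x).le),
      Real.norm_of_nonneg (mul_nonneg two_pos.le (inv_nonneg.2 (weight_pos _).le))]
    gcongr
    exact inv_weight_le_refl ha ha2 x

/-- The weak gradient of the extension. -/
noncomputable def nitscheGrad (p q : ℝ) (f : E3 → ℝ) (j : Fin 3) (x : E3) : ℝ :=
  zeroExt (weakPartial j f) x
    + p * ((if j = 2 then -1 else 1) * zeroExt (weakPartial j f) (refl 1 x))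
    + q * ((if j = 2 then -2 else 1) * zeroExt (weakPartial j f) (refl 2 x))

/-- A change of variables moves the reflections onto the test function, and the condition `p + q =
1` (continuity of traces) is what makes the combined test function vanish on the boundary for the
normal derivative. -/
lemma MemH10.wholeWeak_nitscheExt {f : E3 → ℝ} (hf : MemH10 f) {p q : ℝ} (hpq : p + q = 1) :
    WholeWeak (nitscheExt p q f) (nitscheGrad p q f) where
  memLp_weight := by
    have h0 := memLp_weight_zeroExt hf.2
    have h1 := (memLp_weight_zeroExt_refl hf.2 one_pos one_le_two).const_mul p
    have h2 := (memLp_weight_zeroExt_refl hf.2 two_pos le_rfl).const_mul q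
    refine ((h0.add h1).add h2).ae_eq (.of_forall fun x => ?_)
    simp only [Pi.add_apply, nitscheExt]
    ring
  memLp_grad j := by
    have h := memLp_zeroExt (hf.3 j)
    exact (h.add (((memLp_comp_refl one_pos h).const_mul _).const_mul p)).add
      (((memLp_comp_refl two_pos h).const_mul _).const_mul q)
  weak j φ hφ := by
    have hφj := hφ.classicalPartial j
    have r1 : IsTestFunction fun x => φ (refl 1⁻¹ x) := hφ.comp_refl (by norm_num)
    have r2 : IsTestFunction fun x => φ (refl 2⁻¹ x) := hφ.comp_refl (by norm_num)
    have int : ∀ {ψ : E3 → ℝ}, IsTestFunction ψ → Integrable fun x => zeroExt f x * ψ x :=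
      fun hψ => integrable_mul_of_memLp_weight (memLp_weight_zeroExt hf.2) hψ.continuous hψ.2
    have intg : ∀ {ψ : E3 → ℝ}, IsTestFunction ψ →
        Integrable fun x => zeroExt (weakPartial j f) x * ψ x :=
      fun hψ => (memLp_zeroExt (hf.3 j)).integrable_mul (hψ.memLp 2)
    have intr : ∀ {a : ℝ}, 0 < a → a ≤ 2 → ∀ {ψ : E3 → ℝ}, IsTestFunction ψ →
        Integrable fun x => zeroExt f (refl a x) * ψ x := fun ha ha2 _ hψ =>
      integrable_mul_of_memLp_weight (f := fun x => zeroExt f (refl _ x))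
        (memLp_weight_zeroExt_refl hf.2 ha ha2) hψ.continuous hψ.2
    have intrg : ∀ {a : ℝ}, 0 < a → ∀ {ψ : E3 → ℝ}, IsTestFunction ψ →
        Integrable fun x => zeroExt (weakPartial j f) (refl a x) * ψ x := fun ha _ hψ =>
      (memLp_comp_refl ha (memLp_zeroExt (hf.3 j))).integrable_mul (hψ.memLp 2)
    -- These are the chain-rule factors of the two reflections; the division of `s2` by 2 below is
    -- the Jacobian of the second one.
    set s1 : ℝ := if j = 2 then -1 else 1 with hs1
    set s2 : ℝ := if j = 2 then -2 else 1 with hs2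
    have hψ : IsTestFunction fun x => φ x + (p * s1 * φ (refl 1⁻¹ x)
        + q * s2 / 2 * φ (refl 2⁻¹ x)) :=
      hφ.add ((r1.const_mul _).add (r2.const_mul _))
    have key := hf.integral_mul_classicalPartial (j := j) hψ ?_
    swap
    · intro hj x hx
      have e : ∀ a, refl a x = x := fun a => by
        ext i
        rw [refl_apply]
        split_ifs with h
        · rw [h, hx, mul_zero]
        · rw [one_mul]
      simp only [e, hs1, hs2, hj, if_true]
      -- On the boundary the reflections act as the identity, and the value is `(1 - p - q) φ x`.
      linear_combination (-φ x) * hpq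
    have hder : ∀ x, classicalPartial j (fun x => φ x + (p * s1 * φ (refl 1⁻¹ x)
        + q * s2 / 2 * φ (refl 2⁻¹ x))) x = classicalPartial j φ x
        + (p * classicalPartial j φ (refl 1⁻¹ x) + q / 2 * classicalPartial j φ (refl 2⁻¹ x)) := by
      intro x
      rw [classicalPartial_add j (hφ.differentiable x)
          (((r1.const_mul _).add (r2.const_mul _)).differentiable x),
        classicalPartial_add j ((r1.const_mul _).differentiable x)
          ((r2.const_mul _).differentiable x),
        classicalPartial_const_mul j _ (r1.differentiable x),
        classicalPartial_const_mul j _ (r2.differentiable x),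
        classicalPartial_comp_refl hφ.differentiable, classicalPartial_comp_refl hφ.differentiable]
      rw [hs1, hs2]
      split_ifs <;> norm_num
      ring
    simp only [hder, ← integral_zeroExt_mul] at key
    have c1 := hφj.comp_refl (a := 1⁻¹) (by norm_num)
    have c2 := hφj.comp_refl (a := 2⁻¹) (by norm_num)
    have L : ∫ x, nitscheExt p q f x * classicalPartial j φ x
        = ∫ x, zeroExt f x * (classicalPartial j φ x
        + (p * classicalPartial j φ (refl 1⁻¹ x) + q / 2 * classicalPartial j φ (refl 2⁻¹ x))) := by
      have e1 := integral_comp_refl_mul one_pos (zeroExt f) (classicalPartial j φ)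
      have e2 := integral_comp_refl_mul two_pos (zeroExt f) (classicalPartial j φ)
      calc _ = ∫ x, (zeroExt f x * classicalPartial j φ x
            + (p * (zeroExt f (refl 1 x) * classicalPartial j φ x)
              + q * (zeroExt f (refl 2 x) * classicalPartial j φ x))) := by
            congr 1 with x
            simp only [nitscheExt]
            ring
        _ = ∫ x, (zeroExt f x * classicalPartial j φ x
            + (p * (zeroExt f x * classicalPartial j φ (refl 1⁻¹ x))
              + q / 2 * (zeroExt f x * classicalPartial j φ (refl 2⁻¹ x)))) := by
            rw [integral_linear_combination (int hφj) (intr one_pos one_le_two hφj)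
              (intr two_pos le_rfl hφj), integral_linear_combination (int hφj) (int c1) (int c2),
              e1, e2]
            ring
        _ = _ := by
            congr 1 with x
            ring
    have R : ∫ x, nitscheGrad p q f j x * φ x
        = ∫ x, zeroExt (weakPartial j f) x * (φ x + (p * s1 * φ (refl 1⁻¹ x)
        + q * s2 / 2 * φ (refl 2⁻¹ x))) := by
      have e1 := integral_comp_refl_mul one_pos (zeroExt (weakPartial j f)) φ
      have e2 := integral_comp_refl_mul two_pos (zeroExt (weakPartial j f)) φ
      calc _ = ∫ x, (zeroExt (weakPartial j f) x * φ x
            + ((p * s1) * (zeroExt (weakPartial j f) (refl 1 x) * φ x)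
              + (q * s2) * (zeroExt (weakPartial j f) (refl 2 x) * φ x))) := by
            congr 1 with x
            simp only [nitscheGrad, ← hs1, ← hs2]
            ring
        _ = ∫ x, (zeroExt (weakPartial j f) x * φ x
            + ((p * s1) * (zeroExt (weakPartial j f) x * φ (refl 1⁻¹ x))
              + (q * s2 / 2) * (zeroExt (weakPartial j f) x * φ (refl 2⁻¹ x)))) := by
            rw [integral_linear_combination (intg hφ) (intrg one_pos hφ) (intrg two_pos hφ),
              integral_linear_combination (intg hφ) (intg r1) (intg r2), e1, e2]
            ring
        _ = _ := by
            congr 1 with x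
            ring
    rw [L, R, key]

/-! ### Consequences for the half-space -/

lemma nitscheGrad_of_mem (p q : ℝ) (f : E3 → ℝ) (j : Fin 3) {x : E3} (hx : x ∈ lowerHalfSpace) :
    nitscheGrad p q f j x = weakPartial j f x := by
  have hx' : ¬ 0 < x 2 := not_lt.2 (le_of_lt hx)
  rw [nitscheGrad, zeroExt, indicator_of_mem hx,
    indicator_of_notMem (by rw [refl_mem_iff one_pos]; exact hx'),
    indicator_of_notMem (by rw [refl_mem_iff two_pos]; exact hx')]
  ring

/-- Restrictions of test functions are dense in the weighted Sobolev space. -/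
lemma MemH10.exists_approx {f : E3 → ℝ} (hf : MemH10 f) :
    ∃ φ : ℕ → E3 → ℝ, (∀ n, IsTestFunction (φ n)) ∧
      Tendsto (fun n => eLpNorm (fun x => (weight x)⁻¹ * φ n x - (weight x)⁻¹ * f x) 2 halfVol)
        atTop (𝓝 0) ∧
      ∀ j, Tendsto (fun n => eLpNorm (fun x => classicalPartial j (φ n) x - weakPartial j f x) 2
        halfVol) atTop (𝓝 0) := by
  -- Any pair with `p + q = 1` would do here.
  obtain ⟨φ, hφ, h1, h2⟩ := (hf.wholeWeak_nitscheExt (p := 3) (q := -2) (by norm_num)).exists_approx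
  have hH : ∀ᵐ x ∂halfVol, x ∈ lowerHalfSpace := ae_restrict_mem measurableSet_lowerHalfSpace
  refine ⟨φ, hφ, ?_, fun j => ?_⟩
  · refine tendsto_of_tendsto_of_tendsto_of_le_of_le tendsto_const_nhds h1 (fun _ => zero_le)
      fun n => ?_
    refine le_of_eq_of_le (eLpNorm_congr_ae ?_) (eLpNorm_mono_measure _ Measure.restrict_le_self)
    filter_upwards [hH] with x hx
    rw [nitscheExt_of_mem _ _ _ hx]
  · refine tendsto_of_tendsto_of_tendsto_of_le_of_le tendsto_const_nhds (h2 j) (fun _ => zero_le)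
      fun n => ?_
    refine le_of_eq_of_le (eLpNorm_congr_ae ?_) (eLpNorm_mono_measure _ Measure.restrict_le_self)
    filter_upwards [hH] with x hx
    rw [nitscheGrad_of_mem _ _ _ _ hx]

/-- The inequalities of Korn and Hardy in the half-space. -/
lemma VecMemH10.korn_hardy {u : Fin 3 → E3 → ℝ} (hu : VecMemH10 u) :
    ∑ i, ((∫ x, ((weight x)⁻¹ * u i x) * ((weight x)⁻¹ * u i x) ∂halfVol)
        + ∑ j, ∫ x, weakPartial j (u i) x * weakPartial j (u i) x ∂halfVol)
      ≤ 315 * ∑ i, ∑ j, ∫ x, (weakPartial j (u i) x + weakPartial i (u j) x)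
        * (weakPartial j (u i) x + weakPartial i (u j) x) ∂halfVol := by
  have hH : ∀ᵐ x ∂halfVol, x ∈ lowerHalfSpace := ae_restrict_mem measurableSet_lowerHalfSpace
  -- Let `(p, q)` be the coefficients of the tangential components and `(p', q')` those of the
  -- normal one. Traces match if `p + q = p' + q' = 1`, and mixed strains map to mixed strains if
  -- `p' = -p` and `q' = -2q`. The only solution is `(3, -2)` and `(-3, 4)`.
  set p : Fin 3 → ℝ := fun i => if i = 2 then -3 else 3 with hp
  set q : Fin 3 → ℝ := fun i => if i = 2 then 4 else -2 with hq
  have hW : ∀ i, WholeWeak (nitscheExt (p i) (q i) (u i)) (nitscheGrad (p i) (q i) (u i)) :=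
    fun i => (hu i).wholeWeak_nitscheExt (by simp only [hp, hq]; split_ifs <;> norm_num)
  have key := WholeWeak.korn_hardy hW
  have sq_le : ∀ {a : E3 → ℝ} {b : E3 → ℝ}, MemLp a 2 volume → (∀ x ∈ lowerHalfSpace, a x = b x) →
      ∫ x, b x * b x ∂halfVol ≤ ∫ x, a x * a x := by
    intro a b ha hab
    have hae : (fun x => a x * a x) =ᵐ[halfVol] fun x => b x * b x := by
      filter_upwards [hH] with x hx
      rw [hab x hx]
    rw [← integral_congr_ae hae]
    exact integral_mono_measure Measure.restrict_le_self (.of_forall fun x => mul_self_nonneg _)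
      (ha.integrable_mul ha)
  refine le_trans (Finset.sum_le_sum fun i _ => add_le_add
    (sq_le (hW i).1 fun x hx => by rw [nitscheExt_of_mem _ _ _ hx])
    (Finset.sum_le_sum fun j _ => sq_le ((hW i).2 j) fun x hx => nitscheGrad_of_mem _ _ _ _ hx))
    (key.trans ?_)
  have hE : ∀ i j, ∫ x, (nitscheGrad (p i) (q i) (u i) j x + nitscheGrad (p j) (q j) (u j) i x)
      * (nitscheGrad (p i) (q i) (u i) j x + nitscheGrad (p j) (q j) (u j) i x)
      ≤ 126 * ∫ x, (weakPartial j (u i) x + weakPartial i (u j) x)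
        * (weakPartial j (u i) x + weakPartial i (u j) x) ∂halfVol := by
    intro i j
    set e : E3 → ℝ := zeroExt fun x => weakPartial j (u i) x + weakPartial i (u j) x with he
    have hem : MemLp e 2 volume := memLp_zeroExt (((hu i).3 j).add ((hu j).3 i))
    have hee : Integrable fun x => e x * e x := hem.integrable_mul hem
    have hsum : ∀ x, zeroExt (weakPartial j (u i)) x + zeroExt (weakPartial i (u j)) x = e x :=
      fun x => by
        simp only [he, zeroExt, indicator]
        split_ifs <;> simp
    have hI : ∫ x, (weakPartial j (u i) x + weakPartial i (u j) x)
        * (weakPartial j (u i) x + weakPartial i (u j) x) ∂halfVol = ∫ x, e x * e x := by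
      rw [he, integral_zeroExt_mul]
      refine integral_congr_ae (hH.mono fun x hx => ?_)
      simp only [zeroExt, indicator_of_mem hx]
    have hr1 := integral_comp_refl one_pos fun x => e x * e x
    have hr2 := integral_comp_refl two_pos fun x => e x * e x
    have ir1 := integrable_comp_refl one_pos hee
    have ir2 := integrable_comp_refl two_pos hee
    have hpt : ∀ x, (nitscheGrad (p i) (q i) (u i) j x + nitscheGrad (p j) (q j) (u j) i x)
        * (nitscheGrad (p i) (q i) (u i) j x + nitscheGrad (p j) (q j) (u j) i x)
        ≤ 3 * (e x * e x) + (27 * (e (refl 1 x) * e (refl 1 x))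
          + 192 * (e (refl 2 x) * e (refl 2 x))) := by
      intro x
      -- The choice of coefficients lets each reflected term carry a common factor for both
      -- derivatives. The extremes are `|c| = 3` and, for the normal-normal entry, `|d| = 4 · 2`.
      obtain ⟨c, d, hc, hd, hcd⟩ : ∃ c d : ℝ, c ^ 2 ≤ 9 ∧ d ^ 2 ≤ 64 ∧
          nitscheGrad (p i) (q i) (u i) j x + nitscheGrad (p j) (q j) (u j) i x
          = e x + c * e (refl 1 x) + d * e (refl 2 x) := by
        refine ⟨p i * (if j = 2 then -1 else 1), q i * (if j = 2 then -2 else 1), ?_, ?_, ?_⟩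
        · simp only [hp]
          split_ifs <;> norm_num
        · simp only [hq]
          split_ifs <;> norm_num
        · simp only [nitscheGrad, ← hsum, hp, hq]
          split_ifs <;> ring
      rw [hcd]
      have h3 : ∀ a b c : ℝ, (a + b + c) * (a + b + c) ≤ 3 * (a * a) + 3 * (b * b) + 3 * (c * c) :=
        fun a b c => by nlinarith [sq_nonneg (a - b), sq_nonneg (b - c), sq_nonneg (a - c)]
      refine (h3 _ _ _).trans ?_
      nlinarith [mul_le_mul_of_nonneg_right hc (sq_nonneg (e (refl 1 x))),
        mul_le_mul_of_nonneg_right hd (sq_nonneg (e (refl 2 x)))]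
    rw [hI]
    calc _ ≤ ∫ x, (3 * (e x * e x) + (27 * (e (refl 1 x) * e (refl 1 x))
          + 192 * (e (refl 2 x) * e (refl 2 x)))) := by
          refine integral_mono ?_ ?_ hpt
          · exact (((hW i).2 j).add ((hW j).2 i)).integrable_mul (((hW i).2 j).add ((hW j).2 i))
          · exact (hee.const_mul 3).add ((ir1.const_mul 27).add (ir2.const_mul 192))
      -- The second reflection has Jacobian 2, so the total is `3 + 27 + 192 / 2`.
      _ = 126 * ∫ x, e x * e x := by
          rw [integral_linear_combination (hee.const_mul 3) ir1 ir2, integral_const_mul, hr1, hr2]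
          ring
  -- The constant is `315 = 5/2 · 126`.
  calc _ ≤ 5 / 2 * ∑ i, ∑ j, 126 * ∫ x, (weakPartial j (u i) x + weakPartial i (u j) x)
        * (weakPartial j (u i) x + weakPartial i (u j) x) ∂halfVol := by
        gcongr with i _ j _
        exact hE i j
    _ = _ := by
        simp only [← Finset.mul_sum]
        ring


/-! ### Algebra of the elasticity tensor -/

lemma frobInner_lameTensor_symPart (l m : ℝ) (A B : Matrix (Fin 3) (Fin 3) ℝ) :
    frobInner (lameTensor l m (symPart A)) (symPart B)
      = l * (A.trace * B.trace) + ∑ i, ∑ j, 2 * (m * (symPart A i j * symPart B i j)) := by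
  simp [frobInner, lameTensor, symPart, Matrix.trace, Fin.sum_univ_three, Matrix.one_apply]
  ring

/-- Splitting `S` into its trace and its deviator diagonalizes `ℂ`, with eigenvalues `3l + 2m` and
`2m`. The diagonal deviator is expressed by the squared differences of the diagonal entries, divided
by 3. -/
lemma frobInner_lameTensor_coercive {α β l m : ℝ} (hm : α ≤ m) (hl : β ≤ 3 * l + 2 * m)
    (A : Matrix (Fin 3) (Fin 3) ℝ) :
    min (2 * α) β * frobInner (symPart A) (symPart A)
      ≤ frobInner (lameTensor l m (symPart A)) (symPart A) := by
  rw [frobInner_lameTensor_symPart]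
  set S := symPart A with hS
  have htr : A.trace = S 0 0 + S 1 1 + S 2 2 := by
    simp [hS, symPart, Matrix.trace, Fin.sum_univ_three]
    ring
  have h1 : min (2 * α) β ≤ 2 * m := (min_le_left _ _).trans (by linarith)
  have h2 : min (2 * α) β ≤ 3 * l + 2 * m := (min_le_right _ _).trans hl
  set c := min (2 * α) β
  rw [htr]
  simp only [frobInner, Fin.sum_univ_three]
  have e1 := mul_nonneg (sub_nonneg.2 h2) (sq_nonneg (S 0 0 + S 1 1 + S 2 2))
  have e2 := mul_nonneg (sub_nonneg.2 h1) (sq_nonneg (S 0 0 - S 1 1))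
  have e3 := mul_nonneg (sub_nonneg.2 h1) (sq_nonneg (S 0 0 - S 2 2))
  have e4 := mul_nonneg (sub_nonneg.2 h1) (sq_nonneg (S 1 1 - S 2 2))
  have e5 : ∀ i j, 0 ≤ (2 * m - c) * S i j ^ 2 := fun i j =>
    mul_nonneg (sub_nonneg.2 h1) (sq_nonneg _)
  linarith [e5 0 1, e5 0 2, e5 1 0, e5 1 2, e5 2 0, e5 2 1]

/-! ### Admissible coefficients -/

namespace AdmissibleLame

variable {α β K : ℝ} {lam mu : E3 → ℝ}

/-- `ENNReal.ofReal` truncates negative numbers, and `K` carries no sign; hence the bound `max K 0`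
throughout. -/
lemma _root_.HalfSpaceLame.abs_le_of_enorm_le {K t : ℝ} (h : ‖t‖ₑ ≤ ENNReal.ofReal K) :
    |t| ≤ max K 0 := by
  rw [← ofReal_norm, Real.norm_eq_abs] at h
  have := (ENNReal.ofReal_le_ofReal_iff'.1 h)
  rcases this with h | h
  · exact h.trans (le_max_left _ _)
  · exact h.trans (le_max_right _ _)

lemma _root_.HalfSpaceLame.enorm_le_c01Norm (f : E3 → ℝ) {x : E3} (hx : x ∈ lowerHalfSpace) :
    ‖f x‖ₑ ≤ c01Norm f :=
  (le_iSup₂ (f := fun x (_ : x ∈ lowerHalfSpace) => ‖f x‖ₑ) x hx).trans le_self_add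

lemma _root_.HalfSpaceLame.abs_sub_le_of_c01Norm_le {f : E3 → ℝ} {K : ℝ}
    (h : c01Norm f ≤ ENNReal.ofReal K) {x y : E3}
    (hx : x ∈ lowerHalfSpace) (hy : y ∈ lowerHalfSpace) : |f x - f y| ≤ max K 0 * ‖x - y‖ := by
  by_cases hxy : x = y
  · simp [hxy]
  have h1 : edist (f x) (f y) / edist x y ≤ ENNReal.ofReal K := by
    refine le_trans ?_ (le_add_self.trans h)
    exact (le_iSup₂ (f := fun y (_ : y ∈ lowerHalfSpace) => edist (f x) (f y) / edist x y) y hy).trans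
      (le_iSup₂ (f := fun x (_ : x ∈ lowerHalfSpace) =>
        ⨆ y ∈ lowerHalfSpace, edist (f x) (f y) / edist x y) x hx)
  have h2 := ENNReal.toReal_mono ENNReal.ofReal_ne_top h1
  rw [ENNReal.toReal_div, edist_dist, edist_dist, ENNReal.toReal_ofReal dist_nonneg,
    ENNReal.toReal_ofReal dist_nonneg, div_le_iff₀ (dist_pos.2 hxy), ENNReal.toReal_ofReal'] at h2
  rwa [Real.dist_eq, dist_eq_norm] at h2

lemma abs_mu_le (h : AdmissibleLame α β K lam mu) {x : E3} (hx : x ∈ lowerHalfSpace) :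
    |mu x| ≤ max K 0 :=
  abs_le_of_enorm_le (((enorm_le_c01Norm mu hx).trans le_self_add).trans h.lipschitz)

lemma abs_lam_le (h : AdmissibleLame α β K lam mu) {x : E3} (hx : x ∈ lowerHalfSpace) :
    |lam x| ≤ max K 0 :=
  abs_le_of_enorm_le (((enorm_le_c01Norm lam hx).trans le_add_self).trans h.lipschitz)

lemma abs_mu_sub_le (h : AdmissibleLame α β K lam mu) {x y : E3} (hx : x ∈ lowerHalfSpace)
    (hy : y ∈ lowerHalfSpace) : |mu x - mu y| ≤ max K 0 * ‖x - y‖ :=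
  abs_sub_le_of_c01Norm_le (le_self_add.trans h.lipschitz) hx hy

lemma abs_lam_sub_le (h : AdmissibleLame α β K lam mu) {x y : E3} (hx : x ∈ lowerHalfSpace)
    (hy : y ∈ lowerHalfSpace) : |lam x - lam y| ≤ max K 0 * ‖x - y‖ :=
  abs_sub_le_of_c01Norm_le (le_add_self.trans h.lipschitz) hx hy

lemma _root_.HalfSpaceLame.memLp_top_of_lipschitz {f : E3 → ℝ} {C : ℝ}
    (hb : ∀ x ∈ lowerHalfSpace, |f x| ≤ C)
    (hl : ∀ x ∈ lowerHalfSpace, ∀ y ∈ lowerHalfSpace, |f x - f y| ≤ C * ‖x - y‖) :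
    MemLp f ∞ halfVol := by
  have hc : ContinuousOn f lowerHalfSpace := by
    have : LipschitzOnWith C.toNNReal f lowerHalfSpace := by
      refine LipschitzOnWith.of_dist_le_mul fun x hx y hy => ?_
      rw [Real.dist_eq, dist_eq_norm]
      refine (hl x hx y hy).trans ?_
      gcongr
      exact Real.le_coe_toNNReal C
    exact this.continuousOn
  refine memLp_top_of_bound (hc.aestronglyMeasurable measurableSet_lowerHalfSpace) C ?_
  filter_upwards [ae_restrict_mem measurableSet_lowerHalfSpace] with x hx using hb x hx

lemma memLp_mu (h : AdmissibleLame α β K lam mu) : MemLp mu ∞ halfVol :=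
  memLp_top_of_lipschitz (fun _ hx => h.abs_mu_le hx) fun _ hx _ hy => h.abs_mu_sub_le hx hy

lemma memLp_lam (h : AdmissibleLame α β K lam mu) : MemLp lam ∞ halfVol :=
  memLp_top_of_lipschitz (fun _ hx => h.abs_lam_le hx) fun _ hx _ hy => h.abs_lam_sub_le hx hy

lemma _root_.HalfSpaceLame.c01Norm_const_le (f : E3 → ℝ) {y : E3} (hy : y ∈ lowerHalfSpace) :
    c01Norm (fun _ => f y) ≤ c01Norm f := by
  unfold c01Norm
  refine add_le_add (iSup₂_le fun _ _ => ?_) (iSup₂_le fun _ _ => iSup₂_le fun _ _ => by simp)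
  exact le_iSup₂ (f := fun x (_ : x ∈ lowerHalfSpace) => ‖f x‖ₑ) y hy

/-- Freezing the coefficients keeps them admissible. -/
lemma frozen (h : AdmissibleLame α β K lam mu) {y : E3} (hy : y ∈ lowerHalfSpace) :
    AdmissibleLame α β K (fun _ => lam y) (fun _ => mu y) where
  lipschitz := (add_le_add (c01Norm_const_le mu hy) (c01Norm_const_le lam hy)).trans h.lipschitz
  mu_ge _ _ := h.mu_ge y hy
  bulk_ge _ _ := h.bulk_ge y hy

end AdmissibleLame

/-! ### Square integrable tensor fields -/

lemma integral_mul_finset_sum_sum {μ : Measure E3} {f : Fin 3 → Fin 3 → E3 → ℝ}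
    (hf : ∀ i j, Integrable (f i j) μ) :
    ∫ x, ∑ i, ∑ j, f i j x ∂μ = ∑ i, ∑ j, ∫ x, f i j x ∂μ := by
  rw [integral_finsetSum _ fun i _ => integrable_finsetSum _ fun j _ => hf i j]
  exact Finset.sum_congr rfl fun i _ => integral_finsetSum _ fun j _ => hf i j

lemma TensorMemL2.integrable_frobInner {A B : E3 → Matrix (Fin 3) (Fin 3) ℝ} (hA : TensorMemL2 A)
    (hB : TensorMemL2 B) : Integrable (fun x => frobInner (A x) (B x)) halfVol :=
  integrable_finsetSum _ fun i _ => integrable_finsetSum _ fun j _ => (hA i j).integrable_mul (hB i j)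

lemma TensorMemL2.symPart {A : E3 → Matrix (Fin 3) (Fin 3) ℝ} (hA : TensorMemL2 A) :
    TensorMemL2 fun x => symPart (A x) := fun i j => by
  simpa [HalfSpaceLame.symPart] using ((hA i j).add (hA j i)).const_mul (1 / 2)

lemma memLp_mul_of_top {a f : E3 → ℝ} (ha : MemLp a ∞ halfVol) (hf : MemLp f 2 halfVol) :
    MemLp (fun x => a x * f x) 2 halfVol := hf.mul ha

lemma TensorMemL2.lameTensor {lam mu : E3 → ℝ} (hl : MemLp lam ∞ halfVol) (hm : MemLp mu ∞ halfVol)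
    {A : E3 → Matrix (Fin 3) (Fin 3) ℝ} (hA : TensorMemL2 A) :
    TensorMemL2 fun x => lameTensor (lam x) (mu x) (A x) := fun i j => by
  have h1 : MemLp (fun x => lam x * (A x).trace) 2 halfVol :=
    memLp_mul_of_top hl (memLp_finsetSum _ fun i _ => hA i i)
  have h2 : MemLp (fun x => mu x * HalfSpaceLame.symPart (A x) i j) 2 halfVol :=
    memLp_mul_of_top hm (hA.symPart i j)
  refine ((h1.mul_const ((1 : Matrix (Fin 3) (Fin 3) ℝ) i j)).add (h2.const_mul 2)).ae_eq
    (.of_forall fun x => ?_)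
  simp [HalfSpaceLame.lameTensor]
  ring

lemma VecMemH10.weakGrad_memL2 {u : Fin 3 → E3 → ℝ} (hu : VecMemH10 u) : TensorMemL2 (weakGrad u) :=
  fun i j => (hu i).3 j

lemma VecMemH10.strain_memL2 {u : Fin 3 → E3 → ℝ} (hu : VecMemH10 u) : TensorMemL2 (strain u) :=
  hu.weakGrad_memL2.symPart


lemma integrable_mul_of_memLp_two {μ : Measure E3} {f g : E3 → ℝ} (hf : MemLp f 2 μ)
    (hg : MemLp g 2 μ) : Integrable (fun x => f x * g x) μ := hf.integrable_mul hg

/-! ### The Hilbert space of weighted Sobolev fields -/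

/-- Square integrable functions on the half-space. -/
abbrev HalfL2 : Type := Lp ℝ 2 halfVol

/-- Indices for the components of a vector field and of its gradient. -/
abbrev JetIdx : Type := Fin 3 × Option (Fin 3)

/-- Candidates for the weighted components of a vector field together with its gradient. -/
abbrev Jet : Type := PiLp 2 fun _ : JetIdx => HalfL2

lemma inner_toLp_left {f : E3 → ℝ} (hf : MemLp f 2 halfVol) (g : HalfL2) :
    inner ℝ (hf.toLp f) g = ∫ x, g x * f x ∂halfVol := by
  rw [L2.inner_def]
  refine integral_congr_ae ?_
  filter_upwards [hf.coeFn_toLp] with x hx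
  rw [hx]
  simp

lemma inner_eq_integral (f g : HalfL2) : inner ℝ f g = ∫ x, f x * g x ∂halfVol := by
  rw [L2.inner_def]
  simp [mul_comm]

lemma IsTestFunction.memLp_weight_mul {φ : E3 → ℝ} (hφ : IsTestFunction φ) :
    MemLp (fun x => weight x * φ x) 2 halfVol :=
  ((continuous_weight.mul hφ.continuous).memLp_of_hasCompactSupport hφ.2.mul_left).restrict _

/-- The fields whose gradient components are the weak derivatives of the function components. -/
noncomputable def sobolevJets : Submodule ℝ Jet where
  carrier := {Z | ∀ (i j : Fin 3) (φ : E3 → ℝ) (hφ : IsTestFunction φ), tsupport φ ⊆ lowerHalfSpace →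
    inner ℝ ((hφ.classicalPartial j).memLp_weight_mul.toLp _) (Z (i, none))
      + inner ℝ ((hφ.memLp_half 2).toLp φ) (Z (i, some j)) = 0}
  add_mem' {Z Z'} h h' i j φ hφ hs := by
    have h1 := h i j φ hφ hs
    have h2 := h' i j φ hφ hs
    simp only [PiLp.add_apply, inner_add_right]
    linarith
  zero_mem' i j φ hφ hs := by simp
  smul_mem' c Z h i j φ hφ hs := by
    have h1 := h i j φ hφ hs
    simp only [PiLp.smul_apply, inner_smul_right]
    linear_combination c * h1

/-- The defining conditions are zero sets of continuous functionals: the factor `ϱ` that undoes the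
weight in the zeroth-order slot is harmless, because the test functions have compact support. -/
lemma isClosed_sobolevJets : IsClosed (sobolevJets : Set Jet) := by
  have : (sobolevJets : Set Jet) = ⋂ (i : Fin 3) (j : Fin 3) (φ : E3 → ℝ) (hφ : IsTestFunction φ)
      (_ : tsupport φ ⊆ lowerHalfSpace), {Z : Jet |
      inner ℝ ((hφ.classicalPartial j).memLp_weight_mul.toLp _) (Z (i, none))
      + inner ℝ ((hφ.memLp_half 2).toLp φ) (Z (i, some j)) = 0} := by
    ext Z
    simp only [mem_iInter]
    rfl
  rw [this]
  refine isClosed_iInter fun i => isClosed_iInter fun j => isClosed_iInter fun φ =>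
    isClosed_iInter fun hφ => isClosed_iInter fun _ => isClosed_eq ?_ continuous_const
  have hp : ∀ k : JetIdx, Continuous fun Z : Jet => Z k := fun k =>
    (PiLp.proj 2 (𝕜 := ℝ) (fun _ : JetIdx => HalfL2) k).continuous
  exact (continuous_const.inner (hp _)).add (continuous_const.inner (hp _))

instance : CompleteSpace sobolevJets := isClosed_sobolevJets.completeSpace_coe

lemma locallyIntegrableOn_half {f : E3 → ℝ} (hf : MemLp (fun x => (weight x)⁻¹ * f x) 2 halfVol) :
    LocallyIntegrableOn f lowerHalfSpace := by
  have : IsFiniteMeasureOnCompacts halfVol := by unfold halfVol; infer_instance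
  intro x _
  refine ⟨Metric.closedBall x 1 ∩ lowerHalfSpace,
    Filter.inter_mem (mem_nhdsWithin_of_mem_nhds (Metric.closedBall_mem_nhds x one_pos))
      self_mem_nhdsWithin, ?_⟩
  have := integrableOn_of_memLp_weight hf (isCompact_closedBall x 1)
  rwa [IntegrableOn, halfVol, Measure.restrict_restrict Metric.isClosed_closedBall.measurableSet]
    at this

/-- The vector field of an element of the Hilbert space. -/
noncomputable def jetField (Z : Jet) (i : Fin 3) (x : E3) : ℝ := weight x * Z (i, none) x

lemma inv_weight_mul_jetField (Z : Jet) (i : Fin 3) (x : E3) :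
    (weight x)⁻¹ * jetField Z i x = Z (i, none) x := by
  have := (weight_pos x).ne'
  rw [jetField]
  field_simp

lemma hasWeakPartial_jetField {Z : Jet} (hZ : Z ∈ sobolevJets) (i j : Fin 3) :
    HasWeakPartial j (jetField Z i) (Z (i, some j)) := by
  refine ⟨locallyIntegrableOn_half ?_, locallyIntegrableOn_half ?_, fun φ hφ hs => ?_⟩
  · simp only [inv_weight_mul_jetField]
    exact Lp.memLp _
  · exact memLp_inv_weight_mul (Lp.memLp _)
  · have := hZ i j φ hφ hs
    rw [inner_toLp_left, inner_toLp_left] at this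
    rw [← eq_neg_iff_add_eq_zero] at this
    rw [← this]
    congr 1 with x
    simp only [jetField]
    ring

lemma vecMemH10_jetField {Z : Jet} (hZ : Z ∈ sobolevJets) : VecMemH10 (jetField Z) := fun i => {
  weaklyDifferentiable := fun j => ⟨_, hasWeakPartial_jetField hZ i j⟩
  memLp_weight := by
    simp only [inv_weight_mul_jetField]
    exact Lp.memLp _
  memLp_partial := fun j =>
    (Lp.memLp (Z (i, some j))).ae_eq (hasWeakPartial_jetField hZ i j).weakPartial_ae_eq.symm }

/-- The element of the Hilbert space that belongs to square integrable component functions. -/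
noncomputable def mkJet {b : Fin 3 → E3 → ℝ} {A : E3 → Matrix (Fin 3) (Fin 3) ℝ}
    (hb : ∀ i, MemLp (b i) 2 halfVol) (hA : TensorMemL2 A) : Jet :=
  WithLp.toLp 2 fun k => match k with
    | (i, none) => (hb i).toLp
    | (i, some j) => (hA i j).toLp

lemma mkJet_mem {u : Fin 3 → E3 → ℝ} (hu : VecMemH10 u) :
    mkJet (fun i => (hu i).2) hu.weakGrad_memL2 ∈ sobolevJets := by
  intro i j φ hφ hs
  rw [inner_toLp_left, inner_toLp_left, ← eq_neg_iff_add_eq_zero]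
  have h := ((hu i).1.hasWeakPartial j).2.2 φ hφ hs
  refine Eq.trans ?_ (h.trans (congrArg Neg.neg ?_))
  · refine integral_congr_ae ?_
    filter_upwards [(hu i).2.coeFn_toLp] with x hx
    have := (weight_pos x).ne'
    simp only [mkJet]
    rw [hx]
    field_simp
  · refine integral_congr_ae ?_
    filter_upwards [(hu.weakGrad_memL2 i j).coeFn_toLp] with x hx
    simp only [mkJet]
    rw [hx]
    rfl

/-! ### The energy form -/

/-- The gradient part of an element of the Hilbert space. -/
noncomputable def jetGrad (Z : Jet) (x : E3) : Matrix (Fin 3) (Fin 3) ℝ :=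
  Matrix.of fun i j => Z (i, some j) x

lemma jetGrad_memL2 (Z : Jet) : TensorMemL2 (jetGrad Z) := fun i j => Lp.memLp (Z (i, some j))

lemma weakGrad_jetField {Z : Jet} (hZ : Z ∈ sobolevJets) :
    weakGrad (jetField Z) =ᵐ[halfVol] jetGrad Z := by
  have h : ∀ i j, weakPartial j (jetField Z i) =ᵐ[halfVol] Z (i, some j) := fun i j =>
    (hasWeakPartial_jetField hZ i j).weakPartial_ae_eq
  filter_upwards [eventually_all.2 fun i => eventually_all.2 fun j => h i j] with x hx
  ext i j
  exact hx i j

lemma jetGrad_mkJet {b : Fin 3 → E3 → ℝ} {A : E3 → Matrix (Fin 3) (Fin 3) ℝ}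
    (hb : ∀ i, MemLp (b i) 2 halfVol) (hA : TensorMemL2 A) :
    jetGrad (mkJet hb hA) =ᵐ[halfVol] A := by
  have h : ∀ i j, ((mkJet hb hA) (i, some j) : E3 → ℝ) =ᵐ[halfVol] fun x => A x i j := fun i j =>
    (hA i j).coeFn_toLp
  filter_upwards [eventually_all.2 fun i => eventually_all.2 fun j => h i j] with x hx
  ext i j
  exact hx i j

/-- Coordinates of the Hilbert space. -/
noncomputable def jetProj (k : JetIdx) : Jet →L[ℝ] HalfL2 :=
  PiLp.proj 2 (𝕜 := ℝ) (fun _ : JetIdx => HalfL2) k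

/-- The symmetric part of the gradient. -/
noncomputable def jetSym (i j : Fin 3) : Jet →L[ℝ] HalfL2 :=
  (1 / 2 : ℝ) • (jetProj (i, some j) + jetProj (j, some i))

/-- The divergence. -/
noncomputable def jetTrace : Jet →L[ℝ] HalfL2 := ∑ i, jetProj (i, some i)

lemma jetSym_ae (Z : Jet) (i j : Fin 3) :
    (jetSym i j Z : E3 → ℝ) =ᵐ[halfVol] fun x => symPart (jetGrad Z x) i j := by
  have e : jetSym i j Z = (1 / 2 : ℝ) • (Z (i, some j) + Z (j, some i)) := rfl
  rw [e]
  filter_upwards [Lp.coeFn_smul (1 / 2 : ℝ) (Z (i, some j) + Z (j, some i)),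
    Lp.coeFn_add (Z (i, some j)) (Z (j, some i))] with x h1 h2
  rw [h1, Pi.smul_apply, h2]
  rfl

lemma jetTrace_ae (Z : Jet) :
    (jetTrace Z : E3 → ℝ) =ᵐ[halfVol] fun x => (jetGrad Z x).trace := by
  have e : jetTrace Z = Z (0, some 0) + Z (1, some 1) + Z (2, some 2) := by
    simp [jetTrace, Fin.sum_univ_three, jetProj]
  rw [e]
  filter_upwards [Lp.coeFn_add (Z (0, some 0) + Z (1, some 1)) (Z (2, some 2)),
    Lp.coeFn_add (Z (0, some 0)) (Z (1, some 1))] with x h1 h2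
  rw [h1, Pi.add_apply, h2]
  simp [Matrix.trace, Fin.sum_univ_three, jetGrad]

/-- Multiplication by a bounded function. -/
noncomputable def mulOp {a : E3 → ℝ} (ha : MemLp a ∞ halfVol) : HalfL2 →L[ℝ] HalfL2 :=
  (ContinuousLinearMap.mul ℝ ℝ).holderL halfVol ∞ 2 2 (ha.toLp a)

lemma mulOp_ae {a : E3 → ℝ} (ha : MemLp a ∞ halfVol) (f : HalfL2) :
    (mulOp ha f : E3 → ℝ) =ᵐ[halfVol] fun x => a x * f x := by
  filter_upwards [(ContinuousLinearMap.mul ℝ ℝ).coeFn_holder (r := 2) (ha.toLp a) f,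
    ha.coeFn_toLp] with x h1 h2
  refine Eq.trans h1 ?_
  rw [h2]
  rfl

/-- The energy form of the Lamé system. -/
noncomputable def jetForm {lam mu : E3 → ℝ} (hl : MemLp lam ∞ halfVol) (hm : MemLp mu ∞ halfVol) :
    Jet →L[ℝ] Jet →L[ℝ] ℝ :=
  (innerSL ℝ).bilinearComp ((mulOp hl).comp jetTrace) jetTrace
    + ∑ i, ∑ j, (2 : ℝ) • (innerSL ℝ).bilinearComp ((mulOp hm).comp (jetSym i j)) (jetSym i j)

/-- Assembling the form from bounded operators gives its continuity at once; this lemma identifies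
it with the energy integral. -/
lemma jetForm_apply {lam mu : E3 → ℝ} (hl : MemLp lam ∞ halfVol) (hm : MemLp mu ∞ halfVol)
    (Z Z' : Jet) : jetForm hl hm Z Z' = ∫ x, frobInner (lameTensor (lam x) (mu x)
      (symPart (jetGrad Z x))) (symPart (jetGrad Z' x)) ∂halfVol := by
  have e : jetForm hl hm Z Z' = inner ℝ (mulOp hl (jetTrace Z)) (jetTrace Z')
      + ∑ i, ∑ j, 2 * inner ℝ (mulOp hm (jetSym i j Z)) (jetSym i j Z') := by
    simp [jetForm]
  have i1 : MemLp (fun x => (jetGrad Z x).trace) 2 halfVol :=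
    memLp_finsetSum _ fun i _ => jetGrad_memL2 Z i i
  have i2 : MemLp (fun x => (jetGrad Z' x).trace) 2 halfVol :=
    memLp_finsetSum _ fun i _ => jetGrad_memL2 Z' i i
  have I1 : Integrable (fun x => lam x * ((jetGrad Z x).trace * (jetGrad Z' x).trace)) halfVol := by
    simpa only [mul_assoc] using integrable_mul_of_memLp_two (memLp_mul_of_top hl i1) i2
  have I2 : ∀ i j, Integrable (fun x => 2 * (mu x * (symPart (jetGrad Z x) i j
      * symPart (jetGrad Z' x) i j))) halfVol := fun i j => by
    have := integrable_mul_of_memLp_two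
      (memLp_mul_of_top hm ((jetGrad_memL2 Z).symPart i j)) ((jetGrad_memL2 Z').symPart i j)
    simpa only [mul_assoc] using this.const_mul 2
  simp only [frobInner_lameTensor_symPart]
  rw [e, integral_add I1 (integrable_finsetSum _ fun i _ => integrable_finsetSum _ fun j _ => I2 i j),
    integral_mul_finset_sum_sum I2]
  congr 1
  · rw [inner_eq_integral]
    refine integral_congr_ae ?_
    filter_upwards [mulOp_ae hl (jetTrace Z), jetTrace_ae Z, jetTrace_ae Z'] with x h1 h2 h3
    rw [h1, h2, h3, mul_assoc]
  · refine Finset.sum_congr rfl fun i _ => Finset.sum_congr rfl fun j _ => ?_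
    rw [integral_const_mul, inner_eq_integral]
    congr 1
    refine integral_congr_ae ?_
    filter_upwards [mulOp_ae hm (jetSym i j Z), jetSym_ae Z i j, jetSym_ae Z' i j] with x h1 h2 h3
    rw [h1, h2, h3, mul_assoc]

/-! ### Coercivity of the energy form and the Lax–Milgram theorem. -/

lemma norm_sq_jet (Z : Jet) : ‖Z‖ ^ 2 = ∑ i, ((∫ x, Z (i, none) x * Z (i, none) x ∂halfVol)
    + ∑ j, ∫ x, Z (i, some j) x * Z (i, some j) x ∂halfVol) := by
  rw [PiLp.norm_sq_eq_of_L2, Fintype.sum_prod_type]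
  refine Finset.sum_congr rfl fun i _ => ?_
  rw [Fintype.sum_option]
  simp only [← real_inner_self_eq_norm_sq, inner_eq_integral]

/-- The left-hand side of the inequality of Korn and Hardy is controlled by the strain. -/
lemma VecMemH10.korn_hardy_strain {u : Fin 3 → E3 → ℝ} (hu : VecMemH10 u) :
    ∑ i, ((∫ x, ((weight x)⁻¹ * u i x) * ((weight x)⁻¹ * u i x) ∂halfVol)
        + ∑ j, ∫ x, weakPartial j (u i) x * weakPartial j (u i) x ∂halfVol)
      ≤ 1260 * ∫ x, frobInner (strain u x) (strain u x) ∂halfVol := by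
  -- The strain carries a factor `1/2`, so its square carries `1/4`, and `1260 = 4 · 315`.
  refine hu.korn_hardy.trans (le_of_eq ?_)
  have hs := hu.strain_memL2
  simp only [frobInner]
  rw [integral_mul_finset_sum_sum fun i j =>
    integrable_mul_of_memLp_two (hs i j) (hs i j), Finset.mul_sum,
    Finset.mul_sum]
  refine Finset.sum_congr rfl fun i _ => ?_
  rw [Finset.mul_sum, Finset.mul_sum]
  refine Finset.sum_congr rfl fun j _ => ?_
  rw [← integral_const_mul, ← integral_const_mul]
  congr 1 with x
  simp [strain, symPart, weakGrad]
  ring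

lemma AdmissibleLame.energy_coercive {α β K : ℝ} {lam mu : E3 → ℝ} (h : AdmissibleLame α β K lam mu)
    {u : Fin 3 → E3 → ℝ} (hu : VecMemH10 u) :
    min (2 * α) β * ∫ x, frobInner (strain u x) (strain u x) ∂halfVol
      ≤ ∫ x, frobInner (lameTensor (lam x) (mu x) (strain u x)) (strain u x) ∂halfVol := by
  have hs := hu.strain_memL2
  rw [← integral_const_mul]
  refine integral_mono_ae ((hs.integrable_frobInner hs).const_mul _)
    ((hs.lameTensor h.memLp_lam h.memLp_mu).integrable_frobInner hs) ?_
  filter_upwards [ae_restrict_mem measurableSet_lowerHalfSpace] with x hx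
  exact frobInner_lameTensor_coercive (h.mu_ge x hx) (h.bulk_ge x hx) _

/-- Solvability of the variational problem. -/
theorem AdmissibleLame.exists_solution {α β K : ℝ} {lam mu : E3 → ℝ}
    (h : AdmissibleLame α β K lam mu) (hα : 0 < α) (hβ : 0 < β) {b : Fin 3 → E3 → ℝ}
    {A : E3 → Matrix (Fin 3) (Fin 3) ℝ} (hb : ∀ i, MemLp (b i) 2 halfVol) (hA : TensorMemL2 A) :
    ∃ w, VecMemH10 w ∧ ∀ v, VecMemH10 v →
      ∫ x, frobInner (lameTensor (lam x) (mu x) (strain w x)) (strain v x) ∂halfVol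
        = ∑ i, ((∫ x, b i x * ((weight x)⁻¹ * v i x) ∂halfVol)
          + ∑ j, ∫ x, A x i j * weakGrad v x i j ∂halfVol) := by
  set B : sobolevJets →L[ℝ] sobolevJets →L[ℝ] ℝ := (jetForm h.memLp_lam h.memLp_mu).bilinearComp
    sobolevJets.subtypeL sobolevJets.subtypeL with hB
  have hc : 0 < min (2 * α) β := lt_min (by positivity) hβ
  have hBapp : ∀ Z Z' : sobolevJets, B Z Z' = ∫ x, frobInner (lameTensor (lam x) (mu x)
      (strain (jetField Z) x)) (strain (jetField Z') x) ∂halfVol := by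
    intro Z Z'
    have e : B Z Z' = jetForm h.memLp_lam h.memLp_mu Z Z' := rfl
    rw [e, jetForm_apply]
    refine integral_congr_ae ?_
    filter_upwards [weakGrad_jetField Z.2, weakGrad_jetField Z'.2] with x h1 h2
    simp only [strain, h1, h2]
  have hcoer : IsCoercive B := by
    refine ⟨min (2 * α) β / 1260, by positivity, fun Z => ?_⟩
    have hu := vecMemH10_jetField Z.2
    have k1 := hu.korn_hardy_strain
    have k2 := h.energy_coercive hu
    rw [← hBapp] at k2
    have e : ‖Z‖ * ‖Z‖ = ∑ i, ((∫ x, ((weight x)⁻¹ * jetField Z i x) *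
        ((weight x)⁻¹ * jetField Z i x) ∂halfVol)
        + ∑ j, ∫ x, weakPartial j (jetField Z i) x * weakPartial j (jetField Z i) x ∂halfVol) := by
      rw [← sq, ← Submodule.norm_coe, norm_sq_jet]
      refine Finset.sum_congr rfl fun i _ => ?_
      simp only [inv_weight_mul_jetField]
      congr 1
      refine Finset.sum_congr rfl fun j _ => integral_congr_ae ?_
      filter_upwards [(hasWeakPartial_jetField Z.2 i j).weakPartial_ae_eq] with x hx
      rw [hx]
    rw [mul_assoc, e]
    calc min (2 * α) β / 1260 * _ ≤ min (2 * α) β / 1260 *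
          (1260 * ∫ x, frobInner (strain (jetField Z) x) (strain (jetField Z) x) ∂halfVol) := by
          gcongr
      _ = min (2 * α) β * ∫ x, frobInner (strain (jetField Z) x) (strain (jetField Z) x) ∂halfVol := by
          ring
      _ ≤ B Z Z := k2
  -- The right-hand side is the inner product with a jet that need not come from a Sobolev field.
  -- Projecting it onto the closed subspace does not change its pairing with admissible fields.
  set Z0 : Jet := mkJet hb hA with hZ0
  set f : sobolevJets := sobolevJets.orthogonalProjectionOnto Z0 with hf
  set Zw : sobolevJets := hcoer.continuousLinearEquivOfBilin.symm f with hZw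
  refine ⟨jetField Zw, vecMemH10_jetField Zw.2, fun v hv => ?_⟩
  set Zv : sobolevJets := ⟨mkJet (fun i => (hv i).2) hv.weakGrad_memL2, mkJet_mem hv⟩ with hZv
  have key : B Zw Zv = inner ℝ Z0 (Zv : Jet) := by
    rw [← hcoer.continuousLinearEquivOfBilin_apply, hZw, ContinuousLinearEquiv.apply_symm_apply, hf,
      Submodule.inner_orthogonalProjectionOnto_eq_of_mem_right]
  have e : B Zw Zv = jetForm h.memLp_lam h.memLp_mu Zw Zv := rfl
  rw [e, jetForm_apply] at key
  have hL : ∫ x, frobInner (lameTensor (lam x) (mu x) (strain (jetField Zw) x)) (strain v x) ∂halfVol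
      = ∫ x, frobInner (lameTensor (lam x) (mu x) (symPart (jetGrad Zw x)))
        (symPart (jetGrad Zv x)) ∂halfVol := by
    refine integral_congr_ae ?_
    filter_upwards [weakGrad_jetField Zw.2, jetGrad_mkJet (fun i => (hv i).2) hv.weakGrad_memL2]
      with x h1 h2
    simp only [strain, h1, hZv, h2]
  rw [hL, key, PiLp.inner_apply, Fintype.sum_prod_type]
  refine Finset.sum_congr rfl fun i _ => ?_
  rw [Fintype.sum_option]
  congr 1
  · change inner ℝ ((hb i).toLp) (((hv i).2).toLp) = _
    rw [inner_toLp_left]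
    refine integral_congr_ae ?_
    filter_upwards [(hv i).2.coeFn_toLp] with x hx
    rw [hx, mul_comm]
  · refine Finset.sum_congr rfl fun j _ => ?_
    change inner ℝ ((hA i j).toLp) ((hv.weakGrad_memL2 i j).toLp) = _
    rw [inner_toLp_left]
    refine integral_congr_ae ?_
    filter_upwards [(hv.weakGrad_memL2 i j).coeFn_toLp] with x hx
    rw [hx, mul_comm]


/-! ### The Galerkin representation of solutions of the Lamé system -/

lemma classicalPartial_sum {ι : Type*} (s : Finset ι) {f : ι → E3 → ℝ} {x : E3} (j : Fin 3)
    (hf : ∀ i ∈ s, DifferentiableAt ℝ (f i) x) :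
    classicalPartial j (fun y => ∑ i ∈ s, f i y) x = ∑ i ∈ s, classicalPartial j (f i) x := by
  simp [classicalPartial, fderiv_fun_sum hf]

/-- The displacement field with Galerkin vector in the direction of a coordinate axis. -/
noncomputable def galerkinField (κ : ℝ) (ρ P : E3 → ℝ) (k i : Fin 3) (x : E3) : ℝ :=
  (if i = k then 1 else 0) * P x - κ * classicalPartial i (classicalPartial k ρ) x

lemma contDiff_galerkinField {κ : ℝ} {ρ P : E3 → ℝ} (hρ : ContDiff ℝ ∞ ρ) (hP : ContDiff ℝ ∞ P)
    (k i : Fin 3) : ContDiff ℝ ∞ (galerkinField κ ρ P k i) :=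
  (contDiff_const.mul hP).sub (contDiff_const.mul
    (contDiff_classicalPartial (contDiff_classicalPartial hρ k) i))

lemma classicalPartial_galerkinField {κ : ℝ} {ρ P : E3 → ℝ} (hρ : ContDiff ℝ ∞ ρ)
    (hP : ContDiff ℝ ∞ P) (k i j : Fin 3) : classicalPartial j (galerkinField κ ρ P k i)
      = galerkinField κ (classicalPartial j ρ) (classicalPartial j P) k i := by
  have hd : ∀ {f : E3 → ℝ}, ContDiff ℝ ∞ f → Differentiable ℝ f := fun h => h.differentiable (by simp)
  have hρ2 := contDiff_classicalPartial (contDiff_classicalPartial hρ k) i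
  have hk : classicalPartial k (classicalPartial j ρ) = classicalPartial j (classicalPartial k ρ) :=
    funext (classicalPartial_comm hρ k j)
  ext x
  have e : galerkinField κ ρ P k i = fun x => (if i = k then 1 else 0) * P x
    - κ * classicalPartial i (classicalPartial k ρ) x := rfl
  rw [e, classicalPartial_sub j (hd (contDiff_const.mul hP) x) (hd (contDiff_const.mul hρ2) x),
    classicalPartial_const_mul j _ (hd hP x), classicalPartial_const_mul j _ (hd hρ2 x),
    galerkinField, hk, classicalPartial_comm (contDiff_classicalPartial hρ k) j i]

lemma sum_classicalPartial_galerkinField {κ : ℝ} {ρ P : E3 → ℝ} (hρ : ContDiff ℝ ∞ ρ)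
    (hP : ContDiff ℝ ∞ P) (hΔ : ∀ x, P x = ∑ j, classicalPartial j (classicalPartial j ρ) x)
    (k : Fin 3) (x : E3) :
    ∑ i, classicalPartial i (galerkinField κ ρ P k i) x = (1 - κ) * classicalPartial k P x := by
  have hd : ∀ {f : E3 → ℝ}, ContDiff ℝ ∞ f → Differentiable ℝ f := fun h => h.differentiable (by simp)
  have h1 : ∀ i, classicalPartial i (classicalPartial k (classicalPartial i ρ)) x
      = classicalPartial k (classicalPartial i (classicalPartial i ρ)) x := fun i =>
    classicalPartial_comm (contDiff_classicalPartial hρ i) i k x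
  have h2 : classicalPartial k P x
      = ∑ i, classicalPartial k (classicalPartial i (classicalPartial i ρ)) x := by
    rw [funext hΔ]
    exact classicalPartial_sum _ _ fun i _ =>
      hd (contDiff_classicalPartial (contDiff_classicalPartial hρ i) i) x
  simp only [classicalPartial_galerkinField hρ hP, galerkinField, h1, Finset.sum_sub_distrib,
    ← Finset.mul_sum, ← h2]
  simp
  ring

/-- The divergence of the stress of a Galerkin field. -/
lemma div_stress_galerkinField {l m κ : ℝ} (hκ : (l + 2 * m) * κ = l + m) {ρ P : E3 → ℝ}
    (hρ : ContDiff ℝ ∞ ρ) (hP : ContDiff ℝ ∞ P)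
    (hΔ : ∀ x, P x = ∑ j, classicalPartial j (classicalPartial j ρ) x) (k i : Fin 3) (x : E3) :
    ∑ j, classicalPartial j (fun x => lameTensor l m
        (symPart (classicalGrad (galerkinField κ ρ P k) x)) i j) x
      = (if i = k then 1 else 0) * (m * ∑ j, classicalPartial j (classicalPartial j P) x) := by
  have hd : ∀ {f : E3 → ℝ}, ContDiff ℝ ∞ f → Differentiable ℝ f := fun h => h.differentiable (by simp)
  set u := galerkinField κ ρ P k with hu
  have hus : ∀ i, ContDiff ℝ ∞ (u i) := contDiff_galerkinField hρ hP k
  have hdiv : ∀ x, (symPart (classicalGrad u x)).trace = (1 - κ) * classicalPartial k P x := by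
    -- Differentiation commutes, so the divergence of the field is `(1 - κ) ∂ₖP` because `P` is the
    -- Laplacian of `ρ`.
    intro x
    rw [← sum_classicalPartial_galerkinField hρ hP hΔ]
    simp [symPart, classicalGrad, Matrix.trace, ← hu]
    refine Finset.sum_congr rfl fun i _ => by ring
  have hσ : ∀ j, (fun x => lameTensor l m (symPart (classicalGrad u x)) i j)
      = fun x => (l * (1 - κ) * (1 : Matrix (Fin 3) (Fin 3) ℝ) i j) * classicalPartial k P x
        + (m * classicalPartial j (u i) x + m * classicalPartial i (u j) x) := by
    intro j
    ext x
    simp only [lameTensor, Matrix.add_apply, Matrix.smul_apply, smul_eq_mul, hdiv]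
    simp [symPart, classicalGrad]
    ring
  have hP1 := contDiff_classicalPartial hP k
  have hu1 := fun i j => contDiff_classicalPartial (hus i) j
  have hterm : ∀ j, classicalPartial j (fun x => lameTensor l m
        (symPart (classicalGrad u x)) i j) x
      = (l * (1 - κ) * (1 : Matrix (Fin 3) (Fin 3) ℝ) i j) * classicalPartial j (classicalPartial k P) x
        + (m * classicalPartial j (classicalPartial j (u i)) x
          + m * classicalPartial i (classicalPartial j (u j)) x) := by
    intro j
    rw [hσ, classicalPartial_add j (hd (contDiff_const.mul hP1) x)
      (hd ((contDiff_const.mul (hu1 i j)).add (contDiff_const.mul (hu1 j i))) x),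
      classicalPartial_const_mul j _ (hd hP1 x),
      classicalPartial_add j (hd (contDiff_const.mul (hu1 i j)) x)
        (hd (contDiff_const.mul (hu1 j i)) x),
      classicalPartial_const_mul j _ (hd (hu1 i j) x),
      classicalPartial_const_mul j _ (hd (hu1 j i) x), classicalPartial_comm (hus j) j i]
  have h3 : ∑ j, classicalPartial i (classicalPartial j (u j)) x
      = (1 - κ) * classicalPartial i (classicalPartial k P) x := by
    rw [← classicalPartial_sum _ _ fun j _ => hd (hu1 j j) x,
      ← classicalPartial_const_mul i _ (hd hP1 x)]
    congr 1
    ext x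
    exact sum_classicalPartial_galerkinField hρ hP hΔ k x
  have h4 : ∑ j, classicalPartial j (classicalPartial j (u i)) x
      = (if i = k then 1 else 0) * (∑ j, classicalPartial j (classicalPartial j P) x)
        - κ * classicalPartial i (classicalPartial k P) x := by
    have hL : classicalPartial i (classicalPartial k P) x
        = ∑ j, classicalPartial i (classicalPartial k (classicalPartial j (classicalPartial j ρ))) x := by
      have hk : classicalPartial k P
          = fun x => ∑ j, classicalPartial k (classicalPartial j (classicalPartial j ρ)) x := by
        ext z
        rw [funext hΔ]
        exact classicalPartial_sum _ _ fun j _ =>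
          hd (contDiff_classicalPartial (contDiff_classicalPartial hρ j) j) z
      rw [hk]
      exact classicalPartial_sum _ _ fun j _ => hd (contDiff_classicalPartial
        (contDiff_classicalPartial (contDiff_classicalPartial hρ j) j) k) x
    simp only [hu, classicalPartial_galerkinField hρ hP, classicalPartial_galerkinField
      (contDiff_classicalPartial hρ _) (contDiff_classicalPartial hP _)]
    simp only [galerkinField, Finset.sum_sub_distrib, ← Finset.mul_sum, hL]
  simp only [hterm, Finset.sum_add_distrib, ← Finset.mul_sum, h3, h4]
  have h5 : ∑ j, l * (1 - κ) * (1 : Matrix (Fin 3) (Fin 3) ℝ) i j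
      * classicalPartial j (classicalPartial k P) x
      = l * (1 - κ) * classicalPartial i (classicalPartial k P) x := by
    simp [Matrix.one_apply]
  rw [h5]
  -- The terms with `∂ᵢ∂ₖP` add up to the factor `l + m - (l + 2m)κ`, which is zero; only `m ΔP` in
  -- direction `k` survives.
  linear_combination (-classicalPartial i (classicalPartial k P) x) * hκ

/-! ### The regularized distance -/

/-- The inverse of the regularized distance `(|x|² + e²)^(1/2)`. -/
noncomputable def regInv (e : ℝ) (x : E3) : ℝ := (Real.sqrt (‖x‖ ^ 2 + e ^ 2))⁻¹

lemma regInv_nonneg (e : ℝ) (x : E3) : 0 ≤ regInv e x := inv_nonneg.2 (Real.sqrt_nonneg _)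

lemma regInv_sq_mul {e : ℝ} {x : E3} (h : 0 < ‖x‖ ^ 2 + e ^ 2) :
    regInv e x ^ 2 * (‖x‖ ^ 2 + e ^ 2) = 1 := by
  rw [regInv, inv_pow, Real.sq_sqrt h.le, inv_mul_cancel₀ h.ne']

lemma contDiff_regDist {e : ℝ} (he : 0 < e) :
    ContDiff ℝ ∞ fun x : E3 => Real.sqrt (‖x‖ ^ 2 + e ^ 2) :=
  ((contDiff_norm_sq ℝ).add contDiff_const).sqrt fun x => by positivity

lemma contDiff_regInv {e : ℝ} (he : 0 < e) : ContDiff ℝ ∞ (regInv e) :=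
  (contDiff_regDist he).inv fun x => by positivity

lemma classicalPartial_regDist {e : ℝ} (he : 0 < e) (j : Fin 3) :
    classicalPartial j (fun x : E3 => Real.sqrt (‖x‖ ^ 2 + e ^ 2)) = fun x => x j * regInv e x := by
  ext x
  have h1 : HasFDerivAt (fun x : E3 => ‖x‖ ^ 2 + e ^ 2) (2 • innerSL ℝ x) x :=
    ((hasStrictFDerivAt_norm_sq x).hasFDerivAt).add_const _
  have h2 := h1.sqrt (by positivity)
  rw [classicalPartial, h2.fderiv]
  simp [EuclideanSpace.inner_single_right, regInv]
  field_simp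

lemma classicalPartial_regInv {e : ℝ} (he : 0 < e) (j : Fin 3) (x : E3) :
    classicalPartial j (regInv e) x = -(x j * regInv e x ^ 3) := by
  have hd := ((contDiff_regDist he).differentiable (by simp) x).hasFDerivAt
  have h0 : Real.sqrt (‖x‖ ^ 2 + e ^ 2) ≠ 0 := by positivity
  have h := (hasDerivAt_inv h0).comp_hasFDerivAt x hd
  have e1 := congrFun (classicalPartial_regDist he j) x
  rw [classicalPartial] at e1
  have e2 : fderiv ℝ (regInv e) x = _ := h.fderiv
  rw [classicalPartial, e2]
  simp only [_root_.smul_apply, e1, smul_eq_mul]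
  rw [← inv_pow, ← regInv]
  ring

/-- The product rule for monomials in the inverse regularized distance. -/
lemma classicalPartial_mul_regInv_pow {e : ℝ} (he : 0 < e) {f : E3 → ℝ} (hf : ContDiff ℝ ∞ f)
    (p : ℕ) (j : Fin 3) (x : E3) :
    classicalPartial j (fun x => f x * regInv e x ^ p) x
      = classicalPartial j f x * regInv e x ^ p - p * (x j * f x) * regInv e x ^ (p + 2) := by
  have hs := ((contDiff_regInv he).differentiable (by simp) x)
  have hp : classicalPartial j (fun x => regInv e x ^ p) x = - (p * x j * regInv e x ^ (p + 2)) := by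
    have h := hs.hasFDerivAt.pow p
    have e1 := classicalPartial_regInv he j x
    rw [classicalPartial] at e1
    rw [classicalPartial, h.fderiv]
    simp only [_root_.smul_apply, e1, smul_eq_mul]
    rcases p with _ | p
    · simp
    · simp only [Nat.add_sub_cancel]
      push_cast
      simp
      ring
  rw [classicalPartial_mul (g := fun x => regInv e x ^ p) j (hf.differentiable (by simp) x)
    (hs.pow p), hp]
  ring


/-! ### The singular field and its regularizations -/

/-- The (regularized) singular field with pole at the origin, up to normalization. -/
noncomputable def singField (κ e : ℝ) (k i : Fin 3) (x : E3) : ℝ :=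
  (if i = k then 1 else 0) * (2 * regInv e x + e ^ 2 * regInv e x ^ 3)
    - κ * ((if i = k then 1 else 0) * regInv e x - x i * x k * regInv e x ^ 3)

/-- The partial derivatives of the (regularized) singular field. -/
noncomputable def singGrad (κ e : ℝ) (k i j : Fin 3) (x : E3) : ℝ :=
  (if i = k then 1 else 0) * (-2 * (x j * regInv e x ^ 3) - 3 * (e ^ 2 * (x j * regInv e x ^ 5)))
    - κ * (-(if i = k then 1 else 0) * (x j * regInv e x ^ 3)
      - ((if i = j then 1 else 0) * (x k * regInv e x ^ 3)
        + (if k = j then 1 else 0) * (x i * regInv e x ^ 3))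
      + 3 * (x i * x k * x j * regInv e x ^ 5))

/-- The Laplacian of the regularized distance. -/
noncomputable def regLap (e : ℝ) (x : E3) : ℝ := 2 * regInv e x + e ^ 2 * regInv e x ^ 3

lemma differentiable_of_contDiff {f : E3 → ℝ} (hf : ContDiff ℝ ∞ f) : Differentiable ℝ f :=
  hf.differentiable (by simp)

section Regularized

variable {e : ℝ} (he : 0 < e)
include he

lemma contDiff_regLap : ContDiff ℝ ∞ (regLap e) :=
  (contDiff_const.mul (contDiff_regInv he)).add (contDiff_const.mul ((contDiff_regInv he).pow 3))

lemma regInv_rel (x : E3) : regInv e x ^ 2 * (x 0 ^ 2 + x 1 ^ 2 + x 2 ^ 2 + e ^ 2) = 1 := by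
  have := regInv_sq_mul (e := e) (x := x) (by positivity)
  rwa [norm_sq_eq_sum, Fin.sum_univ_three] at this

lemma classicalPartial_regInv_pow (p : ℕ) (j : Fin 3) (x : E3) :
    classicalPartial j (fun x => regInv e x ^ p) x = - (p * x j * regInv e x ^ (p + 2)) := by
  have := classicalPartial_mul_regInv_pow he (f := fun _ => 1) contDiff_const p j x
  simp only [one_mul, classicalPartial_const, zero_mul, mul_one, zero_sub] at this
  exact this

lemma classicalPartial_classicalPartial_regDist (i k : Fin 3) (x : E3) :
    classicalPartial i (classicalPartial k fun x : E3 => Real.sqrt (‖x‖ ^ 2 + e ^ 2)) x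
      = (if i = k then 1 else 0) * regInv e x - x i * x k * regInv e x ^ 3 := by
  rw [classicalPartial_regDist he]
  have := classicalPartial_mul_regInv_pow he (contDiff_coord k) 1 i x
  simp only [pow_one, classicalPartial_coord] at this
  rw [this]
  simp only [eq_comm (a := k)]
  push_cast
  ring

/-- The explicit formula, unlike the representation by derivatives of the smooth distance, also
makes sense for `e = 0`, where it is the singular limit. -/
lemma singField_eq_galerkinField (κ : ℝ) (k : Fin 3) : singField κ e k
    = galerkinField κ (fun x : E3 => Real.sqrt (‖x‖ ^ 2 + e ^ 2)) (regLap e) k := by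
  ext i x
  rw [galerkinField, classicalPartial_classicalPartial_regDist he, singField, regLap]

lemma contDiff_singField (κ : ℝ) (k i : Fin 3) : ContDiff ℝ ∞ (singField κ e k i) := by
  rw [singField_eq_galerkinField he]
  exact contDiff_galerkinField (contDiff_regDist he) (contDiff_regLap he) k i

lemma regLap_eq_sum (x : E3) : regLap e x = ∑ j, classicalPartial j
    (classicalPartial j fun x : E3 => Real.sqrt (‖x‖ ^ 2 + e ^ 2)) x := by
  simp only [classicalPartial_classicalPartial_regDist he, Fin.sum_univ_three, regLap]
  simp only [↓reduceIte]
  linear_combination regInv e x * regInv_rel he x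

lemma classicalPartial_regLap (j : Fin 3) : classicalPartial j (regLap e)
    = fun x => -2 * (x j * regInv e x ^ 3) + (-3 * e ^ 2) * (x j * regInv e x ^ 5) := by
  ext x
  have hs := contDiff_regInv he
  have e1 := classicalPartial_regInv_pow he 3 j x
  rw [show regLap e = fun x => 2 * regInv e x + e ^ 2 * regInv e x ^ 3 from rfl,
    classicalPartial_add j (differentiable_of_contDiff (contDiff_const.mul hs) x)
      (differentiable_of_contDiff (contDiff_const.mul (hs.pow 3)) x),
    classicalPartial_const_mul j _ (differentiable_of_contDiff hs x),
    classicalPartial_const_mul j _ (differentiable_of_contDiff (hs.pow 3) x),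
    classicalPartial_regInv he, e1]
  push_cast
  ring

/-- The bilaplacian of the regularized distance. It is the dilate of one fixed integrable profile
that keeps its integral as `e` varies, hence an approximate multiple of the Dirac measure. -/
lemma laplacian_regLap (x : E3) :
    ∑ j, classicalPartial j (classicalPartial j (regLap e)) x = -15 * e ^ 4 * regInv e x ^ 7 := by
  have hs := contDiff_regInv he
  have h : ∀ j, classicalPartial j (classicalPartial j (regLap e)) x
      = -2 * (regInv e x ^ 3 - 3 * x j ^ 2 * regInv e x ^ 5)
        + (-3 * e ^ 2) * (regInv e x ^ 5 - 5 * x j ^ 2 * regInv e x ^ 7) := by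
    intro j
    rw [classicalPartial_regLap he,
      classicalPartial_add j (differentiable_of_contDiff
        (contDiff_const.mul ((contDiff_coord j).mul (hs.pow 3))) x)
        (differentiable_of_contDiff (contDiff_const.mul ((contDiff_coord j).mul (hs.pow 5))) x),
      classicalPartial_const_mul j _
        (differentiable_of_contDiff ((contDiff_coord j).mul (hs.pow 3)) x),
      classicalPartial_const_mul j _
        (differentiable_of_contDiff ((contDiff_coord j).mul (hs.pow 5)) x),
      classicalPartial_mul_regInv_pow he (contDiff_coord j),
      classicalPartial_mul_regInv_pow he (contDiff_coord j), classicalPartial_coord]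
    simp only [↓reduceIte]
    push_cast
    ring
  simp only [h, Fin.sum_univ_three]
  linear_combination (6 * regInv e x ^ 3 + 15 * e ^ 2 * regInv e x ^ 5) * regInv_rel he x

lemma classicalPartial_singField (κ : ℝ) (k i j : Fin 3) :
    classicalPartial j (singField κ e k i) = singGrad κ e k i j := by
  ext x
  have hs := contDiff_regInv he
  have hik := (contDiff_coord i).mul (contDiff_coord k)
  have hd : ∀ {f : E3 → ℝ}, ContDiff ℝ ∞ f → DifferentiableAt ℝ f x := fun h =>
    differentiable_of_contDiff h x
  have e1 : classicalPartial j (regLap e) x = _ := congrFun (classicalPartial_regLap he j) x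
  have e2 := classicalPartial_mul_regInv_pow he hik 3 j x
  have e3 := classicalPartial_mul j (hd (contDiff_coord i)) (hd (contDiff_coord k))
  rw [show singField κ e k i = fun x => (if i = k then 1 else 0) * regLap e x
    - κ * ((if i = k then 1 else 0) * regInv e x - x i * x k * regInv e x ^ 3) from rfl,
    classicalPartial_sub j (hd (contDiff_const.mul (contDiff_regLap he)))
      (hd (contDiff_const.mul ((contDiff_const.mul hs).sub (hik.mul (hs.pow 3))))),
    classicalPartial_const_mul j _ (hd (contDiff_regLap he)),
    classicalPartial_const_mul j _ (hd ((contDiff_const.mul hs).sub (hik.mul (hs.pow 3)))),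
    classicalPartial_sub j (hd (contDiff_const.mul hs)) (hd (hik.mul (hs.pow 3))),
    classicalPartial_const_mul j _ (hd hs), classicalPartial_regInv he, e1, e2, e3,
    classicalPartial_coord, classicalPartial_coord, singGrad]
  push_cast
  ring

/-- For `e > 0` everything is smooth, so integration by parts reduces the energy pairing to the
stress divergence, which is concentrated in direction `k`. -/
lemma weak_eq_singField {l m κ : ℝ} (hκ : (l + 2 * m) * κ = l + m) (k : Fin 3)
    {φ : Fin 3 → E3 → ℝ} (hφ : ∀ i, IsTestFunction (φ i)) :
    ∑ i, ∑ j, ∫ x, lameTensor l m (symPart (Matrix.of fun i j => singGrad κ e k i j x)) i j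
        * classicalPartial j (φ i) x
      = 15 * m * ∫ x, e ^ 4 * regInv e x ^ 7 * φ k x := by
  have hg : ∀ x, (Matrix.of fun i j => singGrad κ e k i j x)
      = classicalGrad (singField κ e k) x := fun x => by
    ext i j
    rw [classicalGrad, Matrix.of_apply, Matrix.of_apply, classicalPartial_singField he]
  simp only [hg]
  have hgc : ∀ i j, ContDiff ℝ ∞ fun x => classicalGrad (singField κ e k) x i j := fun i j =>
    contDiff_classicalPartial (contDiff_singField he κ k i) j
  have hσ : ∀ i j, ContDiff ℝ ∞ fun x =>
      lameTensor l m (symPart (classicalGrad (singField κ e k) x)) i j := by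
    intro i j
    simp only [lameTensor, symPart, Matrix.trace, Matrix.add_apply, Matrix.smul_apply,
      Matrix.diag_apply, Matrix.transpose_apply, smul_eq_mul]
    have h1 : ContDiff ℝ ∞ fun x => ∑ i, 1 / 2 * (classicalGrad (singField κ e k) x i i
        + classicalGrad (singField κ e k) x i i) :=
      ContDiff.sum fun i _ => contDiff_const.mul ((hgc i i).add (hgc i i))
    exact ((contDiff_const.mul h1).mul contDiff_const).add
      (contDiff_const.mul (contDiff_const.mul
        ((contDiff_const.mul ((hgc i j).add (hgc j i))).add
          (contDiff_const.mul ((hgc j i).add (hgc i j))))))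
  have hdiv := div_stress_galerkinField hκ (contDiff_regDist he) (contDiff_regLap he)
    (regLap_eq_sum he) k
  rw [← singField_eq_galerkinField he] at hdiv
  have hi : ∀ i, ∑ j, ∫ x, lameTensor l m (symPart (classicalGrad (singField κ e k) x)) i j
      * classicalPartial j (φ i) x
      = if i = k then 15 * m * ∫ x, e ^ 4 * regInv e x ^ 7 * φ k x else 0 := by
    intro i
    have h1 : ∀ j, ∫ x, lameTensor l m (symPart (classicalGrad (singField κ e k) x)) i j
        * classicalPartial j (φ i) x = - ∫ x, classicalPartial j (fun x => lameTensor l m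
          (symPart (classicalGrad (singField κ e k) x)) i j) x * φ i x := fun j =>
      integral_mul_classicalPartial (hσ i j) (hφ i) j
    simp only [h1, Finset.sum_neg_distrib]
    rw [← integral_finsetSum _ fun j _ =>
      ((hφ i).mul_left (contDiff_classicalPartial (hσ i j) j)).integrable]
    simp only [← Finset.sum_mul, hdiv, laplacian_regLap he]
    split_ifs with hik
    · subst hik
      rw [← integral_const_mul, ← integral_neg]
      congr 1 with x
      ring
    · simp
  simp only [hi]
  simp

end Regularized

/-! ### Bounds -/

section Bounds

variable {e : ℝ} (he : 0 ≤ e) {x : E3} (hx : x ≠ 0)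

lemma abs_coord_le_norm (x : E3) (i : Fin 3) : |x i| ≤ ‖x‖ := PiLp.norm_apply_le x i

include hx in
lemma regInv_le (e : ℝ) : regInv e x ≤ ‖x‖⁻¹ := by
  have : 0 < ‖x‖ := norm_pos_iff.2 hx
  refine inv_anti₀ this (Real.le_sqrt_of_sq_le ?_)
  nlinarith [sq_nonneg e]

include hx in
lemma norm_mul_regInv_le (e : ℝ) : ‖x‖ * regInv e x ≤ 1 := by
  have : 0 < ‖x‖ := norm_pos_iff.2 hx
  calc ‖x‖ * regInv e x ≤ ‖x‖ * ‖x‖⁻¹ := by gcongr; exact regInv_le hx e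
    _ = 1 := mul_inv_cancel₀ this.ne'

include hx in
lemma abs_coord_mul_regInv_le (e : ℝ) (i : Fin 3) : |x i * regInv e x| ≤ 1 := by
  rw [abs_mul, abs_of_nonneg (regInv_nonneg e x)]
  exact (mul_le_mul_of_nonneg_right (abs_coord_le_norm x i) (regInv_nonneg e x)).trans
    (norm_mul_regInv_le hx e)

include hx in
lemma sq_mul_regInv_sq_le (e : ℝ) : e ^ 2 * regInv e x ^ 2 ≤ 1 := by
  have h := regInv_sq_mul (e := e) (x := x) (by have := norm_pos_iff.2 hx; positivity)
  nlinarith [sq_nonneg (‖x‖ * regInv e x)]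

include hx in
-- Each term is homogeneous of degree one in `regInv` once the coordinates and `e` are paired with
-- it, and those pairs are bounded by 1. The bound does not depend on `e`, as dominated convergence
-- requires.
lemma abs_singField_le (κ e : ℝ) (k i : Fin 3) :
    |singField κ e k i x| ≤ (3 + 2 * |κ|) * ‖x‖⁻¹ := by
  set s := regInv e x with hs
  have hs0 : 0 ≤ s := regInv_nonneg e x
  have hδ : |(if i = k then (1 : ℝ) else 0)| ≤ 1 := by split_ifs <;> simp
  have h1 : |2 * s + e ^ 2 * s ^ 3| ≤ 3 * s := by
    have := sq_mul_regInv_sq_le hx e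
    rw [abs_of_nonneg (by positivity)]
    nlinarith
  have h2 : |x i * x k * s ^ 3| ≤ s := by
    rw [show x i * x k * s ^ 3 = (x i * s) * (x k * s) * s by ring, abs_mul, abs_mul,
      abs_of_nonneg hs0]
    exact mul_le_of_le_one_left hs0 (mul_le_one₀ (abs_coord_mul_regInv_le hx e i) (abs_nonneg _)
      (abs_coord_mul_regInv_le hx e k))
  calc |singField κ e k i x| ≤ 1 * (3 * s) + |κ| * (1 * s + s) := by
        rw [singField]
        refine (abs_sub _ _).trans (add_le_add ?_ ?_)
        · rw [abs_mul]
          exact mul_le_mul hδ h1 (abs_nonneg _) zero_le_one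
        · rw [abs_mul]
          refine mul_le_mul_of_nonneg_left ((abs_sub _ _).trans (add_le_add ?_ h2)) (abs_nonneg _)
          rw [abs_mul, ← hs, abs_of_nonneg hs0]
          exact mul_le_mul_of_nonneg_right hδ hs0
    _ = (3 + 2 * |κ|) * s := by ring
    _ ≤ _ := by
        gcongr
        exact regInv_le hx e

include hx in
-- The same pairing leaves two free powers of `regInv`, again uniformly in `e`.
lemma abs_singGrad_le (κ e : ℝ) (k i j : Fin 3) :
    |singGrad κ e k i j x| ≤ (5 + 6 * |κ|) * (‖x‖⁻¹) ^ 2 := by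
  set s := regInv e x with hs
  have hs0 : 0 ≤ s := regInv_nonneg e x
  have hδ : ∀ a b : Fin 3, |(if a = b then (1 : ℝ) else 0)| ≤ 1 := fun a b => by
    split_ifs <;> simp
  have h1 : ∀ a : Fin 3, |x a * s ^ 3| ≤ s ^ 2 := fun a => by
    rw [show x a * s ^ 3 = (x a * s) * s ^ 2 by ring, abs_mul, abs_of_nonneg (sq_nonneg s)]
    exact mul_le_of_le_one_left (sq_nonneg s) (abs_coord_mul_regInv_le hx e a)
  have h2 : |e ^ 2 * (x j * s ^ 5)| ≤ s ^ 2 := by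
    rw [show e ^ 2 * (x j * s ^ 5) = (e ^ 2 * s ^ 2) * (x j * s ^ 3) by ring, abs_mul,
      abs_of_nonneg (by positivity)]
    exact (mul_le_of_le_one_left (abs_nonneg _) (sq_mul_regInv_sq_le hx e)).trans (h1 j)
  have h3 : |x i * x k * x j * s ^ 5| ≤ s ^ 2 := by
    rw [show x i * x k * x j * s ^ 5 = (x i * s) * (x k * s) * (x j * s ^ 3) by ring, abs_mul,
      abs_mul]
    exact (mul_le_of_le_one_left (abs_nonneg _) (mul_le_one₀ (abs_coord_mul_regInv_le hx e i)
      (abs_nonneg _) (abs_coord_mul_regInv_le hx e k))).trans (h1 j)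
  have hδ1 : ∀ a b c : Fin 3, |(if a = b then (1 : ℝ) else 0) * (x c * s ^ 3)| ≤ s ^ 2 :=
    fun a b c => by
      rw [abs_mul]
      exact (mul_le_of_le_one_left (abs_nonneg _) (hδ a b)).trans (h1 c)
  calc |singGrad κ e k i j x| ≤ 1 * (2 * s ^ 2 + 3 * s ^ 2)
        + |κ| * ((s ^ 2 + (s ^ 2 + s ^ 2)) + 3 * s ^ 2) := by
        rw [singGrad]
        refine (abs_sub _ _).trans (add_le_add ?_ ?_)
        · rw [abs_mul]
          refine mul_le_mul (hδ i k) ((abs_sub _ _).trans (add_le_add ?_ ?_)) (abs_nonneg _)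
            zero_le_one
          · rw [abs_mul, abs_neg, abs_two]
            exact mul_le_mul_of_nonneg_left (h1 j) two_pos.le
          · rw [abs_mul, abs_of_pos three_pos]
            exact mul_le_mul_of_nonneg_left h2 three_pos.le
        · rw [abs_mul]
          refine mul_le_mul_of_nonneg_left ((abs_add_le _ _).trans (add_le_add ?_ ?_)) (abs_nonneg _)
          · refine (abs_sub _ _).trans (add_le_add ?_ ((abs_add_le _ _).trans
              (add_le_add (hδ1 i j k) (hδ1 k j i))))
            rw [neg_mul, abs_neg]
            exact hδ1 i k j
          · rw [abs_mul, abs_of_pos three_pos]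
            exact mul_le_mul_of_nonneg_left h3 three_pos.le
    _ = (5 + 6 * |κ|) * s ^ 2 := by ring
    _ ≤ _ := by
        gcongr
        exact regInv_le hx e

include hx in
lemma tendsto_regInv {ε : ℕ → ℝ} (hε : Tendsto ε atTop (𝓝 0)) :
    Tendsto (fun n => regInv (ε n) x) atTop (𝓝 (regInv 0 x)) := by
  refine Tendsto.inv₀ ?_ ?_
  · exact (Real.continuous_sqrt.tendsto _).comp (tendsto_const_nhds.add (hε.pow 2))
  · have : 0 < ‖x‖ := norm_pos_iff.2 hx
    positivity

include hx in
lemma tendsto_singField (κ : ℝ) (k i : Fin 3) {ε : ℕ → ℝ} (hε : Tendsto ε atTop (𝓝 0)) :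
    Tendsto (fun n => singField κ (ε n) k i x) atTop (𝓝 (singField κ 0 k i x)) := by
  have h := tendsto_regInv hx hε
  exact (tendsto_const_nhds.mul ((tendsto_const_nhds.mul h).add ((hε.pow 2).mul (h.pow 3)))).sub
    (tendsto_const_nhds.mul ((tendsto_const_nhds.mul h).sub (tendsto_const_nhds.mul (h.pow 3))))

include hx in
lemma tendsto_singGrad (κ : ℝ) (k i j : Fin 3) {ε : ℕ → ℝ} (hε : Tendsto ε atTop (𝓝 0)) :
    Tendsto (fun n => singGrad κ (ε n) k i j x) atTop (𝓝 (singGrad κ 0 k i j x)) := by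
  have h := tendsto_regInv hx hε
  have h3 := fun c : ℝ => (h.pow 3).const_mul c
  have h5 := fun c : ℝ => (h.pow 5).const_mul c
  exact (tendsto_const_nhds.mul (((h3 _).const_mul _).sub (((hε.pow 2).mul (h5 _)).const_mul _))).sub
    (tendsto_const_nhds.mul ((((h3 _).const_mul _).sub (((h3 _).const_mul _).add
      ((h3 _).const_mul _))).add ((h5 _).const_mul _)))

end Bounds

lemma measurable_regInv (e : ℝ) : Measurable (regInv e) := by
  unfold regInv
  fun_prop

lemma measurable_singField (κ e : ℝ) (k i : Fin 3) : Measurable (singField κ e k i) := by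
  have := measurable_regInv e
  unfold singField
  fun_prop

lemma measurable_singGrad (κ e : ℝ) (k i j : Fin 3) : Measurable (singGrad κ e k i j) := by
  have := measurable_regInv e
  unfold singGrad
  fun_prop


/-! ### Passage to the limit in the regularization -/

/-- In polar coordinates the Jacobian `t²` cancels the singularity, and the radial integrand is the
constant 1 on `(0, R)`. -/
lemma integrableOn_inv_norm_sq (R : ℝ) :
    IntegrableOn (fun x : E3 => (‖x‖⁻¹) ^ 2) (Metric.ball 0 R) := by
  rw [← integrable_indicator_iff Metric.isOpen_ball.measurableSet]
  have e : (Metric.ball (0 : E3) R).indicator (fun x : E3 => (‖x‖⁻¹) ^ 2)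
      = fun x => (Iio R).indicator (fun t : ℝ => (t⁻¹) ^ 2) ‖x‖ := by
    ext x
    simp [indicator]
  rw [e, integrable_fun_norm_addHaar]
  have h1 : IntegrableOn (fun _ : ℝ => (1 : ℝ)) (Ioo 0 R) := by
    simp
  rw [← integrable_indicator_iff measurableSet_Ioi]
  rw [← integrable_indicator_iff measurableSet_Ioo] at h1
  refine h1.congr (.of_forall fun t => ?_)
  by_cases h0 : 0 < t
  · by_cases hR : t < R
    · simp [indicator, h0, hR, h0.ne']
    · simp [indicator, h0, hR]
  · simp [indicator, h0]

lemma locallyIntegrable_inv_norm_sq : LocallyIntegrable fun x : E3 => (‖x‖⁻¹) ^ 2 := by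
  intro x
  refine ⟨Metric.ball 0 (‖x‖ + 1), Metric.isOpen_ball.mem_nhds (by simp), integrableOn_inv_norm_sq _⟩

lemma ae_ne_zero : ∀ᵐ x : E3, x ≠ 0 := by
  simp [ae_iff]

lemma integrable_singular_bound {φ : E3 → ℝ} (hφ : IsTestFunction φ) (C : ℝ) :
    Integrable fun x => C * (1 + (‖x‖⁻¹) ^ 2) * φ x := by
  have h1 : LocallyIntegrable (fun x : E3 => C * (1 + (‖x‖⁻¹) ^ 2)) volume :=
    ((locallyIntegrable_const (1 : ℝ)).add locallyIntegrable_inv_norm_sq).smul C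
  exact integrable_mul_of_support (h1.integrableOn_isCompact hφ.2) hφ.2 hφ.continuous
    fun _ hx => image_eq_zero_of_notMem_tsupport hx

/-- Dominated convergence with the locally integrable bound `C (1 + |x|⁻²)`; the value at the pole
does not matter. -/
lemma tendsto_integral_singular {F : ℕ → E3 → ℝ} {f φ : E3 → ℝ} {C : ℝ} (hφ : IsTestFunction φ)
    (hm : ∀ n, Measurable (F n)) (hb : ∀ n x, x ≠ 0 → |F n x| ≤ C * (1 + (‖x‖⁻¹) ^ 2))
    (hlim : ∀ x, x ≠ 0 → Tendsto (fun n => F n x) atTop (𝓝 (f x))) :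
    Tendsto (fun n => ∫ x, F n x * φ x) atTop (𝓝 (∫ x, f x * φ x)) := by
  refine tendsto_integral_of_dominated_convergence _
    (fun n => ((hm n).mul hφ.continuous.measurable).aestronglyMeasurable)
    (integrable_singular_bound hφ C).norm (fun n => ?_) ?_
  · filter_upwards [ae_ne_zero] with x hx
    rw [norm_mul, norm_mul]
    gcongr
    exact (hb n x hx).trans (le_abs_self _)
  · filter_upwards [ae_ne_zero] with x hx
    exact (hlim x hx).mul_const _

lemma inv_norm_le (x : E3) : ‖x‖⁻¹ ≤ 1 + (‖x‖⁻¹) ^ 2 := by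
  nlinarith [sq_nonneg (‖x‖⁻¹ - 1), inv_nonneg.2 (norm_nonneg x)]

lemma tendsto_one_div : Tendsto (fun n : ℕ => 1 / ((n : ℝ) + 1)) atTop (𝓝 0) :=
  tendsto_one_div_add_atTop_nhds_zero_nat

lemma regInv_one_pow_seven (x : E3) : (1 + ‖x‖ ^ 2) ^ (-(7 : ℝ) / 2) = regInv 1 x ^ 7 := by
  have hq : (0 : ℝ) ≤ 1 + ‖x‖ ^ 2 := by positivity
  rw [neg_div, Real.rpow_neg hq, Real.rpow_div_two_eq_sqrt _ hq,
    show (7 : ℝ) = ((7 : ℕ) : ℝ) by norm_num, Real.rpow_natCast, regInv, inv_pow, one_pow,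
    add_comm (1 : ℝ)]

lemma integrable_regInv_pow : Integrable fun x : E3 => regInv 1 x ^ 7 := by
  have hd : (Module.finrank ℝ E3 : ℝ) < 7 := by
    rw [finrank_euclideanSpace, Fintype.card_fin]
    norm_num
  have h := integrable_rpow_neg_one_add_norm_sq (E := E3) (μ := volume) (r := 7) hd
  simp only [regInv_one_pow_seven] at h
  exact h

/-- The total mass of the regularized source. -/
noncomputable def sourceMass : ℝ := ∫ x : E3, regInv 1 x ^ 7

lemma sourceMass_pos : 0 < sourceMass := by
  have hpos : ∀ x : E3, 0 < regInv 1 x ^ 7 := fun x => by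
    unfold regInv
    positivity
  rw [sourceMass, integral_pos_iff_support_of_nonneg (fun x => (hpos x).le) integrable_regInv_pow]
  have : Function.support (fun x : E3 => regInv 1 x ^ 7) = univ :=
    eq_univ_of_forall fun x => (hpos x).ne'
  rw [this]
  simp

lemma regInv_smul {c : ℝ} (hc : 0 < c) (x : E3) : regInv 1 (c • x) = c⁻¹ * regInv c⁻¹ x := by
  rw [regInv, regInv, norm_smul, Real.norm_of_nonneg hc.le, ← mul_inv]
  congr 1
  rw [show (c * ‖x‖) ^ 2 + 1 ^ 2 = c ^ 2 * (‖x‖ ^ 2 + c⁻¹ ^ 2) by field_simp,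
    Real.sqrt_mul (sq_nonneg c), Real.sqrt_sq hc.le]

/-- With `c = n + 1` and `e = 1 / c`, the source is `c³ · regInv 1 (c x)⁷`, which has the mass of
its profile and concentrates at the origin. -/
lemma tendsto_integral_source {φ : E3 → ℝ} (hφ : IsTestFunction φ) :
    Tendsto (fun n : ℕ => ∫ x, (1 / ((n : ℝ) + 1)) ^ 4 * regInv (1 / ((n : ℝ) + 1)) x ^ 7 * φ x)
      atTop (𝓝 (sourceMass * φ 0)) := by
  have hI := sourceMass_pos
  have key := tendsto_integral_comp_smul_smul_of_integrable (μ := (volume : Measure E3))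
    (φ := fun x => sourceMass⁻¹ * regInv 1 x ^ 7) (fun x => by
      have := regInv_nonneg 1 x
      positivity) (by rw [integral_const_mul, ← sourceMass, inv_mul_cancel₀ hI.ne']) ?_
      hφ.integrable hφ.continuous.continuousAt
  · have hc : Tendsto (fun n : ℕ => (n : ℝ) + 1) atTop atTop :=
      tendsto_atTop_add_const_right _ _ tendsto_natCast_atTop_atTop
    have h2 := (key.comp hc).const_mul sourceMass
    refine h2.congr fun n => ?_
    simp only [Function.comp_apply]
    rw [← integral_const_mul]
    congr 1 with x
    have hn : (0 : ℝ) < (n : ℝ) + 1 := by positivity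
    rw [regInv_smul hn, one_div]
    simp only [finrank_euclideanSpace, Fintype.card_fin, smul_eq_mul]
    field_simp
  -- The approximate identity lemma demands that `|x|³` times the profile vanish at infinity; the
  -- profile decays like `|x|⁻⁷`.
  · have h0 : Tendsto (fun x : E3 => sourceMass⁻¹ * ‖x‖⁻¹) (Bornology.cobounded E3) (𝓝 0) := by
      have := (tendsto_inv_atTop_zero.comp (tendsto_norm_cobounded_atTop (E := E3))).const_mul
        sourceMass⁻¹
      simpa using this
    have hne : ∀ᶠ x : E3 in Bornology.cobounded E3, x ≠ 0 := by
      filter_upwards [tendsto_norm_cobounded_atTop.eventually_gt_atTop (0 : ℝ)] with x hx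
      exact norm_pos_iff.1 hx
    refine squeeze_zero' (.of_forall fun x => ?_) ?_ h0
    · have := regInv_nonneg 1 x
      positivity
    · filter_upwards [hne] with x hx
      have hs0 := regInv_nonneg 1 x
      have hs1 : regInv 1 x ≤ 1 := by
        have := sq_mul_regInv_sq_le hx 1
        nlinarith
      have h1 := norm_mul_regInv_le hx 1
      have h3 : (‖x‖ * regInv 1 x) ^ 3 ≤ 1 := pow_le_one₀ (by positivity) h1
      have h4 : regInv 1 x ^ 4 ≤ ‖x‖⁻¹ := by
        calc regInv 1 x ^ 4 ≤ regInv 1 x := pow_le_of_le_one hs0 hs1 (by norm_num)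
          _ ≤ _ := regInv_le hx 1
      simp only [finrank_euclideanSpace, Fintype.card_fin]
      calc ‖x‖ ^ 3 * (sourceMass⁻¹ * regInv 1 x ^ 7)
          = sourceMass⁻¹ * ((‖x‖ * regInv 1 x) ^ 3 * regInv 1 x ^ 4) := by ring
        _ ≤ sourceMass⁻¹ * (1 * ‖x‖⁻¹) := by gcongr
        _ = _ := by rw [one_mul]

lemma lameTensor_symPart_apply (l m : ℝ) (A : Matrix (Fin 3) (Fin 3) ℝ) (i j : Fin 3) :
    lameTensor l m (symPart A) i j
      = l * (1 : Matrix (Fin 3) (Fin 3) ℝ) i j * (A 0 0 + A 1 1 + A 2 2) + m * (A i j + A j i) := by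
  simp [lameTensor, symPart, Matrix.trace, Fin.sum_univ_three]
  ring

lemma abs_lameTensor_symPart_le {l m B : ℝ} {A : Matrix (Fin 3) (Fin 3) ℝ}
    (hA : ∀ i j, |A i j| ≤ B) (i j : Fin 3) :
    |lameTensor l m (symPart A) i j| ≤ (3 * |l| + 2 * |m|) * B := by
  have hB : 0 ≤ B := (abs_nonneg _).trans (hA 0 0)
  rw [lameTensor_symPart_apply]
  have h1 : |(1 : Matrix (Fin 3) (Fin 3) ℝ) i j| ≤ 1 := by
    rw [Matrix.one_apply]
    split_ifs <;> simp
  have h2 : |A 0 0 + A 1 1 + A 2 2| ≤ 3 * B := by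
    refine (abs_add_three _ _ _).trans ?_
    linarith [hA 0 0, hA 1 1, hA 2 2]
  have h3 : |A i j + A j i| ≤ 2 * B := (abs_add_le _ _).trans (by linarith [hA i j, hA j i])
  calc _ ≤ |l| * 1 * (3 * B) + |m| * (2 * B) := by
        refine (abs_add_le _ _).trans (add_le_add ?_ ?_)
        · rw [abs_mul, abs_mul]
          gcongr
        · rw [abs_mul]
          gcongr
    _ = _ := by ring

/-- The fundamental solution of the Lamé system in the whole space, with pole at the origin. -/
theorem exists_fundamental_solution {l m : ℝ} (hm : 0 < m) (hl : 0 < 3 * l + 2 * m) (k : Fin 3) :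
    ∃ (U : Fin 3 → E3 → ℝ) (G : E3 → Matrix (Fin 3) (Fin 3) ℝ) (C : ℝ),
      0 ≤ C ∧ (∀ i, Measurable (U i)) ∧ (∀ i j, Measurable fun x => G x i j) ∧
      (∀ i x, x ≠ 0 → |U i x| ≤ C * ‖x‖⁻¹) ∧
      (∀ i j x, x ≠ 0 → |G x i j| ≤ C * (‖x‖⁻¹) ^ 2) ∧
      (∀ i j φ, IsTestFunction φ → ∫ x, U i x * classicalPartial j φ x = - ∫ x, G x i j * φ x) ∧
      ∀ φ : Fin 3 → E3 → ℝ, (∀ i, IsTestFunction (φ i)) →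
        ∑ i, ∑ j, ∫ x, lameTensor l m (symPart (G x)) i j * classicalPartial j (φ i) x = - φ k 0 := by
  -- The value for which the gradient-type terms of the stress divergence cancel.
  set κ := (l + m) / (l + 2 * m) with hκdef
  have hlm : 0 < l + 2 * m := by linarith
  have hκ : (l + 2 * m) * κ = l + m := by
    rw [hκdef]
    field_simp
  -- The limit source is `15 m · sourceMass` times the Dirac measure, and the normalization asks for
  -- `-φₖ(0)`.
  set c : ℝ := -(15 * m * sourceMass)⁻¹ with hc
  set D : ℝ := 5 + 6 * |κ| with hD
  have hD0 : 0 ≤ D := by positivity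
  have hI := sourceMass_pos
  have hmeas : ∀ e i j, Measurable fun x => singGrad κ e k i j x := fun e i j =>
    measurable_singGrad κ e k i j
  have hUb : ∀ e i x, x ≠ 0 → |singField κ e k i x| ≤ D * ‖x‖⁻¹ := fun e i x hx => by
    refine (abs_singField_le hx κ e k i).trans ?_
    gcongr
    linarith [abs_nonneg κ]
  have hpos : ∀ n : ℕ, (0 : ℝ) < 1 / ((n : ℝ) + 1) := fun n => by positivity
  refine ⟨fun i x => c * singField κ 0 k i x,
    fun x => Matrix.of fun i j => c * singGrad κ 0 k i j x, |c| * D, by positivity,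
    fun i => (measurable_singField κ 0 k i).const_mul c,
    fun i j => (measurable_singGrad κ 0 k i j).const_mul c, fun i x hx => ?_, fun i j x hx => ?_,
    fun i j φ hφ => ?_, fun φ hφ => ?_⟩
  · rw [abs_mul, mul_assoc]
    gcongr
    exact hUb 0 i x hx
  · change |c * singGrad κ 0 k i j x| ≤ _
    rw [abs_mul, mul_assoc]
    gcongr
    exact abs_singGrad_le hx κ 0 k i j
  · have t1 := tendsto_integral_singular (F := fun n => singField κ (1 / ((n : ℝ) + 1)) k i)
      (f := singField κ 0 k i) (C := D) (hφ.classicalPartial j)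
      (fun n => measurable_singField κ _ k i)
      (fun n x hx => (hUb _ i x hx).trans (by gcongr; exact inv_norm_le x))
      fun x hx => tendsto_singField hx κ k i tendsto_one_div
    have t2 := tendsto_integral_singular (F := fun n => singGrad κ (1 / ((n : ℝ) + 1)) k i j)
      (f := singGrad κ 0 k i j) (C := D) hφ (fun n => measurable_singGrad κ _ k i j)
      (fun n x hx => (abs_singGrad_le hx κ _ k i j).trans (by gcongr; linarith))
      fun x hx => tendsto_singGrad hx κ k i j tendsto_one_div
    have heq : ∀ n : ℕ, ∫ x, singField κ (1 / ((n : ℝ) + 1)) k i x * classicalPartial j φ x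
        = - ∫ x, singGrad κ (1 / ((n : ℝ) + 1)) k i j x * φ x := fun n => by
      rw [integral_mul_classicalPartial (contDiff_singField (hpos n) κ k i) hφ,
        classicalPartial_singField (hpos n)]
    have := tendsto_nhds_unique t1 (t2.neg.congr fun n => (heq n).symm)
    simp only [Matrix.of_apply, mul_assoc, integral_const_mul, this]
    ring
  · have t1 : ∀ i j, Tendsto (fun n : ℕ => ∫ x, lameTensor l m
        (symPart (Matrix.of fun i j => singGrad κ (1 / ((n : ℝ) + 1)) k i j x)) i j
          * classicalPartial j (φ i) x) atTop (𝓝 (∫ x, lameTensor l m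
        (symPart (Matrix.of fun i j => singGrad κ 0 k i j x)) i j * classicalPartial j (φ i) x)) := by
      intro i j
      refine tendsto_integral_singular (C := (3 * |l| + 2 * |m|) * D) ((hφ i).classicalPartial j)
        (fun n => ?_) (fun n x hx => ?_) fun x hx => ?_
      · simp only [lameTensor_symPart_apply, Matrix.of_apply]
        have := hmeas (1 / ((n : ℝ) + 1))
        fun_prop
      · have := abs_lameTensor_symPart_le (l := l) (m := m)
          (A := Matrix.of fun i j => singGrad κ (1 / ((n : ℝ) + 1)) k i j x)
          (fun i j => abs_singGrad_le hx κ (1 / ((n : ℝ) + 1)) k i j) i j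
        refine this.trans ?_
        rw [← mul_assoc, ← hD]
        gcongr
        linarith
      · simp only [lameTensor_symPart_apply, Matrix.of_apply]
        have h := fun i j => tendsto_singGrad hx κ k i j tendsto_one_div
        exact (tendsto_const_nhds.mul (((h 0 0).add (h 1 1)).add (h 2 2))).add
          (tendsto_const_nhds.mul ((h i j).add (h j i)))
    have t2 := (tendsto_integral_source (hφ k)).const_mul (15 * m)
    have t3 := tendsto_finsetSum Finset.univ fun i _ => tendsto_finsetSum Finset.univ fun j _ => t1 i j
    have := tendsto_nhds_unique t3 (t2.congr fun n =>
      (weak_eq_singField (hpos n) hκ k hφ).symm)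
    have hlin : ∀ x i j, lameTensor l m (symPart (Matrix.of fun i j => c * singGrad κ 0 k i j x)) i j
        = c * lameTensor l m (symPart (Matrix.of fun i j => singGrad κ 0 k i j x)) i j := by
      intro x i j
      simp only [lameTensor_symPart_apply, Matrix.of_apply]
      ring
    simp only [hlin, mul_assoc, integral_const_mul, ← Finset.mul_sum]
    simp only [mul_assoc] at this
    rw [this, hc]
    field_simp


/-! ### Existence of a Neumann function for constant coefficients -/

lemma integrableOn_inv_dist_sq (y : E3) (R : ℝ) :
    IntegrableOn (fun x : E3 => (‖x - y‖⁻¹) ^ 2) (Metric.ball y R) := by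
  have h := integrableOn_inv_norm_sq R
  rw [← integrable_indicator_iff Metric.isOpen_ball.measurableSet] at h ⊢
  refine (h.comp_sub_right y).congr (.of_forall fun x => ?_)
  simp [indicator, dist_eq_norm]

lemma locallyIntegrable_inv_dist_sq (y : E3) : LocallyIntegrable fun x : E3 => (‖x - y‖⁻¹) ^ 2 := by
  intro x
  exact ⟨Metric.ball y (dist x y + 1), Metric.isOpen_ball.mem_nhds (by simp),
    integrableOn_inv_dist_sq y _⟩

lemma ae_ne (y : E3) : ∀ᵐ x : E3, x ≠ y := by
  simp [ae_iff]

lemma locallyIntegrable_of_singular_bound {f : E3 → ℝ} {y : E3} {C : ℝ} (hf : Measurable f)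
    (hb : ∀ x, x ≠ y → |f x| ≤ C * (1 + (‖x - y‖⁻¹) ^ 2)) : LocallyIntegrable f := by
  have h1 : LocallyIntegrable (fun x : E3 => C * (1 + (‖x - y‖⁻¹) ^ 2)) volume :=
    ((locallyIntegrable_const (1 : ℝ)).add (locallyIntegrable_inv_dist_sq y)).smul C
  refine h1.mono hf.aestronglyMeasurable ?_
  filter_upwards [ae_ne y] with x hx
  exact (hb x hx).trans (le_abs_self _)

lemma IsTestFunction.comp_add {φ : E3 → ℝ} (h : IsTestFunction φ) (y : E3) :
    IsTestFunction fun x => φ (x + y) :=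
  ⟨h.1.comp (contDiff_id.add contDiff_const), h.2.comp_homeomorph (Homeomorph.addRight y)⟩

lemma classicalPartial_comp_add (φ : E3 → ℝ) (y x : E3) (j : Fin 3) :
    classicalPartial j (fun x => φ (x + y)) x = classicalPartial j φ (x + y) := by
  rw [classicalPartial, classicalPartial, fderiv_comp_add_right]

/-- The fundamental solution of the Lamé system with pole at `y`, together with its gradient. -/
structure IsFundamental (l m : ℝ) (y : E3) (k : Fin 3) (C : ℝ) (U : Fin 3 → E3 → ℝ)
    (G : E3 → Matrix (Fin 3) (Fin 3) ℝ) : Prop where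
  nonneg : 0 ≤ C
  measurable : ∀ i, Measurable (U i)
  measurable_grad : ∀ i j, Measurable fun x => G x i j
  bound : ∀ i x, x ≠ y → |U i x| ≤ C * ‖x - y‖⁻¹
  bound_grad : ∀ i j x, x ≠ y → |G x i j| ≤ C * (‖x - y‖⁻¹) ^ 2
  weak_grad : ∀ i j φ, IsTestFunction φ →
    ∫ x, U i x * classicalPartial j φ x = - ∫ x, G x i j * φ x
  weak_eq : ∀ φ : Fin 3 → E3 → ℝ, (∀ i, IsTestFunction (φ i)) →
    ∑ i, ∑ j, ∫ x, lameTensor l m (symPart (G x)) i j * classicalPartial j (φ i) x = - φ k y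

theorem exists_isFundamental {l m : ℝ} (hm : 0 < m) (hl : 0 < 3 * l + 2 * m) (k : Fin 3) (y : E3) :
    ∃ C U G, IsFundamental l m y k C U G := by
  obtain ⟨U, G, C, hC, hU, hG, bU, bG, w1, w2⟩ := exists_fundamental_solution hm hl k
  refine ⟨C, fun i x => U i (x - y), fun x => G (x - y), hC, fun i => (hU i).comp (by fun_prop),
    fun i j => (hG i j).comp (measurable_id.sub_const y), fun i x hx => bU i _ (sub_ne_zero.2 hx),
    fun i j x hx => bG i j _ (sub_ne_zero.2 hx), fun i j φ hφ => ?_, fun φ hφ => ?_⟩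
  · have h := w1 i j _ (hφ.comp_add y)
    rw [← integral_sub_right_eq_self _ y, ← integral_sub_right_eq_self (fun x => G x i j * _) y] at h
    simpa only [classicalPartial_comp_add, sub_add_cancel] using h
  · have h := w2 (fun i x => φ i (x + y)) fun i => (hφ i).comp_add y
    rw [zero_add] at h
    rw [← h]
    refine Finset.sum_congr rfl fun i _ => Finset.sum_congr rfl fun j _ => ?_
    rw [← integral_sub_right_eq_self (fun x => lameTensor l m (symPart (G x)) i j * _) y]
    simp only [classicalPartial_comp_add, sub_add_cancel]

lemma inv_norm_sub_le (x y : E3) : ‖x - y‖⁻¹ ≤ 1 + (‖x - y‖⁻¹) ^ 2 := inv_norm_le _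

namespace IsFundamental

variable {l m C : ℝ} {y : E3} {k : Fin 3} {U : Fin 3 → E3 → ℝ} {G : E3 → Matrix (Fin 3) (Fin 3) ℝ}

lemma locallyIntegrable (h : IsFundamental l m y k C U G) (i : Fin 3) : LocallyIntegrable (U i) :=
  locallyIntegrable_of_singular_bound (h.measurable i) fun x hx =>
    (h.bound i x hx).trans (mul_le_mul_of_nonneg_left (inv_norm_sub_le x y) h.nonneg)

lemma locallyIntegrable_grad (h : IsFundamental l m y k C U G) (i j : Fin 3) :
    LocallyIntegrable fun x => G x i j :=
  locallyIntegrable_of_singular_bound (h.measurable_grad i j) fun x hx =>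
    (h.bound_grad i j x hx).trans (mul_le_mul_of_nonneg_left (by linarith) h.nonneg)

end IsFundamental

/-! ### Cutting off the fundamental solution inside the half-space. -/

lemma LocallyIntegrable.integrable_mul_test {f φ : E3 → ℝ} (hf : LocallyIntegrable f)
    (hφ : Continuous φ) (hc : HasCompactSupport φ) : Integrable fun x => f x * φ x :=
  integrable_mul_of_support (hf.integrableOn_isCompact hc) hc hφ
    fun _ hx => image_eq_zero_of_notMem_tsupport hx

lemma LocallyIntegrable.test_mul {f φ : E3 → ℝ} (hf : LocallyIntegrable f)
    (hφ : IsTestFunction φ) : LocallyIntegrable fun x => φ x * f x := by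
  simpa only [mul_comm] using
    (LocallyIntegrable.integrable_mul_test hf hφ.continuous hφ.2).locallyIntegrable

lemma memLp_mul_of_bounded {μ : Measure E3} [IsFiniteMeasureOnCompacts μ] {f ψ : E3 → ℝ} {B : ℝ}
    (hf : Measurable f) (hψ : Continuous ψ) (hc : HasCompactSupport ψ)
    (hb : ∀ᵐ x ∂μ, |f x * ψ x| ≤ B * |ψ x|) : MemLp (fun x => f x * ψ x) 2 μ := by
  refine ((hψ.memLp_of_hasCompactSupport (μ := μ) (p := 2) hc).norm.const_mul B).mono
    (hf.mul hψ.measurable).aestronglyMeasurable (hb.mono fun x hx => ?_)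
  exact hx.trans (le_abs_self _)

/-- The stress is symmetric, so the symmetrization of the second factor can be dropped and energies
can be integrated by parts entry by entry. -/
lemma frobInner_lameTensor_eq_sum (l m : ℝ) (A B : Matrix (Fin 3) (Fin 3) ℝ) :
    frobInner (lameTensor l m (symPart A)) (symPart B)
      = ∑ i, ∑ j, lameTensor l m (symPart A) i j * B i j := by
  simp [frobInner, lameTensor, symPart, Matrix.trace, Fin.sum_univ_three, Matrix.one_apply]
  ring

lemma lameTensor_symPart_add (l m c : ℝ) (A B : Matrix (Fin 3) (Fin 3) ℝ) (i j : Fin 3) :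
    lameTensor l m (symPart (c • A + B)) i j
      = c * lameTensor l m (symPart A) i j + lameTensor l m (symPart B) i j := by
  simp only [lameTensor_symPart_apply, Matrix.add_apply, Matrix.smul_apply, smul_eq_mul]
  ring

/-- The tensor product of a field with a gradient. -/
noncomputable def outerGrad (U : Fin 3 → E3 → ℝ) (η : E3 → ℝ) (x : E3) : Matrix (Fin 3) (Fin 3) ℝ :=
  Matrix.of fun i j => classicalPartial j η x * U i x

/-- The gradient of a field multiplied by a cutoff function. -/
noncomputable def cutGrad (U : Fin 3 → E3 → ℝ) (G : E3 → Matrix (Fin 3) (Fin 3) ℝ) (η : E3 → ℝ) (x : E3) :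
    Matrix (Fin 3) (Fin 3) ℝ := η x • G x + outerGrad U η x

namespace IsFundamental

variable {l m C : ℝ} {y : E3} {k : Fin 3} {U : Fin 3 → E3 → ℝ} {G : E3 → Matrix (Fin 3) (Fin 3) ℝ}
  {η : E3 → ℝ}

lemma hasWeakPartial (h : IsFundamental l m y k C U G) (hη : IsTestFunction η) (i j : Fin 3) :
    HasWeakPartial j (fun x => η x * U i x) fun x => cutGrad U G η x i j := by
  have hd := hη.classicalPartial j
  have iU := h.locallyIntegrable i
  have iG := h.locallyIntegrable_grad i j
  have e : (fun x => cutGrad U G η x i j) = fun x => η x * G x i j + classicalPartial j η x * U i x := by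
    ext x
    simp [cutGrad, outerGrad]
  rw [e]
  refine ⟨(LocallyIntegrable.test_mul iU hη).locallyIntegrableOn _,
    ((LocallyIntegrable.test_mul iG hη).add
      (LocallyIntegrable.test_mul iU hd)).locallyIntegrableOn _, fun φ hφ hs => ?_⟩
  rw [integral_half_eq, integral_half_eq]
  · have w := h.weak_grad i j _ (hη.mul_right hφ.1)
    have e1 : ∀ x, U i x * classicalPartial j (fun x => η x * φ x) x
        = η x * U i x * classicalPartial j φ x + U i x * (classicalPartial j η x * φ x) := fun x => by
      rw [classicalPartial_mul j (hη.differentiable x) (hφ.differentiable x)]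
      ring
    have e2 : ∀ x, (η x * G x i j + classicalPartial j η x * U i x) * φ x
        = G x i j * (η x * φ x) + U i x * (classicalPartial j η x * φ x) := fun x => by ring
    have t1 := hη.mul_right hφ.1
    have t2 := hd.mul_right hφ.1
    have i0 := LocallyIntegrable.integrable_mul_test (LocallyIntegrable.test_mul iU hη)
      (hφ.classicalPartial j).continuous (hφ.classicalPartial j).2
    have i1 := LocallyIntegrable.integrable_mul_test iU t2.continuous t2.2
    have i2 := LocallyIntegrable.integrable_mul_test iG t1.continuous t1.2
    simp only [e1] at w
    simp only [e2]
    rw [integral_add i0 i1] at w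
    rw [integral_add i2 i1]
    linarith
  · intro x hx
    simp [eq_zero_of_tsupport_subset hs hx]
  · intro x hx
    simp [eq_zero_of_tsupport_subset ((tsupport_classicalPartial_subset φ j).trans hs) hx]

lemma measurable_stress (h : IsFundamental l m y k C U G) (i j : Fin 3) :
    Measurable fun x => lameTensor l m (symPart (G x)) i j := by
  simp only [lameTensor_symPart_apply]
  have := h.measurable_grad
  fun_prop

lemma stress_bound (h : IsFundamental l m y k C U G) (i j : Fin 3) {x : E3} (hx : x ≠ y) :
    |lameTensor l m (symPart (G x)) i j| ≤ (3 * |l| + 2 * |m|) * C * (1 + (‖x - y‖⁻¹) ^ 2) := by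
  refine (abs_lameTensor_symPart_le (fun i j => h.bound_grad i j x hx) i j).trans ?_
  rw [← mul_assoc]
  have := h.nonneg
  gcongr
  linarith

lemma locallyIntegrable_stress (h : IsFundamental l m y k C U G) (i j : Fin 3) :
    LocallyIntegrable fun x => lameTensor l m (symPart (G x)) i j :=
  locallyIntegrable_of_singular_bound (h.measurable_stress i j) fun _ hx => h.stress_bound i j hx

/-- A function that is bounded away from the pole, times a function vanishing near the pole. -/
lemma _root_.HalfSpaceLame.abs_mul_le_of_vanish {f ψ : E3 → ℝ} {y : E3} {r B : ℝ} {n : ℕ} (hr : 0 < r)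
    (hB : 0 ≤ B) (hf : ∀ x, x ≠ y → |f x| ≤ B * (‖x - y‖⁻¹) ^ n)
    (hψ : ∀ x ∈ Metric.ball y r, ψ x = 0) (x : E3) : |f x * ψ x| ≤ B * (r⁻¹) ^ n * |ψ x| := by
  by_cases hx : x ∈ Metric.ball y r
  · simp [hψ x hx]
  · rw [Metric.mem_ball, dist_eq_norm, not_lt] at hx
    have hne : x ≠ y := by
      rintro rfl
      simp at hx
      linarith
    rw [abs_mul]
    refine mul_le_mul_of_nonneg_right ((hf x hne).trans ?_) (abs_nonneg _)
    gcongr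

/-- Where `∇η` does not vanish, the distance to the pole is at least `r`, so `U` is bounded there.
-/
lemma memLp_outerGrad (h : IsFundamental l m y k C U G) (hη : IsTestFunction η) {r : ℝ} (hr : 0 < r)
    (h1 : ∀ x ∈ Metric.ball y r, ∀ j, classicalPartial j η x = 0) : TensorMemL2 (outerGrad U η) := by
  intro i j
  have hd := hη.classicalPartial j
  have := memLp_mul_of_bounded (μ := volume) (h.measurable i) hd.continuous hd.2
    (.of_forall (abs_mul_le_of_vanish (n := 1) hr h.nonneg (fun x hx => by
      rw [pow_one]
      exact h.bound i x hx) fun x hx => h1 x hx j))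
  refine (this.restrict lowerHalfSpace).ae_eq (.of_forall fun x => ?_)
  simp [outerGrad, mul_comm]

/-- The whole-space equation is tested with `ηφ`, which is supported in the open half-space and
equals `φ` at the pole. The product rule leaves two commutator terms with `∇η`, both away from the
pole. -/
lemma energy_cutGrad (h : IsFundamental l m y k C U G) (hη : IsTestFunction η)
    (hs : tsupport η ⊆ lowerHalfSpace) (hy : η y = 1) {φ : Fin 3 → E3 → ℝ}
    (hφ : ∀ i, IsTestFunction (φ i)) {r : ℝ} (hr : 0 < r)
    (h1 : ∀ x ∈ Metric.ball y r, ∀ j, classicalPartial j η x = 0) :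
    Integrable (fun x => frobInner (lameTensor l m (symPart (cutGrad U G η x)))
        (symPart (classicalGrad φ x))) halfVol ∧
    ∫ x, frobInner (lameTensor l m (symPart (cutGrad U G η x))) (symPart (classicalGrad φ x)) ∂halfVol
      = - φ k y + ∑ i, ∑ j,
        (∫ x, lameTensor l m (symPart (outerGrad U η x)) i j * classicalPartial j (φ i) x ∂halfVol
        - ∫ x, lameTensor l m (symPart (G x)) i j * (classicalPartial j η x * φ i x) ∂halfVol) := by
  have hO := (h.memLp_outerGrad hη hr h1).symPart
  have hsup : ∀ x ∉ lowerHalfSpace, η x = 0 := fun x hx => eq_zero_of_tsupport_subset hs hx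
  have hsup' : ∀ j, ∀ x ∉ lowerHalfSpace, classicalPartial j η x = 0 := fun j x hx =>
    eq_zero_of_tsupport_subset ((tsupport_classicalPartial_subset η j).trans hs) hx
  have t1 : ∀ i, IsTestFunction fun x => η x * φ i x := fun i => hη.mul_right (hφ i).1
  have t2 : ∀ i j, IsTestFunction fun x => classicalPartial j η x * φ i x := fun i j =>
    (hη.classicalPartial j).mul_right (hφ i).1
  have I1 : ∀ i j, Integrable fun x => lameTensor l m (symPart (G x)) i j
      * classicalPartial j (fun x => η x * φ i x) x := fun i j =>
    LocallyIntegrable.integrable_mul_test (h.locallyIntegrable_stress i j)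
      ((t1 i).classicalPartial j).continuous ((t1 i).classicalPartial j).2
  have I2 : ∀ i j, Integrable fun x => lameTensor l m (symPart (G x)) i j
      * (classicalPartial j η x * φ i x) := fun i j =>
    LocallyIntegrable.integrable_mul_test (h.locallyIntegrable_stress i j) (t2 i j).continuous
      (t2 i j).2
  have I3 : ∀ i j, Integrable (fun x => lameTensor l m (symPart (outerGrad U η x)) i j
      * classicalPartial j (φ i) x) halfVol := fun i j =>
    integrable_mul_of_memLp_two (hO.lameTensor (lam := fun _ => l) (mu := fun _ => m)
      (memLp_top_const l) (memLp_top_const m) i j) (((hφ i).classicalPartial j).memLp_half 2)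
  have J1 : ∀ i j, Integrable (fun x => lameTensor l m (symPart (G x)) i j
      * classicalPartial j (fun x => η x * φ i x) x) halfVol := fun i j =>
    (I1 i j).mono_measure Measure.restrict_le_self
  have J2 : ∀ i j, Integrable (fun x => lameTensor l m (symPart (G x)) i j
      * (classicalPartial j η x * φ i x)) halfVol := fun i j =>
    (I2 i j).mono_measure Measure.restrict_le_self
  have J3 : ∀ i j, Integrable (fun x => lameTensor l m (symPart (G x)) i j
      * classicalPartial j (fun x => η x * φ i x) x - lameTensor l m (symPart (G x)) i j
      * (classicalPartial j η x * φ i x)) halfVol := fun i j => (J1 i j).sub (J2 i j)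
  have e : ∀ x, frobInner (lameTensor l m (symPart (cutGrad U G η x))) (symPart (classicalGrad φ x))
      = ∑ i, ∑ j, ((lameTensor l m (symPart (G x)) i j * classicalPartial j (fun x => η x * φ i x) x
        - lameTensor l m (symPart (G x)) i j * (classicalPartial j η x * φ i x))
        + lameTensor l m (symPart (outerGrad U η x)) i j * classicalPartial j (φ i) x) := fun x => by
    rw [frobInner_lameTensor_eq_sum]
    refine Finset.sum_congr rfl fun i _ => Finset.sum_congr rfl fun j _ => ?_
    rw [cutGrad, lameTensor_symPart_add,
      classicalPartial_mul j (hη.differentiable x) ((hφ i).differentiable x), classicalGrad,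
      Matrix.of_apply]
    ring
  simp only [e]
  have I : ∀ i j, Integrable (fun x => (lameTensor l m (symPart (G x)) i j
      * classicalPartial j (fun x => η x * φ i x) x
        - lameTensor l m (symPart (G x)) i j * (classicalPartial j η x * φ i x))
        + lameTensor l m (symPart (outerGrad U η x)) i j * classicalPartial j (φ i) x) halfVol :=
    fun i j => (J3 i j).add (I3 i j)
  refine ⟨integrable_finsetSum _ fun i _ => integrable_finsetSum _ fun j _ => I i j, ?_⟩
  have w := h.weak_eq _ t1
  rw [hy, one_mul] at w
  rw [integral_mul_finset_sum_sum I, ← w, ← Finset.sum_add_distrib]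
  refine Finset.sum_congr rfl fun i _ => ?_
  rw [← Finset.sum_add_distrib]
  refine Finset.sum_congr rfl fun j _ => ?_
  have e4 : ∫ x, lameTensor l m (symPart (G x)) i j
      * classicalPartial j (fun x => η x * φ i x) x ∂halfVol = ∫ x, lameTensor l m (symPart (G x)) i j
      * classicalPartial j (fun x => η x * φ i x) x := integral_half_eq fun x hx => by
    rw [classicalPartial_mul j (hη.differentiable x) ((hφ i).differentiable x), hsup x hx,
      hsup' j x hx]
    ring
  rw [integral_add (J3 i j) (I3 i j), integral_sub (J1 i j) (J2 i j), e4]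
  ring

end IsFundamental

/-! ### The Neumann column for constant coefficients. -/

instance : IsFiniteMeasureOnCompacts halfVol := by
  unfold halfVol
  infer_instance

/-- A cutoff function that is equal to one near a given point of the half-space. -/
lemma exists_cutoff_near {y : E3} (hy : y ∈ lowerHalfSpace) : ∃ (η : E3 → ℝ) (r : ℝ), 0 < r ∧
    IsTestFunction η ∧ tsupport η ⊆ lowerHalfSpace ∧ ∀ x ∈ Metric.ball y r, η x = 1 := by
  obtain ⟨d, hd, hsub⟩ := Metric.isOpen_iff.1 isOpen_lowerHalfSpace y hy
  let b : ContDiffBump y := ⟨d / 4, d / 2, by positivity, by linarith⟩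
  refine ⟨b, d / 4, by positivity, ⟨b.contDiff, b.hasCompactSupport⟩, ?_, fun x hx =>
    b.one_of_mem_closedBall (Metric.ball_subset_closedBall hx)⟩
  rw [b.tsupport_eq]
  exact (Metric.closedBall_subset_ball (by change d / 2 < d; linarith)).trans hsub

lemma classicalPartial_eq_zero_of_const {η : E3 → ℝ} {s : Set E3} {c : ℝ} (hs : IsOpen s)
    (h : ∀ x ∈ s, η x = c) {x : E3} (hx : x ∈ s) (j : Fin 3) : classicalPartial j η x = 0 := by
  have : η =ᶠ[𝓝 x] fun _ => c := by
    filter_upwards [hs.mem_nhds hx] with z hz using h z hz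
  rw [classicalPartial, this.fderiv_eq]
  simp

lemma memLp_mul_off_ball {s : Set E3} (hs : MeasurableSet s) {f ψ : E3 → ℝ} {y : E3} {ρ B : ℝ} {n : ℕ}
    (hρ : 0 < ρ) (hB : 0 ≤ B) (hm : Measurable f) (hf : ∀ x, x ≠ y → |f x| ≤ B * (‖x - y‖⁻¹) ^ n)
    (hψ : Continuous ψ) (hc : HasCompactSupport ψ) :
    MemLp (fun x => f x * ψ x) 2 (volume.restrict (s \ Metric.ball y ρ)) := by
  refine memLp_mul_of_bounded (B := B * (ρ⁻¹) ^ n) hm hψ hc ?_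
  filter_upwards [ae_restrict_mem (hs.diff Metric.isOpen_ball.measurableSet)] with x hx
  have hx2 := hx.2
  rw [Metric.mem_ball, dist_eq_norm, not_lt] at hx2
  have hne : x ≠ y := by
    rintro rfl
    simp at hx2
    linarith
  rw [abs_mul]
  refine mul_le_mul_of_nonneg_right ((hf x hne).trans ?_) (abs_nonneg _)
  gcongr

lemma restrict_diff_le_halfVol (s : Set E3) : volume.restrict (lowerHalfSpace \ s) ≤ halfVol :=
  Measure.restrict_mono sdiff_subset le_rfl

/-- This is where dimension three enters the bound for the defect: `|x - y|⁻²` is locally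
integrable. -/
lemma memLp_inv_dist_mul {η : E3 → ℝ} (hη : IsTestFunction η) (y : E3) :
    MemLp (fun x => ‖x - y‖⁻¹ * η x) 2 volume := by
  have hm : Measurable fun x : E3 => ‖x - y‖⁻¹ := by fun_prop
  have hm2 : AEStronglyMeasurable (fun x : E3 => ‖x - y‖⁻¹ * η x) volume :=
    (hm.mul hη.continuous.measurable).aestronglyMeasurable
  rw [memLp_two_iff_integrable_sq hm2]
  have hc := hη.mul_right hη.1
  refine (LocallyIntegrable.integrable_mul_test (locallyIntegrable_inv_dist_sq y) hc.continuous
    hc.2).congr (.of_forall fun x => ?_)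
  ring

/-- For constant coefficients there is a column of a Neumann function whose gradient becomes square
integrable after multiplication by a bounded Lipschitz function that vanishes at the pole. -/
theorem exists_neumannColumn_const {α β K l m : ℝ} (hα : 0 < α) (hβ : 0 < β)
    (ha : AdmissibleLame α β K (fun _ => l) (fun _ => m)) {y : E3} (hy : y ∈ lowerHalfSpace)
    (k : Fin 3) : ∃ N : Fin 3 → E3 → ℝ, IsNeumannColumn (fun _ => l) (fun _ => m) y k N ∧
      ∀ (a : E3 → ℝ) (L : ℝ), AEStronglyMeasurable a halfVol →
        (∀ x ∈ lowerHalfSpace, |a x| ≤ L ∧ |a x| ≤ L * ‖x - y‖) →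
        ∀ i j, MemLp (fun x => a x * weakPartial j (N i) x) 2 halfVol := by
  have hm : 0 < m := hα.trans_le (ha.mu_ge y hy)
  have hl : 0 < 3 * l + 2 * m := hβ.trans_le (ha.bulk_ge y hy)
  obtain ⟨C, U, G, h⟩ := exists_isFundamental hm hl k y
  obtain ⟨η, r, hr, hη, hs, h1⟩ := exists_cutoff_near hy
  have hd : ∀ x ∈ Metric.ball y r, ∀ j, classicalPartial j η x = 0 := fun x hx j =>
    classicalPartial_eq_zero_of_const Metric.isOpen_ball h1 hx j
  have hO := h.memLp_outerGrad hη hr hd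
  have hB : ∀ i j, MemLp (fun x => lameTensor l m (symPart (G x)) i j
      * (weight x * classicalPartial j η x)) 2 halfVol := fun i j => by
    have hc := hη.classicalPartial j
    refine memLp_mul_of_bounded (h.measurable_stress i j) (continuous_weight.mul hc.continuous)
      hc.2.mul_left (.of_forall (abs_mul_le_of_vanish (y := y) (n := 2) hr
        (B := (3 * |l| + 2 * |m|) * C) ?_ (fun x hx => ?_) fun x hx => ?_))
    · have := h.nonneg
      positivity
    · refine (abs_lameTensor_symPart_le (fun i j => h.bound_grad i j x hx) i j).trans ?_
      rw [← mul_assoc]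
    · simp [hd x hx j]
  -- The data are the negatives of the commutator terms of `ηU`. The zeroth-order one is multiplied
  -- by `ϱ`, because the right-hand side is paired with `ϱ⁻¹v`.
  obtain ⟨w, hw, hweq⟩ := ha.exists_solution hα hβ
    (b := fun i x => ∑ j, lameTensor l m (symPart (G x)) i j * (weight x * classicalPartial j η x))
    (A := fun x => - lameTensor l m (symPart (outerGrad U η x)))
    (fun i => memLp_finsetSum _ fun j _ => hB i j)
    (fun i j => (hO.symPart.lameTensor (lam := fun _ => l) (mu := fun _ => m)
      (memLp_top_const l) (memLp_top_const m) i j).neg)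
  have hV : ∀ i, WeaklyDifferentiable fun x => η x * U i x := fun i j => ⟨_, h.hasWeakPartial hη i j⟩
  have hgrad : ∀ i j, weakPartial j (fun x => η x * U i x + w i x)
      =ᵐ[halfVol] fun x => cutGrad U G η x i j + weakPartial j (w i) x := fun i j => by
    filter_upwards [weakPartial_add (hV i) (hw i).1 j, (h.hasWeakPartial hη i j).weakPartial_ae_eq]
      with x e1 e2
    rw [e1, e2]
  have hae : ∀ᵐ x ∂halfVol, x ≠ y := ae_restrict_of_ae (ae_ne y)
  refine ⟨fun i x => η x * U i x + w i x, ⟨fun i => (hV i).add (hw i).1, fun ρ hρ i => ?_,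
    fun ρ hρ i j => ?_, fun φ hφ => ?_⟩, fun a L hma hL i j => ?_⟩
  · simp only [mul_add]
    refine (memLp_inv_weight_mul ?_).add ((hw i).2.mono_measure (restrict_diff_le_halfVol _))
    simpa only [mul_comm] using memLp_mul_off_ball measurableSet_lowerHalfSpace (n := 1) hρ h.nonneg
      (h.measurable i) (fun x hx => by
        rw [pow_one]
        exact h.bound i x hx) hη.continuous hη.2
  · have e : weakPartial j (fun x => η x * U i x + w i x)
        =ᵐ[volume.restrict (lowerHalfSpace \ Metric.ball y ρ)]
        fun x => cutGrad U G η x i j + weakPartial j (w i) x :=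
      ae_mono (restrict_diff_le_halfVol (Metric.ball y ρ)) (hgrad i j)
    refine MemLp.ae_eq e.symm (MemLp.add ?_
      (((hw i).3 j).mono_measure (restrict_diff_le_halfVol _)))
    refine MemLp.add ?_ ((hO i j).mono_measure (restrict_diff_le_halfVol _))
    simpa only [Matrix.smul_apply, smul_eq_mul, mul_comm] using
      memLp_mul_off_ball measurableSet_lowerHalfSpace (n := 2) hρ h.nonneg
      (h.measurable_grad i j) (fun x hx => h.bound_grad i j x hx) hη.continuous hη.2
  · obtain ⟨J, e⟩ := h.energy_cutGrad hη hs (h1 y (Metric.mem_ball_self hr)) hφ hr hd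
    have hφH : VecMemH10 φ := fun i => (hφ i).memH10
    have hφg : ∀ᵐ x ∂halfVol, weakGrad φ x = classicalGrad φ x := by
      filter_upwards [ae_all_iff.2 fun i => ae_all_iff.2 fun j => (hφ i).weakPartial_ae_eq j] with x hx
      ext i j
      exact hx i j
    have hN : ∀ᵐ x ∂halfVol, weakGrad (fun i x => η x * U i x + w i x) x
        = (1 : ℝ) • cutGrad U G η x + weakGrad w x := by
      filter_upwards [ae_all_iff.2 fun i => ae_all_iff.2 fun j => hgrad i j] with x hx
      ext i j
      rw [one_smul]
      exact hx i j
    have key := hweq φ hφH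
    have I2 : ∀ i j, Integrable (fun x => lameTensor l m (symPart (G x)) i j
        * (classicalPartial j η x * φ i x)) halfVol := fun i j =>
      have t := (hη.classicalPartial j).mul_right (hφ i).1
      (LocallyIntegrable.integrable_mul_test (h.locallyIntegrable_stress i j) t.continuous
        t.2).mono_measure Measure.restrict_le_self
    have e1 : ∀ i, ∫ x, (∑ j, lameTensor l m (symPart (G x)) i j * (weight x * classicalPartial j η x))
        * ((weight x)⁻¹ * φ i x) ∂halfVol
        = ∑ j, ∫ x, lameTensor l m (symPart (G x)) i j * (classicalPartial j η x * φ i x) ∂halfVol := by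
      intro i
      rw [← integral_finsetSum _ fun j _ => I2 i j]
      congr 1 with x
      rw [Finset.sum_mul]
      refine Finset.sum_congr rfl fun j _ => ?_
      have := (weight_pos x).ne'
      field_simp
    have e2 : ∀ i j, ∫ x, (- lameTensor l m (symPart (outerGrad U η x))) i j * weakGrad φ x i j ∂halfVol
        = - ∫ x, lameTensor l m (symPart (outerGrad U η x)) i j * classicalPartial j (φ i) x ∂halfVol := by
      intro i j
      rw [← integral_neg]
      refine integral_congr_ae (hφg.mono fun x hx => ?_)
      simp only [hx, classicalGrad, Matrix.of_apply, Matrix.neg_apply, neg_mul]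
    simp only [e1, e2] at key
    have e3 : ∫ x, frobInner (lameTensor l m (strain (fun i x => η x * U i x + w i x) x))
        (symPart (classicalGrad φ x)) ∂halfVol
        = ∫ x, (frobInner (lameTensor l m (symPart (cutGrad U G η x))) (symPart (classicalGrad φ x))
          + frobInner (lameTensor l m (strain w x)) (strain φ x)) ∂halfVol := by
      refine integral_congr_ae ?_
      filter_upwards [hφg, hN] with x e1 e2
      simp only [strain, e1, e2, frobInner_lameTensor_eq_sum, lameTensor_symPart_add, one_mul,
        add_mul, Finset.sum_add_distrib]
    have J' : Integrable (fun x => frobInner (lameTensor l m (strain w x)) (strain φ x)) halfVol :=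
      (hw.strain_memL2.lameTensor (lam := fun _ => l) (mu := fun _ => m)
        (memLp_top_const l) (memLp_top_const m)).integrable_frobInner hφH.strain_memL2
    rw [e3, integral_add J J', e, key, add_assoc, ← Finset.sum_add_distrib]
    -- The commutators of `ηU` and the energy of `w` cancel component by component, leaving
    -- `-φₖ(y)`.
    rw [Finset.sum_eq_zero, add_zero]
    intro i _
    rw [Finset.sum_neg_distrib, Finset.sum_sub_distrib]
    ring
  · have hL0 : 0 ≤ L := (abs_nonneg _).trans (hL y hy).1
    have hat : MemLp a ∞ halfVol := memLp_top_of_bound hma L <| by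
      filter_upwards [ae_restrict_mem measurableSet_lowerHalfSpace] with x hx using (hL x hx).1
    -- Only the singular part needs the factor that vanishes at the pole: `|x - y| · |x - y|⁻² = |x
    -- - y|⁻¹`. The two remaining parts of the gradient are square integrable, so boundedness of `a`
    -- suffices for them.
    have t1 : MemLp (fun x => a x * (η x * G x i j)) 2 halfVol := by
      refine (((memLp_inv_dist_mul hη y).restrict lowerHalfSpace).const_mul (L * C)).mono
        (hma.mul (hη.continuous.measurable.mul (h.measurable_grad i j)).aestronglyMeasurable) ?_
      filter_upwards [ae_restrict_mem measurableSet_lowerHalfSpace, hae] with x hx hne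
      have hp : 0 < ‖x - y‖ := norm_pos_iff.2 (sub_ne_zero.2 hne)
      have hC := h.nonneg
      simp only [norm_mul, Real.norm_eq_abs, abs_inv, abs_norm]
      rw [abs_of_nonneg hL0, abs_of_nonneg hC]
      calc |a x| * (|η x| * |G x i j|)
          ≤ (L * ‖x - y‖) * (|η x| * (C * (‖x - y‖⁻¹) ^ 2)) := by
            gcongr
            · exact (hL x hx).2
            · exact h.bound_grad i j x hne
        _ = _ := by field_simp
    refine MemLp.ae_eq ?_ ((t1.add (memLp_mul_of_top hat (hO i j))).add
      (memLp_mul_of_top hat ((hw i).3 j)))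
    filter_upwards [hgrad i j] with x hx
    simp only [Pi.add_apply]
    rw [hx, cutGrad, Matrix.add_apply, Matrix.smul_apply, smul_eq_mul]
    ring


/-! ### Interior regularity of weak solutions -/

lemma mollify_add (φ : ContDiffBump (0 : E3)) {f g : E3 → ℝ} (hf : LocallyIntegrable f)
    (hg : LocallyIntegrable g) (x : E3) :
    mollify φ (fun t => f t + g t) x = mollify φ f x + mollify φ g x := by
  simp only [mollify_apply, mul_add]
  exact integral_add (integrable_mollify_integrand φ hf x) (integrable_mollify_integrand φ hg x)

lemma mollify_const_mul (φ : ContDiffBump (0 : E3)) (c : ℝ) (f : E3 → ℝ) (x : E3) :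
    mollify φ (fun t => c * f t) x = c * mollify φ f x := by
  simp only [mollify_apply, ← integral_const_mul]
  congr 1 with t
  ring

/-! ### Caccioppoli's inequality for smooth solutions. -/

lemma IsTestFunction.lameTensor_entry {W : E3 → Matrix (Fin 3) (Fin 3) ℝ}
    (hW : ∀ i j, IsTestFunction fun x => W x i j) (l m : ℝ) (i j : Fin 3) :
    IsTestFunction fun x => lameTensor l m (symPart (W x)) i j := by
  simp only [lameTensor_symPart_apply]
  exact ((((hW 0 0).add (hW 1 1)).add (hW 2 2)).const_mul _).add
    (((hW i j).add (hW j i)).const_mul m)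

lemma IsTestFunction.integrable_energy {W : E3 → Matrix (Fin 3) (Fin 3) ℝ}
    (hW : ∀ i j, IsTestFunction fun x => W x i j) (l m : ℝ) :
    Integrable fun x => frobInner (lameTensor l m (symPart (W x))) (symPart (W x)) := by
  simp only [frobInner_lameTensor_eq_sum]
  exact integrable_finsetSum _ fun i _ => integrable_finsetSum _ fun j _ =>
    ((IsTestFunction.lameTensor_entry hW l m i j).mul_right (hW i j).1).integrable

lemma classicalPartial_sq_mul {ζ f : E3 → ℝ} (hζ : IsTestFunction ζ) (hf : ContDiff ℝ ∞ f) (j : Fin 3)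
    (x : E3) : classicalPartial j (fun x => ζ x * ζ x * f x) x
      = ζ x * ζ x * classicalPartial j f x + f x * (2 * ζ x * classicalPartial j ζ x) := by
  have hz := hζ.differentiable x
  rw [classicalPartial_mul (f := fun x => ζ x * ζ x) j (hz.mul hz) (hf.differentiable (by simp) x), classicalPartial_mul j hz hz]
  ring

/-- A completion of the square for the symmetric form `ℂ`: with `A = ∇u` and `B = u ⊗ ∇ζ`, the
right-hand side is the stress of `u` tested against `∇(ζ²u)`. -/
lemma energy_cutGrad_pointwise (l m z : ℝ) (A B : Matrix (Fin 3) (Fin 3) ℝ) :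
    frobInner (lameTensor l m (symPart (z • A + B))) (symPart (z • A + B))
      - frobInner (lameTensor l m (symPart B)) (symPart B)
      = ∑ i, ∑ j, lameTensor l m (symPart A) i j * (z * z * A i j + 2 * z * B i j) := by
  simp only [frobInner_lameTensor_eq_sum, lameTensor_symPart_apply, Fin.sum_univ_three,
    Matrix.add_apply, Matrix.smul_apply, smul_eq_mul, Matrix.one_apply_eq]
  simp
  ring

lemma sq_symPart_le (A : Matrix (Fin 3) (Fin 3) ℝ) (i j : Fin 3) :
    symPart A i j * symPart A i j ≤ frobInner (symPart A) (symPart A) := by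
  have h1 : ∀ i, 0 ≤ ∑ j, symPart A i j * symPart A i j := fun i =>
    Finset.sum_nonneg fun j _ => mul_self_nonneg _
  exact (Finset.single_le_sum (f := fun j => symPart A i j * symPart A i j)
    (fun j _ => mul_self_nonneg _) (Finset.mem_univ j)).trans
    (Finset.single_le_sum (f := fun i => ∑ j, symPart A i j * symPart A i j)
      (fun i _ => h1 i) (Finset.mem_univ i))

lemma energy_le (l m : ℝ) (A : Matrix (Fin 3) (Fin 3) ℝ) :
    frobInner (lameTensor l m (symPart A)) (symPart A)
      ≤ (3 * |l| + 2 * |m|) * ∑ i, ∑ j, A i j * A i j := by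
  have e : frobInner (lameTensor l m (symPart A)) (symPart A)
      = l * (A 0 0 + A 1 1 + A 2 2) ^ 2
        + m * ((∑ i, ∑ j, (A i j + A j i) ^ 2) / 2) := by
    simp [frobInner, lameTensor, symPart, Matrix.trace, Fin.sum_univ_three, Matrix.one_apply]
    ring
  have h1 : (A 0 0 + A 1 1 + A 2 2) ^ 2 ≤ 3 * ∑ i, ∑ j, A i j * A i j := by
    simp only [Fin.sum_univ_three]
    nlinarith [sq_nonneg (A 0 0 - A 1 1), sq_nonneg (A 0 0 - A 2 2), sq_nonneg (A 1 1 - A 2 2),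
      mul_self_nonneg (A 0 1), mul_self_nonneg (A 0 2), mul_self_nonneg (A 1 0),
      mul_self_nonneg (A 1 2), mul_self_nonneg (A 2 0), mul_self_nonneg (A 2 1)]
  have h2 : (∑ i, ∑ j, (A i j + A j i) ^ 2) / 2 ≤ 2 * ∑ i, ∑ j, A i j * A i j := by
    simp only [Fin.sum_univ_three]
    nlinarith [sq_nonneg (A 0 1 - A 1 0), sq_nonneg (A 0 2 - A 2 0), sq_nonneg (A 1 2 - A 2 1)]
  rw [e]
  have h3 : 0 ≤ (∑ i, ∑ j, (A i j + A j i) ^ 2) / 2 := by positivity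
  calc _ ≤ |l| * (A 0 0 + A 1 1 + A 2 2) ^ 2 + |m| * ((∑ i, ∑ j, (A i j + A j i) ^ 2) / 2) := by
        gcongr
        · exact le_abs_self l
        · exact le_abs_self m
    _ ≤ |l| * (3 * ∑ i, ∑ j, A i j * A i j) + |m| * (2 * ∑ i, ∑ j, A i j * A i j) := by
        gcongr
    _ = _ := by ring

lemma isTestFunction_outerGrad {u : Fin 3 → E3 → ℝ} (hu : ∀ i, ContDiff ℝ ∞ (u i)) {ζ : E3 → ℝ}
    (hζ : IsTestFunction ζ) (i j : Fin 3) : IsTestFunction fun x => outerGrad u ζ x i j :=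
  (hζ.classicalPartial j).mul_right (hu i)

lemma isTestFunction_cutGrad {u : Fin 3 → E3 → ℝ} (hu : ∀ i, ContDiff ℝ ∞ (u i)) {ζ : E3 → ℝ}
    (hζ : IsTestFunction ζ) (i j : Fin 3) :
    IsTestFunction fun x => cutGrad u (classicalGrad u) ζ x i j :=
  (hζ.mul_right (contDiff_classicalPartial (hu i) j)).add (isTestFunction_outerGrad hu hζ i j)

lemma contDiff_stress {u : Fin 3 → E3 → ℝ} (hu : ∀ i, ContDiff ℝ ∞ (u i)) (l m : ℝ) (i j : Fin 3) :
    ContDiff ℝ ∞ fun x => lameTensor l m (symPart (classicalGrad u x)) i j := by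
  simp only [lameTensor_symPart_apply, classicalGrad, Matrix.of_apply]
  have := fun i j => contDiff_classicalPartial (hu i) j
  fun_prop

/-- The inequality of Caccioppoli for smooth solutions. -/
lemma caccioppoli {α β l m : ℝ} (hm : α ≤ m) (hl : β ≤ 3 * l + 2 * m) (hα : 0 < α) (hβ : 0 < β)
    {u : Fin 3 → E3 → ℝ}
    (hu : ∀ i, ContDiff ℝ ∞ (u i)) {ζ : E3 → ℝ} (hζ : IsTestFunction ζ)
    (hdiv : ∀ x, ζ x ≠ 0 → ∀ i, ∑ j, classicalPartial j
      (fun x => lameTensor l m (symPart (classicalGrad u x)) i j) x = 0) (i j : Fin 3) :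
    min (2 * α) β * ∫ x, symPart (cutGrad u (classicalGrad u) ζ x) i j
        * symPart (cutGrad u (classicalGrad u) ζ x) i j
      ≤ (3 * |l| + 2 * |m|) * ∑ i, ∑ j, ∫ x, outerGrad u ζ x i j * outerGrad u ζ x i j := by
  have hW := isTestFunction_cutGrad hu hζ
  have hO := isTestFunction_outerGrad hu hζ
  have hc : 0 < min (2 * α) β := lt_min (by positivity) hβ
  have hφ : ∀ i, IsTestFunction fun x => ζ x * ζ x * u i x := fun i =>
    (hζ.mul_right hζ.1).mul_right (hu i)
  have hσ := contDiff_stress hu l m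
  have iOut : ∀ i j, Integrable fun x => outerGrad u ζ x i j * outerGrad u ζ x i j := fun i j =>
    ((hO i j).mul_right (hO i j).1).integrable
  have I1 := IsTestFunction.integrable_energy hW l m
  have I2 := IsTestFunction.integrable_energy hO l m
  have hS : IsTestFunction fun x => symPart (cutGrad u (classicalGrad u) ζ x) i j := by
    have := ((hW i j).add (hW j i)).const_mul (1 / 2)
    simpa [symPart] using this
  -- The energy of `ζu` equals that of `u ⊗ ∇ζ` exactly, since `u` solves the equation wherever
  -- `ζ²u` does not vanish. No absorption argument is needed.
  have key : ∫ x, (frobInner (lameTensor l m (symPart (cutGrad u (classicalGrad u) ζ x)))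
        (symPart (cutGrad u (classicalGrad u) ζ x))
      - frobInner (lameTensor l m (symPart (outerGrad u ζ x))) (symPart (outerGrad u ζ x))) = 0 := by
    have e : ∀ x, frobInner (lameTensor l m (symPart (cutGrad u (classicalGrad u) ζ x)))
        (symPart (cutGrad u (classicalGrad u) ζ x))
      - frobInner (lameTensor l m (symPart (outerGrad u ζ x))) (symPart (outerGrad u ζ x))
      = ∑ i, ∑ j, lameTensor l m (symPart (classicalGrad u x)) i j
        * classicalPartial j (fun x => ζ x * ζ x * u i x) x := fun x => by
      rw [cutGrad, energy_cutGrad_pointwise]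
      refine Finset.sum_congr rfl fun i _ => Finset.sum_congr rfl fun j _ => ?_
      rw [classicalPartial_sq_mul hζ (hu i)]
      simp only [classicalGrad, outerGrad, Matrix.of_apply]
      ring
    simp only [e]
    rw [integral_mul_finset_sum_sum fun i j => (((hφ i).classicalPartial j).mul_left (hσ i j)).integrable]
    refine Finset.sum_eq_zero fun i _ => ?_
    simp only [integral_mul_classicalPartial (hσ _ _) (hφ i)]
    rw [Finset.sum_neg_distrib, ← integral_finsetSum _ fun j _ =>
      ((hφ i).mul_left (contDiff_classicalPartial (hσ i j) j)).integrable, neg_eq_zero]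
    refine integral_eq_zero_of_ae (.of_forall fun x => ?_)
    simp only [← Finset.sum_mul, Pi.zero_apply]
    by_cases hx : ζ x = 0
    · simp [hx]
    · rw [hdiv x hx i, zero_mul]
  rw [integral_sub I1 I2, sub_eq_zero] at key
  rw [← integral_const_mul, ← integral_mul_finset_sum_sum iOut, ← integral_const_mul]
  calc _ ≤ ∫ x, frobInner (lameTensor l m (symPart (cutGrad u (classicalGrad u) ζ x)))
        (symPart (cutGrad u (classicalGrad u) ζ x)) := by
        refine integral_mono ((hS.mul_right hS.1).integrable.const_mul _) I1 fun x => ?_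
        exact (mul_le_mul_of_nonneg_left (sq_symPart_le _ i j) hc.le).trans
          (frobInner_lameTensor_coercive hm hl _)
    _ = _ := key
    _ ≤ _ := integral_mono I2 ((integrable_finsetSum _ fun i _ => integrable_finsetSum _ fun j _ =>
        iOut i j).const_mul _) fun x => energy_le l m _

/-- The restriction of a field to a ball, extended by zero. -/
noncomputable def ballCut (y : E3) (R : ℝ) (f : E3 → ℝ) : E3 → ℝ := (Metric.ball y R).indicator f

lemma integrable_ballCut {y : E3} {R : ℝ} (hR : Metric.closedBall y R ⊆ lowerHalfSpace) {f : E3 → ℝ}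
    (hf : LocallyIntegrableOn f lowerHalfSpace) : Integrable (ballCut y R f) := by
  rw [ballCut, integrable_indicator_iff Metric.isOpen_ball.measurableSet]
  exact (hf.integrableOn_compact_subset hR (isCompact_closedBall y R)).mono_set
    Metric.ball_subset_closedBall

lemma integral_ballCut_mul {y : E3} {R : ℝ} (hR : Metric.closedBall y R ⊆ lowerHalfSpace) (f : E3 → ℝ)
    {ψ : E3 → ℝ} (hψ : tsupport ψ ⊆ Metric.ball y R) :
    ∫ x, ballCut y R f x * ψ x = ∫ x, f x * ψ x ∂halfVol := by
  have hs : tsupport ψ ⊆ lowerHalfSpace := (hψ.trans Metric.ball_subset_closedBall).trans hR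
  rw [integral_half_eq]
  · congr 1 with x
    by_cases hx : x ∈ Metric.ball y R
    · rw [ballCut, indicator_of_mem hx]
    · simp [eq_zero_of_tsupport_subset hψ hx]
  · intro x hx
    simp [eq_zero_of_tsupport_subset hs hx]

lemma classicalPartial_mollify_ballCut {y : E3} {R : ℝ} (hR : Metric.closedBall y R ⊆ lowerHalfSpace)
    {f g : E3 → ℝ} {j : Fin 3} (h : HasWeakPartial j f g) (φ : ContDiffBump (0 : E3)) {x : E3}
    (hx : Metric.closedBall x φ.rOut ⊆ Metric.ball y R) :
    classicalPartial j (mollify φ (ballCut y R f)) x = mollify φ (ballCut y R g) x := by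
  have hs := (tsupport_bump_subset φ x).trans hx
  refine classicalPartial_mollify_eq φ (integrable_ballCut hR h.1).locallyIntegrable ?_
  rw [integral_ballCut_mul hR _ hs,
    integral_ballCut_mul hR _ ((tsupport_classicalPartial_subset _ j).trans hs)]
  exact h.2.2 _ (isTestFunction_bump φ x) ((hs.trans Metric.ball_subset_closedBall).trans hR)

/-- Constant coefficients commute with convolution, so a mollified weak solution solves the equation
classically at points farther than the mollification radius from the edge of the ball. -/
lemma sum_classicalPartial_mollify_ballCut {y : E3} {R : ℝ}
    (hR : Metric.closedBall y R ⊆ lowerHalfSpace) {s : Fin 3 → E3 → ℝ}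
    (hs : ∀ j, LocallyIntegrableOn (s j) lowerHalfSpace)
    (h : ∀ φ, IsTestFunction φ → tsupport φ ⊆ lowerHalfSpace →
      ∑ j, ∫ x, s j x * classicalPartial j φ x ∂halfVol = 0) (φ : ContDiffBump (0 : E3)) {x : E3}
    (hx : Metric.closedBall x φ.rOut ⊆ Metric.ball y R) :
    ∑ j, classicalPartial j (mollify φ (ballCut y R (s j))) x = 0 := by
  have hb := (tsupport_bump_subset φ x).trans hx
  have key := h _ (isTestFunction_bump φ x) ((hb.trans Metric.ball_subset_closedBall).trans hR)
  rw [← neg_eq_zero, ← Finset.sum_neg_distrib] at key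
  rw [← key]
  refine Finset.sum_congr rfl fun j _ => ?_
  rw [classicalPartial_mollify φ (integrable_ballCut hR (hs j)).locallyIntegrable,
    ← integral_ballCut_mul hR _ ((tsupport_classicalPartial_subset _ j).trans hb), ← integral_neg]
  congr 1 with t
  rw [classicalPartial_bump]
  ring


lemma ballCut_lameTensor (y : E3) (R l m : ℝ) (A : E3 → Matrix (Fin 3) (Fin 3) ℝ) (i j : Fin 3) :
    ballCut y R (fun x => lameTensor l m (symPart (A x)) i j)
      = fun x => l * (1 : Matrix (Fin 3) (Fin 3) ℝ) i j * ((ballCut y R (fun x => A x 0 0) x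
        + ballCut y R (fun x => A x 1 1) x) + ballCut y R (fun x => A x 2 2) x)
        + m * (ballCut y R (fun x => A x i j) x + ballCut y R (fun x => A x j i) x) := by
  ext x
  by_cases hx : x ∈ Metric.ball y R
  · simp only [ballCut, indicator_of_mem hx, lameTensor_symPart_apply]
  · simp only [ballCut, indicator_of_notMem hx, add_zero, mul_zero]

lemma mollify_ballCut_lameTensor {y : E3} {R : ℝ} (l m : ℝ) {A : E3 → Matrix (Fin 3) (Fin 3) ℝ}
    (hA : ∀ i j, LocallyIntegrable (ballCut y R fun x => A x i j)) (φ : ContDiffBump (0 : E3))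
    (i j : Fin 3) (x : E3) :
    mollify φ (ballCut y R (fun x => lameTensor l m (symPart (A x)) i j)) x
      = lameTensor l m (symPart (Matrix.of fun i j => mollify φ (ballCut y R fun x => A x i j) x))
        i j := by
  have h1 : LocallyIntegrable fun t => ballCut y R (fun x => A x 0 0) t
      + ballCut y R (fun x => A x 1 1) t := (hA 0 0).add (hA 1 1)
  have h2 : LocallyIntegrable fun t => ballCut y R (fun x => A x 0 0) t
      + ballCut y R (fun x => A x 1 1) t + ballCut y R (fun x => A x 2 2) t := h1.add (hA 2 2)
  have h3 : LocallyIntegrable fun t => ballCut y R (fun x => A x i j) t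
      + ballCut y R (fun x => A x j i) t := (hA i j).add (hA j i)
  have h4 : LocallyIntegrable fun t => l * (1 : Matrix (Fin 3) (Fin 3) ℝ) i j
      * (ballCut y R (fun x => A x 0 0) t + ballCut y R (fun x => A x 1 1) t
      + ballCut y R (fun x => A x 2 2) t) := h2.smul (l * (1 : Matrix (Fin 3) (Fin 3) ℝ) i j)
  have h5 : LocallyIntegrable fun t => m * (ballCut y R (fun x => A x i j) t
      + ballCut y R (fun x => A x j i) t) := h3.smul m
  rw [ballCut_lameTensor, mollify_add φ h4 h5, mollify_const_mul, mollify_const_mul,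
    mollify_add φ h1 (hA 2 2), mollify_add φ (hA 0 0) (hA 1 1), mollify_add φ (hA i j) (hA j i),
    lameTensor_symPart_apply]
  rfl

lemma memLp_ballCut_sub {y : E3} {R ρ : ℝ} (hR : Metric.closedBall y R ⊆ lowerHalfSpace) {f : E3 → ℝ}
    (hf : MemLp (fun x => (weight x)⁻¹ * f x) 2 (volume.restrict (lowerHalfSpace \ Metric.ball y ρ))) :
    MemLp ((Metric.ball y R \ Metric.ball y ρ).indicator f) 2 volume := by
  have hms : MeasurableSet (Metric.ball y R \ Metric.ball y ρ) :=
    Metric.isOpen_ball.measurableSet.diff Metric.isOpen_ball.measurableSet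
  rw [memLp_indicator_iff_restrict hms]
  obtain ⟨W, hW⟩ := (isCompact_closedBall y R).exists_bound_of_continuousOn
    continuous_weight.continuousOn
  have h1 := hf.mono_measure (Measure.restrict_mono
    (sdiff_subset_sdiff_left (Metric.ball_subset_closedBall.trans hR)) le_rfl :
      volume.restrict (Metric.ball y R \ Metric.ball y ρ) ≤ _)
  have e : f = fun x => weight x * ((weight x)⁻¹ * f x) := by
    ext x
    have := (weight_pos x).ne'
    field_simp
  refine (h1.const_mul W).mono ?_ ?_
  · rw [e]
    exact continuous_weight.aestronglyMeasurable.mul h1.1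
  · filter_upwards [ae_restrict_mem hms] with x hx
    have hw := hW x (Metric.ball_subset_closedBall hx.1)
    rw [Real.norm_of_nonneg (weight_pos x).le] at hw
    have h0 := weight_pos x
    calc ‖f x‖ = weight x * ‖(weight x)⁻¹ * f x‖ := by
          rw [norm_mul, norm_inv, Real.norm_of_nonneg h0.le]
          field_simp
      _ ≤ W * ‖(weight x)⁻¹ * f x‖ := by gcongr
      _ ≤ _ := (mul_le_mul_of_nonneg_right (le_abs_self W) (norm_nonneg _)).trans_eq
          (norm_mul W _).symm

/-- Weak solutions for constant coefficients that have finite energy away from a point have finite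
energy. -/
theorem strain_memL2_of_weak_solution {α β l m : ℝ} (hm : α ≤ m) (hl : β ≤ 3 * l + 2 * m)
    (hα : 0 < α) (hβ : 0 < β) {y : E3} (hy : y ∈ lowerHalfSpace) {D : Fin 3 → E3 → ℝ}
    (hD : ∀ i, WeaklyDifferentiable (D i))
    (hw : ∀ r : ℝ, 0 < r → ∀ i, MemLp (fun x => (weight x)⁻¹ * D i x) 2
      (volume.restrict (lowerHalfSpace \ Metric.ball y r)))
    (hg : ∀ r : ℝ, 0 < r → ∀ i j, MemLp (weakPartial j (D i)) 2
      (volume.restrict (lowerHalfSpace \ Metric.ball y r)))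
    (heq : ∀ i φ, IsTestFunction φ → tsupport φ ⊆ lowerHalfSpace →
      ∑ j, ∫ x, lameTensor l m (strain D x) i j * classicalPartial j φ x ∂halfVol = 0) :
    TensorMemL2 (strain D) := by
  intro i₀ j₀
  obtain ⟨R', hR', hsub⟩ := Metric.isOpen_iff.1 isOpen_lowerHalfSpace y hy
  obtain ⟨R, hR0, hRR'⟩ : ∃ R, 0 < R ∧ R < R' := exists_between hR'
  have hR : Metric.closedBall y R ⊆ lowerHalfSpace :=
    (Metric.closedBall_subset_ball hRR').trans hsub
  have hc : 0 < min (2 * α) β := lt_min (by positivity) hβ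
  have hli : ∀ i j, LocallyIntegrableOn (fun x => weakGrad D x i j) lowerHalfSpace := fun i j =>
    (hD i).locallyIntegrableOn_weakPartial j
  have hliσ : ∀ i j, LocallyIntegrableOn (fun x => lameTensor l m (strain D x) i j) lowerHalfSpace := by
    intro i j
    simp only [strain, lameTensor_symPart_apply]
    exact ((((hli 0 0).add (hli 1 1)).add (hli 2 2)).smul
      (l * (1 : Matrix (Fin 3) (Fin 3) ℝ) i j)).add (((hli i j).add (hli j i)).smul m)
  have hfi := fun i => (integrable_ballCut hR (hD i).locallyIntegrableOn).locallyIntegrable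
  have hgi := fun i j => (integrable_ballCut hR (hli i j)).locallyIntegrable
  set u : ℕ → Fin 3 → E3 → ℝ := fun n i => mollify (bumpSeq n) (ballCut y R (D i)) with hu
  have hus : ∀ n i, ContDiff ℝ ∞ (u n i) := fun n i => contDiff_mollify _ (hfi i)
  -- The cutoff is 1 on the ball of radius `R/4` and vanishes outside radius `R/2`. With
  -- mollification radii below `R/8`, the values of `D` used where `∇b ≠ 0` lie outside the ball of
  -- radius `R/8`, where `D` is square integrable.
  let b : ContDiffBump y := ⟨R / 4, R / 2, by positivity, by linarith⟩
  have hζ : IsTestFunction (b : E3 → ℝ) := ⟨b.contDiff, b.hasCompactSupport⟩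
  have hζ1 : ∀ x ∈ Metric.ball y (R / 4), b x = 1 := fun x hx =>
    b.one_of_mem_closedBall (Metric.ball_subset_closedBall hx)
  have hζ' : ∀ x ∈ Metric.ball y (R / 4), ∀ j, classicalPartial j b x = 0 := fun x hx j =>
    classicalPartial_eq_zero_of_const Metric.isOpen_ball hζ1 hx j
  have hsupp : tsupport (b : E3 → ℝ) ⊆ Metric.ball y (3 * R / 4) := by
    rw [b.tsupport_eq]
    exact Metric.closedBall_subset_ball (by change R / 2 < _; linarith)
  have hsmall : ∀ᶠ n in atTop, (bumpSeq n).rOut < R / 8 :=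
    tendsto_rOut_bumpSeq.eventually (gt_mem_nhds (by positivity))
  have hin : ∀ n, (bumpSeq n).rOut < R / 8 → ∀ x ∈ Metric.ball y (3 * R / 4),
      Metric.closedBall x (bumpSeq n).rOut ⊆ Metric.ball y R := by
    intro n hn x hx t ht
    rw [Metric.mem_ball] at hx ⊢
    rw [Metric.mem_closedBall] at ht
    linarith [dist_triangle t x y]
  have hgrad : ∀ n, (bumpSeq n).rOut < R / 8 → ∀ x ∈ Metric.ball y (3 * R / 4), classicalGrad (u n) x
      = Matrix.of fun i j => mollify (bumpSeq n) (ballCut y R fun x => weakGrad D x i j) x := by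
    intro n hn x hx
    ext i j
    exact classicalPartial_mollify_ballCut hR ((hD i).hasWeakPartial j) _ (hin n hn x hx)
  have hdiv : ∀ n, (bumpSeq n).rOut < R / 8 → ∀ x ∈ Metric.ball y (3 * R / 4), ∀ i,
      ∑ j, classicalPartial j (fun x => lameTensor l m (symPart (classicalGrad (u n) x)) i j) x = 0 := by
    intro n hn x hx i
    rw [← sum_classicalPartial_mollify_ballCut hR (hliσ i) (heq i) (bumpSeq n) (hin n hn x hx)]
    refine Finset.sum_congr rfl fun j _ => ?_
    have : (fun x => lameTensor l m (symPart (classicalGrad (u n) x)) i j) =ᶠ[𝓝 x]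
        mollify (bumpSeq n) (ballCut y R fun x => lameTensor l m (strain D x) i j) := by
      filter_upwards [Metric.isOpen_ball.mem_nhds hx] with z hz
      rw [hgrad n hn z hz]
      exact (mollify_ballCut_lameTensor l m hgi (bumpSeq n) i j z).symm
    rw [classicalPartial, classicalPartial, this.fderiv_eq]
  set h : Fin 3 → E3 → ℝ := fun i => (Metric.ball y R \ Metric.ball y (R / 8)).indicator (D i) with hh
  have hhL : ∀ i, MemLp (h i) 2 volume := fun i =>
    memLp_ballCut_sub hR (hw (R / 8) (by positivity) i)
  have hhc : ∀ i, HasCompactSupport (h i) := fun i =>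
    HasCompactSupport.intro (isCompact_closedBall y R) fun x hx => indicator_of_notMem
      (fun hx' => hx (Metric.ball_subset_closedBall hx'.1)) _
  have hht : ∀ n i, IsTestFunction (mollify (bumpSeq n) (h i)) := fun n i =>
    isTestFunction_mollify _ ((hhL i).locallyIntegrable (by norm_num)) (hhc i)
  -- The right-hand side of Caccioppoli's inequality sees only the mollification of `h`, which does
  -- not contain the part of `D` near the pole.
  have hO : ∀ n, (bumpSeq n).rOut < R / 8 → ∀ x i j,
      outerGrad (u n) b x i j = classicalPartial j b x * mollify (bumpSeq n) (h i) x := by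
    intro n hn x i j
    by_cases hx : x ∈ Metric.ball y (R / 4)
    · simp [outerGrad, hζ' x hx j]
    · simp only [outerGrad, Matrix.of_apply]
      congr 1
      refine mollify_congr_on _ fun t ht => ?_
      have ht' : t ∉ Metric.ball y (R / 8) := by
        rw [Metric.mem_ball, not_lt] at hx ⊢
        rw [Metric.mem_ball, dist_comm] at ht
        linarith [dist_triangle x t y]
      by_cases htR : t ∈ Metric.ball y R
      · have : t ∈ Metric.ball y R \ Metric.ball y (R / 8) := ⟨htR, ht'⟩
        simp only [hh, ballCut, indicator_of_mem htR, indicator_of_mem this]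
      · have : t ∉ Metric.ball y R \ Metric.ball y (R / 8) := fun h' => htR h'.1
        simp only [hh, ballCut, indicator_of_notMem htR, indicator_of_notMem this]
  have hlim : ∀ i, Tendsto (fun n => ∫ x, mollify (bumpSeq n) (h i) x * mollify (bumpSeq n) (h i) x)
      atTop (𝓝 (∫ x, h i x * h i x)) := fun i =>
    tendsto_integral_mul_of_eLpNorm (fun n => (hht n i).memLp 2) (hhL i)
      (tendsto_eLpNorm_mollify_sub (hhL i)) (fun n => (hht n i).memLp 2) (hhL i)
      (tendsto_eLpNorm_mollify_sub (hhL i))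
  choose B hB0 hB using fun j => (hζ.classicalPartial j).exists_bound
  -- The integrals of the mollified squares converge, hence are eventually below their limit plus 1;
  -- this makes the bound uniform in `n`.
  set T : ℝ := (3 * |l| + 2 * |m|) * ∑ i, ∑ j, B j ^ 2 * ((∫ x, h i x * h i x) + 1) with hT
  have hbound : ∀ᶠ n in atTop, eLpNorm (fun x => symPart (Matrix.of fun i j => mollify (bumpSeq n)
      (ballCut y R fun x => weakGrad D x i j) x) i₀ j₀) 2 (volume.restrict (Metric.ball y (R / 4)))
      ≤ 1 + ENNReal.ofReal ((min (2 * α) β)⁻¹ * T) := by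
    filter_upwards [hsmall, eventually_all.2 fun i =>
      (hlim i).eventually (gt_mem_nhds (lt_add_one _))] with n hn hn'
    have cac := caccioppoli hm hl hα hβ (hus n) hζ (fun x hx => hdiv n hn x (hsupp
      (subset_tsupport _ hx))) i₀ j₀
    have hTn : (3 * |l| + 2 * |m|) * ∑ i, ∑ j, ∫ x, outerGrad (u n) b x i j * outerGrad (u n) b x i j
        ≤ T := by
      refine mul_le_mul_of_nonneg_left (Finset.sum_le_sum fun i _ => Finset.sum_le_sum fun j _ => ?_)
        (by positivity)
      refine le_trans ?_ (mul_le_mul_of_nonneg_left (hn' i).le (sq_nonneg (B j)))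
      rw [← integral_const_mul]
      refine integral_mono ?_ (((hht n i).mul_right (hht n i).1).integrable.const_mul _) fun x => ?_
      · have := isTestFunction_outerGrad (hus n) hζ i j
        exact (this.mul_right this.1).integrable
      · simp only [hO n hn x i j]
        have := hB j x
        have h2 : classicalPartial j b x ^ 2 ≤ B j ^ 2 := sq_le_sq' (neg_le_of_abs_le this)
          (le_of_abs_le this)
        nlinarith [mul_le_mul_of_nonneg_right h2 (sq_nonneg (mollify (bumpSeq n) (h i) x))]
    have hS : IsTestFunction fun x => symPart (cutGrad (u n) (classicalGrad (u n)) b x) i₀ j₀ := by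
      have hW := isTestFunction_cutGrad (hus n) hζ
      have := ((hW i₀ j₀).add (hW j₀ i₀)).const_mul (1 / 2)
      simpa [symPart] using this
    have hsq : eLpNorm (fun x => symPart (cutGrad (u n) (classicalGrad (u n)) b x) i₀ j₀) 2 volume ^ 2
        ≤ ENNReal.ofReal ((min (2 * α) β)⁻¹ * T) := by
      rw [eLpNorm_two_sq]
      have : ∫⁻ x, ‖symPart (cutGrad (u n) (classicalGrad (u n)) b x) i₀ j₀‖ₑ ^ 2
          = ENNReal.ofReal (∫ x, symPart (cutGrad (u n) (classicalGrad (u n)) b x) i₀ j₀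
            * symPart (cutGrad (u n) (classicalGrad (u n)) b x) i₀ j₀) := by
        rw [ofReal_integral_eq_lintegral_ofReal (hS.mul_right hS.1).integrable
          (.of_forall fun x => mul_self_nonneg _)]
        refine lintegral_congr fun x => ?_
        rw [Real.enorm_eq_ofReal_abs, ← ENNReal.ofReal_pow (abs_nonneg _), sq_abs, sq]
      rw [this]
      refine ENNReal.ofReal_le_ofReal ?_
      rw [inv_mul_eq_div, le_div_iff₀ hc, mul_comm]
      exact cac.trans hTn
    have hle : eLpNorm (fun x => symPart (Matrix.of fun i j => mollify (bumpSeq n)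
        (ballCut y R fun x => weakGrad D x i j) x) i₀ j₀) 2 (volume.restrict (Metric.ball y (R / 4)))
        ≤ eLpNorm (fun x => symPart (cutGrad (u n) (classicalGrad (u n)) b x) i₀ j₀) 2 volume := by
      refine le_trans (le_of_eq ?_) (eLpNorm_mono_measure _
        (Measure.restrict_le_self (s := Metric.ball y (R / 4))))
      refine eLpNorm_congr_ae ?_
      filter_upwards [ae_restrict_mem Metric.isOpen_ball.measurableSet] with x hx
      rw [← hgrad n hn x (Metric.ball_subset_ball (by linarith) hx)]
      congr 2
      ext i j
      simp [cutGrad, outerGrad, hζ1 x hx, hζ' x hx j]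
    refine hle.trans ?_
    -- The inequality `a ≤ 1 + a²` turns the bound of the squared norm into one of the norm without
    -- square roots.
    refine (le_trans ?_ (add_le_add_right hsq 1))
    rcases le_total (eLpNorm (fun x => symPart (cutGrad (u n) (classicalGrad (u n)) b x) i₀ j₀) 2
      volume) 1 with h1 | h1
    · exact h1.trans le_self_add
    · refine le_trans ?_ le_add_self
      rw [sq]
      exact le_mul_of_one_le_left zero_le h1
  have hms : MeasurableSet (Metric.ball y (R / 4)) := Metric.isOpen_ball.measurableSet
  have hball : MemLp (fun x => strain D x i₀ j₀) 2 (volume.restrict (Metric.ball y (R / 4))) := by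
    have hio : ∀ i j, IntegrableOn (fun x => weakGrad D x i j) (Metric.ball y (R / 4)) := fun i j =>
      ((hli i j).integrableOn_compact_subset hR (isCompact_closedBall y R)).mono_set
        ((Metric.ball_subset_ball (by linarith)).trans Metric.ball_subset_closedBall)
    have hlimae : ∀ᵐ x ∂volume.restrict (Metric.ball y (R / 4)), Tendsto (fun n => symPart
        (Matrix.of fun i j => mollify (bumpSeq n) (ballCut y R fun x => weakGrad D x i j) x) i₀ j₀)
        atTop (𝓝 (strain D x i₀ j₀)) := by
      filter_upwards [ae_restrict_mem hms, ae_restrict_of_ae (ae_tendsto_mollify (hgi i₀ j₀)),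
        ae_restrict_of_ae (ae_tendsto_mollify (hgi j₀ i₀))] with x hx h1 h2
      have hxR : x ∈ Metric.ball y R := Metric.ball_subset_ball (by linarith) hx
      have e : ∀ g : E3 → ℝ, ballCut y R g x = g x := fun g => indicator_of_mem hxR g
      rw [e] at h1 h2
      have := (h1.add h2).const_mul (1 / 2)
      simpa [symPart, strain] using this
    have hm0 : ∀ n, AEStronglyMeasurable (fun x => symPart (Matrix.of fun i j => mollify (bumpSeq n)
        (ballCut y R fun x => weakGrad D x i j) x) i₀ j₀) (volume.restrict (Metric.ball y (R / 4))) := by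
      intro n
      have c := fun i j => (contDiff_mollify (bumpSeq n) (hgi i j)).continuous
      simp only [symPart, Matrix.smul_apply, Matrix.add_apply, Matrix.transpose_apply, Matrix.of_apply]
      exact (((c i₀ j₀).add (c j₀ i₀)).const_smul (1 / 2 : ℝ)).aestronglyMeasurable
    refine ⟨?_, ?_⟩
    · simp only [strain, symPart, Matrix.smul_apply, Matrix.add_apply, Matrix.transpose_apply]
      exact ((hio i₀ j₀).aestronglyMeasurable.add (hio j₀ i₀).aestronglyMeasurable).const_smul (1 / 2 : ℝ)
    -- Fatou's lemma: the mollified strains converge almost everywhere and are eventually bounded in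
    -- the mean square, so the limit is square integrable near the pole.
    · refine lt_of_le_of_lt (Lp.eLpNorm_lim_le_liminf_eLpNorm hm0 _ hlimae) ?_
      refine lt_of_le_of_lt (liminf_le_of_frequently_le' hbound.frequently) ?_
      exact ENNReal.add_lt_top.2 ⟨ENNReal.one_lt_top, ENNReal.ofReal_lt_top⟩
  have hoff : MemLp (fun x => strain D x i₀ j₀) 2
      (volume.restrict (lowerHalfSpace \ Metric.ball y (R / 4))) := by
    have := ((hg (R / 4) (by positivity) i₀ j₀).add (hg (R / 4) (by positivity) j₀ i₀)).const_mul
      (1 / 2)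
    simpa [strain, symPart, weakGrad] using this
  classical
  have hfin := MemLp.piecewise (μ := halfVol) hms
    (hball.mono_measure (Measure.restrict_mono_measure Measure.restrict_le_self _)) (g := fun x =>
      strain D x i₀ j₀) (by
      rw [halfVol, Measure.restrict_restrict hms.compl, inter_comm, ← Set.sdiff_eq]
      exact hoff)
  rwa [piecewise_same] at hfin


/-! ### The tensor field `(ℂ(x) - ℂ(y)) ∇̂N(x)` -/

lemma locallyIntegrableOn_stress {N : Fin 3 → E3 → ℝ} (hN : ∀ i, WeaklyDifferentiable (N i)) (l m : ℝ)
    (i j : Fin 3) : LocallyIntegrableOn (fun x => lameTensor l m (strain N x) i j) lowerHalfSpace := by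
  have hli := fun i j => (hN i).locallyIntegrableOn_weakPartial j
  simp only [strain, lameTensor_symPart_apply]
  exact ((((hli 0 0).add (hli 1 1)).add (hli 2 2)).smul
    (l * (1 : Matrix (Fin 3) (Fin 3) ℝ) i j)).add (((hli i j).add (hli j i)).smul m)

lemma weakGrad_sub_ae {u v : Fin 3 → E3 → ℝ} (hu : ∀ i, WeaklyDifferentiable (u i))
    (hv : ∀ i, WeaklyDifferentiable (v i)) :
    ∀ᵐ x ∂halfVol, weakGrad (fun i x => u i x - v i x) x = weakGrad u x - weakGrad v x := by
  filter_upwards [ae_all_iff.2 fun i => ae_all_iff.2 fun j => weakPartial_sub (hu i) (hv i) j]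
    with x hx
  ext i j
  exact hx i j

lemma weakGrad_add_ae {u v : Fin 3 → E3 → ℝ} (hu : ∀ i, WeaklyDifferentiable (u i))
    (hv : ∀ i, WeaklyDifferentiable (v i)) :
    ∀ᵐ x ∂halfVol, weakGrad (fun i x => u i x + v i x) x = weakGrad u x + weakGrad v x := by
  filter_upwards [ae_all_iff.2 fun i => ae_all_iff.2 fun j => weakPartial_add (hu i) (hv i) j]
    with x hx
  ext i j
  exact hx i j

lemma weakGrad_test_ae {φ : Fin 3 → E3 → ℝ} (hφ : ∀ i, IsTestFunction (φ i)) :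
    ∀ᵐ x ∂halfVol, weakGrad φ x = classicalGrad φ x := by
  filter_upwards [ae_all_iff.2 fun i => ae_all_iff.2 fun j => (hφ i).weakPartial_ae_eq j] with x hx
  ext i j
  exact hx i j

lemma symPart_sub (A B : Matrix (Fin 3) (Fin 3) ℝ) : symPart (A - B) = symPart A - symPart B := by
  ext i j
  simp [symPart]
  ring

lemma symPart_add (A B : Matrix (Fin 3) (Fin 3) ℝ) : symPart (A + B) = symPart A + symPart B := by
  ext i j
  simp [symPart]
  ring

lemma lameTensor_sub (l m : ℝ) (A B : Matrix (Fin 3) (Fin 3) ℝ) :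
    lameTensor l m (A - B) = lameTensor l m A - lameTensor l m B := by
  ext i j
  simp [lameTensor, symPart_sub, Matrix.trace_sub]
  ring

lemma lameTensor_add (l m : ℝ) (A B : Matrix (Fin 3) (Fin 3) ℝ) :
    lameTensor l m (A + B) = lameTensor l m A + lameTensor l m B := by
  ext i j
  simp [lameTensor, symPart_add, Matrix.trace_add]
  ring

lemma frobInner_sub_left (A B C : Matrix (Fin 3) (Fin 3) ℝ) :
    frobInner (A - B) C = frobInner A C - frobInner B C := by
  simp [frobInner, sub_mul, Finset.sum_sub_distrib]

lemma frobInner_add_left (A B C : Matrix (Fin 3) (Fin 3) ℝ) :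
    frobInner (A + B) C = frobInner A C + frobInner B C := by
  simp [frobInner, add_mul, Finset.sum_add_distrib]

lemma frobInner_symPart_right (A B : Matrix (Fin 3) (Fin 3) ℝ) :
    frobInner A (symPart B) = ∑ i, ∑ j, symPart A i j * B i j := by
  simp [frobInner, symPart, Fin.sum_univ_three]
  ring

/-- The weak equation of a Neumann function with constant coefficients, by components. -/
lemma IsNeumannColumn.sum_integral_stress {l m : ℝ} {y : E3} {k : Fin 3} {N : Fin 3 → E3 → ℝ}
    (h : IsNeumannColumn (fun _ => l) (fun _ => m) y k N) (i : Fin 3) {φ : E3 → ℝ}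
    (hφ : IsTestFunction φ) (hs : tsupport φ ⊆ lowerHalfSpace) :
    ∑ j, ∫ x, lameTensor l m (strain N x) i j * classicalPartial j φ x ∂halfVol
      = - if k = i then φ y else 0 := by
  -- The test field has a single nonzero component, which isolates one row of the stress.
  have key := h.weak_eq (fun k x => if k = i then φ x else 0) fun k => by
    by_cases hk : k = i
    · simpa [hk] using hφ
    · simpa [hk] using IsTestFunction.zero
  rw [← key, ← integral_finsetSum]
  · congr 1 with x
    rw [strain, frobInner_lameTensor_eq_sum]
    symm
    rw [Finset.sum_eq_single i]
    · simp [classicalGrad]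
    · intro k _ hk
      simp [classicalGrad, hk, classicalPartial_const]
    · simp
  · intro j _
    exact LocallyIntegrableOn.integrable_mul_test
      (locallyIntegrableOn_stress h.weaklyDifferentiable l m i j) (hφ.classicalPartial j).continuous
      (hφ.classicalPartial j).2 ((tsupport_classicalPartial_subset φ j).trans hs)

/-- Two Neumann functions with the same constant coefficients differ by a field of finite energy. -/
theorem strain_sub_memL2 {α β l m : ℝ} (hm : α ≤ m) (hl : β ≤ 3 * l + 2 * m) (hα : 0 < α) (hβ : 0 < β)
    {y : E3} (hy : y ∈ lowerHalfSpace) {k : Fin 3} {N N' : Fin 3 → E3 → ℝ}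
    (h : IsNeumannColumn (fun _ => l) (fun _ => m) y k N)
    (h' : IsNeumannColumn (fun _ => l) (fun _ => m) y k N') :
    TensorMemL2 (strain fun i x => N i x - N' i x) := by
  have hsub := weakGrad_sub_ae h.weaklyDifferentiable h'.weaklyDifferentiable
  refine strain_memL2_of_weak_solution hm hl hα hβ hy
    (fun i => (h.weaklyDifferentiable i).sub (h'.weaklyDifferentiable i)) (fun r hr i => ?_)
    (fun r hr i j => ?_) fun i φ hφ hs => ?_
  · simp only [mul_sub]
    exact (h.memLp_weight r hr i).sub (h'.memLp_weight r hr i)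
  · have e : weakPartial j (fun x => N i x - N' i x)
        =ᵐ[volume.restrict (lowerHalfSpace \ Metric.ball y r)]
        fun x => weakPartial j (N i) x - weakPartial j (N' i) x :=
      ae_mono (restrict_diff_le_halfVol (Metric.ball y r))
        (weakPartial_sub (h.weaklyDifferentiable i) (h'.weaklyDifferentiable i) j)
    exact MemLp.ae_eq e.symm ((h.memLp_partial r hr i j).sub (h'.memLp_partial r hr i j))
  · have e1 := h.sum_integral_stress i hφ hs
    have e2 := h'.sum_integral_stress i hφ hs
    have I : ∀ {N : Fin 3 → E3 → ℝ} (_ : ∀ i, WeaklyDifferentiable (N i)) (j : Fin 3),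
        Integrable (fun x => lameTensor l m (strain N x) i j * classicalPartial j φ x) halfVol :=
      fun hN j => LocallyIntegrableOn.integrable_mul_test
        (locallyIntegrableOn_stress hN l m i j) (hφ.classicalPartial j).continuous
        (hφ.classicalPartial j).2 ((tsupport_classicalPartial_subset φ j).trans hs)
    rw [← sub_eq_zero.2 (e1.trans e2.symm), ← Finset.sum_sub_distrib]
    refine Finset.sum_congr rfl fun j _ => ?_
    rw [← integral_sub (I h.weaklyDifferentiable j) (I h'.weaklyDifferentiable j)]
    refine integral_congr_ae (hsub.mono fun x hx => ?_)
    simp only [strain, hx, symPart_sub, lameTensor_sub, Matrix.sub_apply, sub_mul]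

lemma frozenDefect_apply (lam mu : E3 → ℝ) (y : E3) (N : Fin 3 → E3 → ℝ) (x : E3) (i j : Fin 3) :
    frozenDefect lam mu y N x i j = (1 : Matrix (Fin 3) (Fin 3) ℝ) i j
      * ((lam x - lam y) * strain N x 0 0 + (lam x - lam y) * strain N x 1 1
        + (lam x - lam y) * strain N x 2 2) + 2 * ((mu x - mu y) * strain N x i j) := by
  simp only [frozenDefect, strain, Matrix.sub_apply, lameTensor_symPart_apply]
  simp [symPart]
  ring

/-- The given column is compared with the constructed one. For the latter the Lipschitz factor tames
the singularity; the difference has square integrable strain, so boundedness of the coefficients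
suffices. -/
theorem AdmissibleLame.frozenDefect_memL2 {α β K : ℝ} {lam mu : E3 → ℝ}
    (h : AdmissibleLame α β K lam mu) (hα : 0 < α) (hβ : 0 < β) {y : E3} (hy : y ∈ lowerHalfSpace)
    {k : Fin 3} {Nt : Fin 3 → E3 → ℝ} (hN : IsFrozenNeumannColumn lam mu y k Nt) :
    TensorMemL2 (frozenDefect lam mu y Nt) := by
  obtain ⟨N, hN', hmul⟩ := exists_neumannColumn_const hα hβ (h.frozen hy) hy k
  have hD := strain_sub_memL2 (h.mu_ge y hy) (h.bulk_ge y hy) hα hβ hy hN hN'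
  have hK : 0 ≤ max K 0 := le_max_right _ _
  have key : ∀ a : E3 → ℝ, MemLp a ∞ halfVol → (∀ x ∈ lowerHalfSpace, |a x| ≤ max K 0) →
      (∀ x ∈ lowerHalfSpace, |a x - a y| ≤ max K 0 * ‖x - y‖) → ∀ i j,
      MemLp (fun x => (a x - a y) * strain Nt x i j) 2 halfVol := by
    intro a ha hb hL i j
    have ha' : MemLp (fun x => a x - a y) ∞ halfVol := ha.sub (memLp_top_const _)
    -- The constant `2 * max K 0` serves both as a bound for the difference of two values and as a
    -- Lipschitz constant.
    have hp := hmul (fun x => a x - a y) (2 * max K 0) ha'.1 fun x hx => ⟨by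
      have h1 := abs_sub (a x) (a y)
      linarith [hb x hx, hb y hy], (hL x hx).trans (by
        have := mul_nonneg hK (norm_nonneg (x - y))
        linarith)⟩
    refine MemLp.ae_eq ?_ ((((hp i j).add (hp j i)).const_mul (1 / 2)).add
      (memLp_mul_of_top ha' (hD i j)))
    filter_upwards [weakGrad_sub_ae hN.weaklyDifferentiable hN'.weaklyDifferentiable] with x hx
    simp only [Pi.add_apply, strain, hx]
    simp [symPart, weakGrad]
    ring
  have k1 := key lam h.memLp_lam (fun x hx => h.abs_lam_le hx) fun x hx => h.abs_lam_sub_le hx hy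
  have k2 := key mu h.memLp_mu (fun x hx => h.abs_mu_le hx) fun x hx => h.abs_mu_sub_le hx hy
  intro i j
  simp only [frozenDefect_apply]
  exact ((((k1 0 0).add (k1 1 1)).add (k1 2 2)).const_mul _).add ((k2 i j).const_mul 2)

/-! ### The variational problem -/

lemma AdmissibleLame.integrable_energy {α β K : ℝ} {lam mu : E3 → ℝ} (h : AdmissibleLame α β K lam mu)
    {u v : Fin 3 → E3 → ℝ} (hu : VecMemH10 u) (hv : VecMemH10 v) :
    Integrable (fun x => frobInner (lameTensor (lam x) (mu x) (strain u x)) (strain v x)) halfVol :=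
  (hu.strain_memL2.lameTensor h.memLp_lam h.memLp_mu).integrable_frobInner hv.strain_memL2

/-- Pairing `F` with a symmetric tensor sees only its symmetric part, so the data are a pure
gradient term. -/
theorem AdmissibleLame.exists_variationalSolution {α β K : ℝ} {lam mu : E3 → ℝ}
    (h : AdmissibleLame α β K lam mu) (hα : 0 < α) (hβ : 0 < β) {F : E3 → Matrix (Fin 3) (Fin 3) ℝ}
    (hF : TensorMemL2 F) : ∃ M, IsVariationalSolution lam mu F M := by
  obtain ⟨M, hM, hMeq⟩ := h.exists_solution hα hβ (b := fun _ _ => 0)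
    (A := fun x => - symPart (F x)) (fun _ => MemLp.zero') (fun i j => (hF.symPart i j).neg)
  refine ⟨M, hM, fun v hv => ?_⟩
  rw [hMeq v hv]
  simp only [zero_mul, integral_zero, zero_add, Matrix.neg_apply, neg_mul, integral_neg,
    Finset.sum_neg_distrib, strain, frobInner_symPart_right]
  rw [integral_mul_finset_sum_sum fun i j =>
    integrable_mul_of_memLp_two (hF.symPart i j) (hv.weakGrad_memL2 i j)]

lemma VecMemH10.sub {u v : Fin 3 → E3 → ℝ} (hu : VecMemH10 u) (hv : VecMemH10 v) :
    VecMemH10 fun i x => u i x - v i x := fun i => (hu i).sub (hv i)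

/-- Vanishing energy forces vanishing strain and, by Korn and Hardy, a vanishing weighted norm;
rigid motions are excluded by the weight. -/
lemma AdmissibleLame.ae_eq_zero_of_energy {α β K : ℝ} {lam mu : E3 → ℝ}
    (h : AdmissibleLame α β K lam mu) (hα : 0 < α) (hβ : 0 < β) {u : Fin 3 → E3 → ℝ}
    (hu : VecMemH10 u) (h0 : ∫ x, frobInner (lameTensor (lam x) (mu x) (strain u x)) (strain u x)
      ∂halfVol ≤ 0) (i : Fin 3) : u i =ᵐ[halfVol] 0 := by
  have hc : 0 < min (2 * α) β := lt_min (by positivity) hβ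
  have h1 : ∫ x, frobInner (strain u x) (strain u x) ∂halfVol ≤ 0 := by
    by_contra hlt
    have := mul_pos hc (not_le.1 hlt)
    linarith [h.energy_coercive hu]
  have h2 := hu.korn_hardy_strain
  have hn : ∀ i, 0 ≤ ∫ x, ((weight x)⁻¹ * u i x) * ((weight x)⁻¹ * u i x) ∂halfVol := fun i =>
    integral_nonneg fun x => mul_self_nonneg _
  have hn' : ∀ i, 0 ≤ ∑ j, ∫ x, weakPartial j (u i) x * weakPartial j (u i) x ∂halfVol := fun i =>
    Finset.sum_nonneg fun j _ => integral_nonneg fun x => mul_self_nonneg _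
  have h3 := Finset.single_le_sum (f := fun i =>
    (∫ x, ((weight x)⁻¹ * u i x) * ((weight x)⁻¹ * u i x) ∂halfVol)
        + ∑ j, ∫ x, weakPartial j (u i) x * weakPartial j (u i) x ∂halfVol)
    (fun i _ => add_nonneg (hn i) (hn' i)) (Finset.mem_univ i)
  have h4 : ∫ x, ((weight x)⁻¹ * u i x) * ((weight x)⁻¹ * u i x) ∂halfVol = 0 :=
    le_antisymm (by linarith [hn' i]) (hn i)
  rw [integral_eq_zero_iff_of_nonneg (fun x => mul_self_nonneg _)
    (integrable_mul_of_memLp_two (hu i).2 (hu i).2)] at h4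
  filter_upwards [h4] with x hx
  have := (weight_pos x).ne'
  simpa [this] using hx

theorem IsVariationalSolution.ae_eq {α β K : ℝ} {lam mu : E3 → ℝ}
    (h : AdmissibleLame α β K lam mu) (hα : 0 < α) (hβ : 0 < β) {F : E3 → Matrix (Fin 3) (Fin 3) ℝ}
    {M M' : Fin 3 → E3 → ℝ} (hM : IsVariationalSolution lam mu F M)
    (hM' : IsVariationalSolution lam mu F M') (i : Fin 3) : M' i =ᵐ[halfVol] M i := by
  have hD := hM'.1.sub hM.1
  have e : ∫ x, frobInner (lameTensor (lam x) (mu x) (strain (fun i x => M' i x - M i x) x))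
      (strain (fun i x => M' i x - M i x) x) ∂halfVol = 0 := by
    rw [← sub_eq_zero.2 ((hM'.2 _ hD).trans (hM.2 _ hD).symm),
      ← integral_sub (h.integrable_energy hM'.1 hD) (h.integrable_energy hM.1 hD)]
    refine integral_congr_ae ?_
    filter_upwards [weakGrad_sub_ae (fun i => (hM'.1 i).1) fun i => (hM.1 i).1] with x hx
    simp only [strain, hx, symPart_sub, lameTensor_sub, frobInner_sub_left]
  filter_upwards [h.ae_eq_zero_of_energy hα hβ hD e.le i] with x hx
  exact sub_eq_zero.1 hx

lemma neg_frobInner_le {c : ℝ} (hc : 0 < c) (A B : Matrix (Fin 3) (Fin 3) ℝ) :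
    - frobInner A B ≤ (2 * c)⁻¹ * frobInner A A + c / 2 * frobInner B B := by
  simp only [frobInner, Finset.mul_sum, ← Finset.sum_neg_distrib, ← Finset.sum_add_distrib]
  refine Finset.sum_le_sum fun i _ => Finset.sum_le_sum fun j _ => ?_
  have : (2 * c)⁻¹ * (A i j * A i j) + c / 2 * (B i j * B i j) + A i j * B i j
      = (2 * c)⁻¹ * (A i j + c * B i j) ^ 2 := by
    field_simp
    ring
  have h2 : 0 ≤ (2 * c)⁻¹ * (A i j + c * B i j) ^ 2 := by positivity
  linarith

/-- Testing with the solution itself and using Young's inequality bounds the squared strain norm by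
`c⁻²` times that of `F`; the factor 1260 comes from Korn and Hardy. -/
theorem IsVariationalSolution.h10Norm_le {α β K : ℝ} {lam mu : E3 → ℝ}
    (h : AdmissibleLame α β K lam mu) (hα : 0 < α) (hβ : 0 < β) {F : E3 → Matrix (Fin 3) (Fin 3) ℝ}
    (hF : TensorMemL2 F) {M : Fin 3 → E3 → ℝ} (hM : IsVariationalSolution lam mu F M) :
    h10Norm M ≤ Real.sqrt (1260 / min (2 * α) β ^ 2) * tensorL2Norm F := by
  have hc : 0 < min (2 * α) β := lt_min (by positivity) hβ
  set c := min (2 * α) β with hcdef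
  have hs := hM.1.strain_memL2
  have k1 := h.energy_coercive hM.1
  rw [hM.2 M hM.1] at k1
  have k2 : - ∫ x, frobInner (F x) (strain M x) ∂halfVol
      ≤ (2 * c)⁻¹ * (∫ x, frobInner (F x) (F x) ∂halfVol)
        + c / 2 * ∫ x, frobInner (strain M x) (strain M x) ∂halfVol := by
    rw [← integral_neg, ← integral_const_mul, ← integral_const_mul, ← integral_add
      ((hF.integrable_frobInner hF).const_mul _) ((hs.integrable_frobInner hs).const_mul _)]
    exact integral_mono (hF.integrable_frobInner hs).neg
      (((hF.integrable_frobInner hF).const_mul _).add ((hs.integrable_frobInner hs).const_mul _))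
      fun x => neg_frobInner_le hc _ _
  have k3 := hM.1.korn_hardy_strain
  simp only [← sq] at k3
  rw [h10Norm, tensorL2Norm, ← Real.sqrt_mul (by positivity)]
  refine Real.sqrt_le_sqrt (k3.trans ?_)
  have k4 : c / 2 * ∫ x, frobInner (strain M x) (strain M x) ∂halfVol
      ≤ (2 * c)⁻¹ * ∫ x, frobInner (F x) (F x) ∂halfVol := by linarith
  -- The factor `2520 / c` restores `1260` on the left, where half of the coercivity constant
  -- remained after absorption.
  have k5 := mul_le_mul_of_nonneg_left k4 (by positivity : 0 ≤ 2520 / c)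
  calc _ = 2520 / c * (c / 2 * ∫ x, frobInner (strain M x) (strain M x) ∂halfVol) := by
        field_simp
        ring
    _ ≤ _ := k5
    _ = _ := by
        field_simp
        ring

/-- The variational identity for test fields implies the one for all admissible fields. -/
theorem isVariationalSolution_of_test {α β K : ℝ} {lam mu : E3 → ℝ}
    (h : AdmissibleLame α β K lam mu) {F : E3 → Matrix (Fin 3) (Fin 3) ℝ} (hF : TensorMemL2 F)
    {w : Fin 3 → E3 → ℝ} (hw : VecMemH10 w)
    (heq : ∀ φ : Fin 3 → E3 → ℝ, (∀ i, IsTestFunction (φ i)) →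
      ∫ x, frobInner (lameTensor (lam x) (mu x) (strain w x) + F x) (symPart (classicalGrad φ x))
        ∂halfVol = 0) : IsVariationalSolution lam mu F w := by
  refine ⟨hw, fun v hv => ?_⟩
  have hA1 := hw.strain_memL2.lameTensor h.memLp_lam h.memLp_mu
  have hA : TensorMemL2 fun x => lameTensor (lam x) (mu x) (strain w x) + F x := fun i j =>
    (hA1 i j).add (hF i j)
  rw [← sub_eq_zero, sub_neg_eq_add, ← integral_add (hA1.integrable_frobInner hv.strain_memL2)
    (hF.integrable_frobInner hv.strain_memL2)]
  simp only [← frobInner_add_left]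
  -- Only the convergence of the gradients is needed, because both sides involve the test field
  -- through its strain.
  choose φ hφ _ hlim using fun i => (hv i).exists_approx
  have t : ∀ i j, Tendsto (fun n => ∫ x, symPart (lameTensor (lam x) (mu x) (strain w x) + F x) i j
      * classicalPartial j (φ i n) x ∂halfVol) atTop
      (𝓝 (∫ x, symPart (lameTensor (lam x) (mu x) (strain w x) + F x) i j
        * weakPartial j (v i) x ∂halfVol)) := fun i j =>
    tendsto_integral_mul_of_eLpNorm (fun _ => hA.symPart i j) (hA.symPart i j) (by simp)
      (fun n => ((hφ i n).classicalPartial j).memLp_half 2) ((hv i).3 j) (hlim i j)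
  have t2 := tendsto_finsetSum Finset.univ fun i _ => tendsto_finsetSum Finset.univ fun j _ => t i j
  have e1 : ∀ n, ∑ i, ∑ j, ∫ x, symPart (lameTensor (lam x) (mu x) (strain w x) + F x) i j
      * classicalPartial j (φ i n) x ∂halfVol = 0 := fun n => by
    rw [← heq (fun i => φ i n) fun i => hφ i n, ← integral_mul_finset_sum_sum fun i j =>
      integrable_mul_of_memLp_two (hA.symPart i j) (((hφ i n).classicalPartial j).memLp_half 2)]
    simp only [frobInner_symPart_right]
    rfl
  simp only [e1] at t2
  rw [tendsto_nhds_unique tendsto_const_nhds t2, ← integral_mul_finset_sum_sum fun i j =>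
      integrable_mul_of_memLp_two (hA.symPart i j) ((hv i).3 j)]
  simp only [strain, frobInner_symPart_right]
  rfl


/-! ### The correction of the Neumann function -/

/-- Near the pole the gradient is locally integrable, since the pole is interior; elsewhere it is
square integrable. Such integrability must be proved before integrals are split, as the integral of
a non-integrable function is 0 by convention. -/
lemma IsNeumannColumn.integrable_mul_test {lam mu : E3 → ℝ} {y : E3} (hy : y ∈ lowerHalfSpace)
    {k : Fin 3} {N : Fin 3 → E3 → ℝ} (h : IsNeumannColumn lam mu y k N) (i j : Fin 3) {φ : E3 → ℝ}
    (hφ : IsTestFunction φ) : Integrable (fun x => weakPartial j (N i) x * φ x) halfVol := by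
  obtain ⟨R', hR', hsub⟩ := Metric.isOpen_iff.1 isOpen_lowerHalfSpace y hy
  obtain ⟨R, hR0, hRR'⟩ : ∃ R, 0 < R ∧ R < R' := exists_between hR'
  have hR : Metric.closedBall y R ⊆ lowerHalfSpace :=
    (Metric.closedBall_subset_ball hRR').trans hsub
  have h1 : IntegrableOn (fun x => weakPartial j (N i) x * φ x) (Metric.closedBall y R) :=
    (((h.weaklyDifferentiable i).locallyIntegrableOn_weakPartial j).integrableOn_compact_subset hR
      (isCompact_closedBall y R)).mul_continuousOn hφ.continuous.continuousOn
      (isCompact_closedBall y R)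
  have h2 : IntegrableOn (fun x => weakPartial j (N i) x * φ x) (lowerHalfSpace \ Metric.ball y R) :=
    (h.memLp_partial R hR0 i j).integrable_mul ((hφ.memLp 2).restrict _)
  refine (h1.union h2).mono_set fun x hx => ?_
  by_cases hxR : x ∈ Metric.ball y R
  · exact .inl (Metric.ball_subset_closedBall hxR)
  · exact .inr ⟨hx, hxR⟩

lemma IsNeumannColumn.integrable_frozen_energy {lam mu : E3 → ℝ} {y : E3} (hy : y ∈ lowerHalfSpace)
    {k : Fin 3} {N : Fin 3 → E3 → ℝ} (h : IsNeumannColumn lam mu y k N) (l m : ℝ)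
    {φ : Fin 3 → E3 → ℝ} (hφ : ∀ i, IsTestFunction (φ i)) :
    Integrable (fun x => frobInner (lameTensor l m (strain N x)) (symPart (classicalGrad φ x)))
      halfVol := by
  simp only [strain, frobInner_lameTensor_eq_sum, lameTensor_symPart_apply]
  refine integrable_finsetSum _ fun i _ => integrable_finsetSum _ fun j _ => ?_
  have I := fun a b => h.integrable_mul_test hy a b ((hφ i).classicalPartial j)
  have := ((((I 0 0).add (I 1 1)).add (I 2 2)).const_mul
    (l * (1 : Matrix (Fin 3) (Fin 3) ℝ) i j)).add (((I i j).add (I j i)).const_mul m)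
  refine this.congr (.of_forall fun x => ?_)
  simp only [Pi.add_apply, weakGrad, classicalGrad, Matrix.of_apply]
  ring

lemma lameTensor_eq_add_frozenDefect (lam mu : E3 → ℝ) (y : E3) (N : Fin 3 → E3 → ℝ) (x : E3) :
    lameTensor (lam x) (mu x) (strain N x)
      = lameTensor (lam y) (mu y) (strain N x) + frozenDefect lam mu y N x := by
  rw [frozenDefect, add_sub_cancel]

lemma TensorMemL2.integrable_test {F : E3 → Matrix (Fin 3) (Fin 3) ℝ} (hF : TensorMemL2 F)
    {φ : Fin 3 → E3 → ℝ} (hφ : ∀ i, IsTestFunction (φ i)) :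
    Integrable (fun x => frobInner (F x) (HalfSpaceLame.symPart (classicalGrad φ x))) halfVol := by
  have : TensorMemL2 (classicalGrad φ) := fun i j => ((hφ i).classicalPartial j).memLp_half 2
  exact hF.integrable_frobInner this.symPart

/-- The weak equation with variable coefficients for a column with frozen coefficients. -/
lemma IsFrozenNeumannColumn.integral_eq {lam mu : E3 → ℝ} {y : E3} (hy : y ∈ lowerHalfSpace)
    {k : Fin 3} {Nt : Fin 3 → E3 → ℝ} (h : IsFrozenNeumannColumn lam mu y k Nt)
    (hF : TensorMemL2 (frozenDefect lam mu y Nt)) {φ : Fin 3 → E3 → ℝ}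
    (hφ : ∀ i, IsTestFunction (φ i)) :
    Integrable (fun x => frobInner (lameTensor (lam x) (mu x) (strain Nt x))
      (symPart (classicalGrad φ x))) halfVol ∧
    ∫ x, frobInner (lameTensor (lam x) (mu x) (strain Nt x)) (symPart (classicalGrad φ x)) ∂halfVol
      = - φ k y + ∫ x, frobInner (frozenDefect lam mu y Nt x) (symPart (classicalGrad φ x)) ∂halfVol := by
  have I1 := IsNeumannColumn.integrable_frozen_energy hy h (lam y) (mu y) hφ
  have I2 := hF.integrable_test hφ
  simp only [lameTensor_eq_add_frozenDefect lam mu y, frobInner_add_left]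
  refine ⟨I1.add I2, ?_⟩
  rw [integral_add I1 I2, ← h.weak_eq φ hφ]

/-- The variable tensor applied to the frozen column produces the Dirac source plus the pairing with
the defect, and the equation for `M` contributes the negative of that pairing. -/
theorem IsFrozenNeumannColumn.add {α β K : ℝ} {lam mu : E3 → ℝ} (ha : AdmissibleLame α β K lam mu)
    {y : E3} (hy : y ∈ lowerHalfSpace) {k : Fin 3} {Nt M : Fin 3 → E3 → ℝ}
    (h : IsFrozenNeumannColumn lam mu y k Nt) (hF : TensorMemL2 (frozenDefect lam mu y Nt))
    (hM : IsVariationalSolution lam mu (frozenDefect lam mu y Nt) M) :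
    IsNeumannColumn lam mu y k fun i x => Nt i x + M i x where
  weaklyDifferentiable i := (h.weaklyDifferentiable i).add (hM.1 i).1
  memLp_weight r hr i := by
    simp only [mul_add]
    exact (h.memLp_weight r hr i).add ((hM.1 i).2.mono_measure (restrict_diff_le_halfVol _))
  memLp_partial r hr i j := by
    have e : weakPartial j (fun x => Nt i x + M i x)
        =ᵐ[volume.restrict (lowerHalfSpace \ Metric.ball y r)]
        fun x => weakPartial j (Nt i) x + weakPartial j (M i) x :=
      ae_mono (restrict_diff_le_halfVol (Metric.ball y r))
        (weakPartial_add (h.weaklyDifferentiable i) (hM.1 i).1 j)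
    exact MemLp.ae_eq e.symm ((h.memLp_partial r hr i j).add
      (((hM.1 i).3 j).mono_measure (restrict_diff_le_halfVol _)))
  weak_eq φ hφ := by
    have hφH : VecMemH10 φ := fun i => (hφ i).memH10
    obtain ⟨I1, e1⟩ := h.integral_eq hy hF hφ
    have e2 := hM.2 φ hφH
    have I2 := ha.integrable_energy hM.1 hφH
    have e3 : ∫ x, frobInner (frozenDefect lam mu y Nt x) (symPart (classicalGrad φ x)) ∂halfVol
        = ∫ x, frobInner (frozenDefect lam mu y Nt x) (strain φ x) ∂halfVol :=
      integral_congr_ae ((weakGrad_test_ae hφ).mono fun x hx => by simp only [strain, hx])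
    have e4 : ∫ x, frobInner (lameTensor (lam x) (mu x) (strain (fun i x => Nt i x + M i x) x))
        (symPart (classicalGrad φ x)) ∂halfVol
        = ∫ x, (frobInner (lameTensor (lam x) (mu x) (strain Nt x)) (symPart (classicalGrad φ x))
          + frobInner (lameTensor (lam x) (mu x) (strain M x)) (strain φ x)) ∂halfVol := by
      refine integral_congr_ae ?_
      filter_upwards [weakGrad_test_ae hφ,
        weakGrad_add_ae h.weaklyDifferentiable fun i => (hM.1 i).1] with x h1 h2
      simp only [strain, h1, h2, symPart_add, lameTensor_add, frobInner_add_left]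
    rw [e4, integral_add I1 I2, e1, e2, e3]
    ring

/-- Subtracting the two equations removes the Dirac source. What remains is known for test fields
only, and extends by density once the difference is in the weighted space. -/
theorem IsNeumannColumn.isVariationalSolution_sub {α β K : ℝ} {lam mu : E3 → ℝ}
    (ha : AdmissibleLame α β K lam mu) {y : E3} (hy : y ∈ lowerHalfSpace) {k : Fin 3}
    {N Nt : Fin 3 → E3 → ℝ} (hN : IsNeumannColumn lam mu y k N)
    (h : IsFrozenNeumannColumn lam mu y k Nt) (hF : TensorMemL2 (frozenDefect lam mu y Nt))
    (hsub : VecMemH10 fun i x => N i x - Nt i x) :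
    IsVariationalSolution lam mu (frozenDefect lam mu y Nt) fun i x => N i x - Nt i x := by
  refine isVariationalSolution_of_test ha hF hsub fun φ hφ => ?_
  obtain ⟨I1, e1⟩ := h.integral_eq hy hF hφ
  have I2 := hF.integrable_test hφ
  have I3 := (hsub.strain_memL2.lameTensor ha.memLp_lam ha.memLp_mu).integrable_test hφ
  have e2 : ∫ x, frobInner (lameTensor (lam x) (mu x) (strain N x)) (symPart (classicalGrad φ x))
      ∂halfVol = ∫ x, (frobInner (lameTensor (lam x) (mu x) (strain (fun i x => N i x - Nt i x) x))
        (symPart (classicalGrad φ x))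
        + frobInner (lameTensor (lam x) (mu x) (strain Nt x)) (symPart (classicalGrad φ x)))
        ∂halfVol := by
    refine integral_congr_ae ?_
    filter_upwards [weakGrad_sub_ae hN.weaklyDifferentiable h.weaklyDifferentiable] with x hx
    simp only [strain, hx, symPart_sub, lameTensor_sub, frobInner_sub_left, sub_add_cancel]
  rw [hN.weak_eq φ hφ, integral_add I3 I1, e1] at e2
  simp only [frobInner_add_left]
  rw [integral_add I3 I2]
  linarith

end HalfSpaceLame


theorem mainTheorem8 (α₀ β₀ K : ℝ) (hα : 0 < α₀) (hβ : 0 < β₀) :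
    ∃ C : ℝ, 0 < C ∧
      ∀ lam mu : E3 → ℝ, AdmissibleLame α₀ β₀ K lam mu →
      ∀ y ∈ lowerHalfSpace, ∀ k : Fin 3,
        (∃ Nt : Fin 3 → E3 → ℝ, IsFrozenNeumannColumn lam mu y k Nt) ∧
        ∀ Nt : Fin 3 → E3 → ℝ, IsFrozenNeumannColumn lam mu y k Nt →
          TensorMemL2 (frozenDefect lam mu y Nt) ∧
          ∃ M : Fin 3 → E3 → ℝ,
            IsVariationalSolution lam mu (frozenDefect lam mu y Nt) M ∧
            (∀ M' : Fin 3 → E3 → ℝ,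
              IsVariationalSolution lam mu (frozenDefect lam mu y Nt) M' →
              ∀ i, M' i =ᵐ[halfVol] M i) ∧
            h10Norm M ≤ C * tensorL2Norm (frozenDefect lam mu y Nt) ∧
            IsNeumannColumn lam mu y k (fun i x => Nt i x + M i x) ∧
            (∀ N : Fin 3 → E3 → ℝ, IsNeumannColumn lam mu y k N →
              VecMemH10 (fun i x => N i x - Nt i x) →
              ∀ i, N i =ᵐ[halfVol] fun x => Nt i x + M i x) := by
  have hc : 0 < min (2 * α₀) β₀ := lt_min (by positivity) hβ
  -- Korn's constant divided by the square of the coercivity constant of `ℂ`; `K` does not enter.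
  refine ⟨Real.sqrt (1260 / min (2 * α₀) β₀ ^ 2), by positivity, fun lam mu ha y hy k => ⟨?_, ?_⟩⟩
  · obtain ⟨N, hN, -⟩ := exists_neumannColumn_const hα hβ (ha.frozen hy) hy k
    exact ⟨N, hN⟩
  · intro Nt hNt
    have hF := ha.frozenDefect_memL2 hα hβ hy hNt
    obtain ⟨M, hM⟩ := ha.exists_variationalSolution hα hβ hF
    refine ⟨hF, M, hM, fun M' hM' i => hM.ae_eq ha hα hβ hM' i, hM.h10Norm_le ha hα hβ hF,
      hNt.add ha hy hF hM, fun N hN hsub i => ?_⟩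
    -- A competing column minus the frozen one solves the same variational problem as `M`, so
    -- uniqueness there settles uniqueness here.
    filter_upwards [hM.ae_eq ha hα hβ (hN.isVariationalSolution_sub ha hy hNt hF hsub) i] with x hx
    rw [← hx]
    ring
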